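/- Let $n\ge 0$, let $\mathbb T^n=\mathbb R^n/\mathbb Z^n$, let $\mathcal F=\mathcal F(\mathbb T^n)$ be the complex algebra with basis the Fourier exponentials $e^{2\pi i m\cdot x}$ ($m\in\mathbb Z^n$), and let $W_n$ be the Lie algebra of vector fields on $\mathbb T^n$ with coefficients in $\mathcal F$, with basis $d_j(s)=\frac1{2\pi i}e^{2\pi i s\cdot x}\frac{\partial}{\partial x^j}$ ($s\in\mathbb Z^n$, $1\le j\le n$); put $d_j=d_j(0)$. A complex $W_n$-module $J$ which is also an $\mathcal F$-module belongs to the category $\mathcal J$ if $d_1,\dots,d_n$ act diagonalizably on $J$ (that is, $J$ is spanned by common eigenvectors of $d_1,\dots,d_n$), $J$ is a free $\mathcal F$-module of finite rank, and $X(fw)=(Xf)w+f(Xw)$ for all $X\in W_n$, $f\in\mathcal F$, $w\in J$. Submodules and isomorphisms in $\mathcal J$ are those compatible with both $W_n$ and $\mathcal F$; indecomposable and irreducible modules are nonzero. Let $W_n^+$ be the Lie algebra of derivations of $\mathbb C[z_1,\dots,z_n]$ spanned by the $z^\alpha\frac{\partial}{\partial z_j}$ with $\alpha\in\mathbb Z_+^n\setminus\{0\}$,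 $1\le j\le n$. Modules are considered up to isomorphism in the 1-1 correspondences below. (a) Let $J\in\mathcal J$ be indecomposable. Then some weight space $J_\lambda=\{w\in J: d_jw=\lambda_jw \text{ for all } j\}$, $\lambda\in\mathbb C^n$, is nonzero. For every $\lambda$ with $U:=J_\lambda\ne0$: $U$ is finite-dimensional; the map $\mathcal F\otimes U\to J$, $f\otimes v\mapsto fv$, is an isomorphism of $\mathcal F$-modules; there are unique operators $D_j(s)\in\mathrm{End}\,U$ with $d_j(s)v=e^{2\pi i s\cdot x}D_j(s)v$ for all $v\in U$, $s\in\mathbb Z^n$, $1\le j\le n$; these are polynomial in $s$ and have a unique finite expansion $$D_j(s)=\lambda_j\,\mathrm{Id}+\sum_{\alpha\in\mathbb Z_+^n\setminus\{0\}}\frac{s^\alpha}{\alpha!}D_j^{(\alpha)},\qquad D_j^{(\alpha)}\in\mathrm{End}\,U;$$ and $\rho\big(z^\alpha\frac{\partial}{\partial z_j}\big)=D_j^{(\alpha)}$ ($\alpha\neq 0$) defines a (unique) representation $\rho$ of the Lie algebra $W_n^+$ on $U$. (b) If $(U,\rho)$ is a finite-dimensional $W_n^+$-module, then for each $j$ one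 has $\rho\big(z^\beta\frac{\partial}{\partial z_j}\big)=0$ for all but finitely many $\beta$. There is a 1-1 correspondence between indecomposable modules $J$ in $\mathcal J$ and pairs $(\lambda,U)$ with $\lambda\in\mathbb C^n/\mathbb Z^n$ and $U$ an indecomposable finite-dimensional $W_n^+$-module. For every representative $\lambda\in\mathbb C^n$, the module $J$ corresponds to $(\lambda,U)$ if and only if $J\cong\mathcal F\otimes U$ as an $\mathcal F$-module, with $W_n$ acting by $$d_j(s)\big(e^{2\pi i m\cdot x}v\big)=(m_j+\lambda_j)e^{2\pi i(m+s)\cdot x}v+\sum_{\beta\in\mathbb Z_+^n\setminus\{0\}}\frac{s^\beta}{\beta!}\,e^{2\pi i(m+s)\cdot x}\rho\Big(z^\beta\frac{\partial}{\partial z_j}\Big)v.$$ (c) There is a 1-1 correspondence between irreducible modules $J$ in $\mathcal J$ and pairs $(\lambda,V)$ with $\lambda\in\mathbb C^n/\mathbb Z^n$ and $(V,\rho)$ an irreducible finite-dimensional $gl_n(\mathbb C)$-module. For every representative $\lambda\in\mathbb C^n$, the module $J$ corresponds to $(\lambda,V)$ if and only if $J\cong\mathcal F\otimes V$ as an $\mathcal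 F$-module, with $W_n$ acting by $$d_j(s)\big(e^{2\pi i m\cdot x}v\big)=(m_j+\lambda_j)e^{2\pi i(m+s)\cdot x}v+\sum_{p=1}^n s_p\,e^{2\pi i(m+s)\cdot x}\rho(E^p_j)v,$$ where $E^p_j$ is the elementary matrix with $1$ in position $(p,j)$. -/

import Mathlib

open scoped TensorProduct

universe u

attribute [local instance 100] LieRing.ofAssociativeRing

noncomputable section

namespace JetModules

/-! ### Functions and vector fields on the torus -/

/-- The algebra of functions on the `n`-dimensional torus `ℝⁿ / ℤⁿ` whose basis consists of the
Fourier exponentials `e^{2πi m·x}`, `m ∈ ℤⁿ`, i.e. the group algebra `ℂ[ℤⁿ]`. -/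
abbrev TorusFun (n : ℕ) : Type := AddMonoidAlgebra ℂ (Fin n → ℤ)

/-- The Fourier basis function `e^{2πi m·x}`. -/
def fexp {n : ℕ} (m : Fin n → ℤ) : TorusFun n := AddMonoidAlgebra.single m 1

/-- The Lie algebra `W_n` of vector fields on the torus: the derivations of the algebra of
functions, with the commutator bracket. -/
abbrev W (n : ℕ) : Type := Derivation ℂ (TorusFun n) (TorusFun n)

/-- The operator `(1/2πi) ∂/∂x^j` on functions: `e^{2πi m·x} ↦ m_j e^{2πi m·x}`. -/
def partialLin {n : ℕ} (j : Fin n) : TorusFun n →ₗ[ℂ] TorusFun n :=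
  (Finsupp.lsum ℂ fun m : Fin n → ℤ =>
    ((m j : ℂ) • AddMonoidAlgebra.lsingle (R := ℂ) (S := ℂ) m : ℂ →ₗ[ℂ] TorusFun n)) ∘ₗ
    (AddMonoidAlgebra.coeffLinearEquiv ℂ).toLinearMap

theorem partialLin_single {n : ℕ} (j : Fin n) (m : Fin n → ℤ) (a : ℂ) :
    partialLin j (AddMonoidAlgebra.single m a) = AddMonoidAlgebra.single m ((m j : ℂ) * a) := by
  simp [partialLin]

/-- The vector field `d_j = (1/2πi) ∂/∂x^j`. -/
def dPartial {n : ℕ} (j : Fin n) : W n :=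
  Derivation.mk' (partialLin j) (by
    intro a b
    induction a using AddMonoidAlgebra.induction_linear with
    | zero => simp
    | add f g hf hg =>
      rw [add_mul, map_add, hf, hg, map_add, add_smul, smul_add]; abel
    | single m x =>
      induction b using AddMonoidAlgebra.induction_linear with
      | zero => simp
      | add f g hf hg =>
        rw [mul_add, map_add, hf, hg, map_add, add_smul, smul_add]; abel
      | single k y =>
        simp only [smul_eq_mul, AddMonoidAlgebra.single_mul_single, partialLin_single, Pi.add_apply,
          add_comm k m, ← AddMonoidAlgebra.single_add]
        congr 1
        push_cast
        ring)

/-- The vector field `d_j(s) = (1/2πi) e^{2πi s·x} ∂/∂x^j`. -/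
def dField {n : ℕ} (j : Fin n) (s : Fin n → ℤ) : W n := fexp s • dPartial j

theorem dField_fexp {n : ℕ} (j : Fin n) (s m : Fin n → ℤ) :
    dField j s (fexp m) = (m j : ℂ) • fexp (s + m) := by
  simp [dField, fexp, dPartial, partialLin_single, AddMonoidAlgebra.single_mul_single]

/-! ### The category of modules over both the functions and the vector fields -/

/-- A module in the category `𝒥`: a `W_n`-module over `ℂ` which is also a module over the algebra
of functions (with the same underlying complex vector space) such that the `d_j` act
diagonalizably, it is free of finite rank over the functions, and `W_n` acts by derivations. -/
structure JMod (n : ℕ) where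
  carrier : Type u
  [addCommGroup : AddCommGroup carrier]
  [module : Module ℂ carrier]
  [funModule : Module (TorusFun n) carrier]
  [isScalarTower : IsScalarTower ℂ (TorusFun n) carrier]
  [lieRingModule : LieRingModule (W n) carrier]
  [lieModule : LieModule ℂ (W n) carrier]
  /-- The common eigenvectors of `d_1, …, d_n` span the module. -/
  diagonalizable :
    Submodule.span ℂ {w : carrier | ∃ μ : Fin n → ℂ, ∀ j, ⁅dPartial j, w⁆ = μ j • w} = ⊤
  free : Module.Free (TorusFun n) carrier
  finite : Module.Finite (TorusFun n) carrier
  leibniz : ∀ (X : W n) (f : TorusFun n) (w : carrier), ⁅X, f • w⁆ = X f • w + f • ⁅X, w⁆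

namespace JMod

attribute [instance] addCommGroup module funModule isScalarTower lieRingModule lieModule

instance instCoeSort (n : ℕ) : CoeSort (JMod.{u} n) (Type u) := ⟨carrier⟩

variable {n : ℕ}

/-- Submodules in `𝒥` are the subspaces stable under both `W_n` and the functions. -/
def IsStable (J : JMod.{u} n) (P : Submodule (TorusFun n) J) : Prop :=
  ∀ (X : W n), ∀ w ∈ P, ⁅X, w⁆ ∈ P

/-- Nonzero, and not a direct sum of two nonzero submodules. -/
def Indecomposable (J : JMod.{u} n) : Prop :=
  Nontrivial J ∧ ∀ P Q : Submodule (TorusFun n) J, J.IsStable P → J.IsStable Q →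
    IsCompl P Q → P = ⊥ ∨ Q = ⊥

/-- Nonzero, and without submodules other than zero and itself. -/
def Irreducible (J : JMod.{u} n) : Prop :=
  Nontrivial J ∧ ∀ P : Submodule (TorusFun n) J, J.IsStable P → P = ⊥ ∨ P = ⊤

/-- Isomorphism in `𝒥`: a bijection linear over the functions and commuting with `W_n`. -/
def Iso (J K : JMod.{u} n) : Prop :=
  ∃ φ : J ≃ₗ[TorusFun n] K, ∀ (X : W n) (w : J), φ ⁅X, w⁆ = ⁅X, φ w⁆

theorem iso_equivalence : Equivalence (Iso (n := n)) where
  refl _ := ⟨LinearEquiv.refl _ _, fun _ _ => rfl⟩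
  symm := by
    rintro J K ⟨φ, h⟩
    exact ⟨φ.symm, fun X w => φ.injective (by simp [h])⟩
  trans := by
    rintro J K L ⟨φ, h⟩ ⟨ψ, k⟩
    exact ⟨φ.trans ψ, fun X w => by simp [h, k]⟩

/-- Isomorphism as an equivalence relation on the modules in `𝒥` with property `p`. -/
def isoSetoid (p : JMod.{u} n → Prop) : Setoid {J : JMod.{u} n // p J} where
  r J K := Iso J.1 K.1
  iseqv := ⟨fun J => iso_equivalence.refl J.1, fun h => iso_equivalence.symm h,
    fun h k => iso_equivalence.trans h k⟩

/-- Isomorphism classes of modules in `𝒥` with property `p`. -/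
def IsoClass (p : JMod.{u} n → Prop) : Type (u + 1) := Quotient (isoSetoid p)

/-- The isomorphism class of a module. -/
def isoClass {p : JMod.{u} n → Prop} (J : {J : JMod.{u} n // p J}) : IsoClass p :=
  Quotient.mk (isoSetoid p) J

/-- The weight space `J_μ = {w | d_j w = μ_j w for all j}`. -/
def weightSpace (J : JMod.{u} n) (μ : Fin n → ℂ) : Submodule ℂ J where
  carrier := {w | ∀ j, ⁅dPartial j, w⁆ = μ j • w}
  add_mem' ha hb j := by rw [lie_add, ha j, hb j, smul_add]
  zero_mem' j := by simp
  smul_mem' c w hw j := by rw [lie_smul, hw j, smul_comm]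

end JMod

/-! ### Finite-dimensional modules over a complex Lie algebra -/

/-- A finite-dimensional module over the complex Lie algebra `L`. -/
structure FDMod (L : Type) [LieRing L] [LieAlgebra ℂ L] where
  carrier : Type u
  [addCommGroup : AddCommGroup carrier]
  [module : Module ℂ carrier]
  [lieRingModule : LieRingModule L carrier]
  [lieModule : LieModule ℂ L carrier]
  finiteDimensional : FiniteDimensional ℂ carrier

namespace FDMod

attribute [instance] addCommGroup module lieRingModule lieModule finiteDimensional

variable {L : Type} [LieRing L] [LieAlgebra ℂ L]

instance instCoeSort (L : Type) [LieRing L] [LieAlgebra ℂ L] :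
    CoeSort (FDMod.{u} L) (Type u) := ⟨carrier⟩

/-- Nonzero, and not a direct sum of two nonzero submodules. -/
def Indecomposable (U : FDMod.{u} L) : Prop :=
  Nontrivial U ∧ ∀ P Q : LieSubmodule ℂ L U, IsCompl P Q → P = ⊥ ∨ Q = ⊥

/-- Nonzero, and without submodules other than zero and itself. -/
def Irreducible (U : FDMod.{u} L) : Prop := LieModule.IsIrreducible ℂ L U

/-- Isomorphism as an equivalence relation on the modules with property `p`. -/
def isoSetoid (p : FDMod.{u} L → Prop) : Setoid {U : FDMod.{u} L // p U} where
  r U V := Nonempty (U.1 ≃ₗ⁅ℂ,L⁆ V.1)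
  iseqv := ⟨fun _ => ⟨LieModuleEquiv.refl⟩, fun ⟨e⟩ => ⟨e.symm⟩, fun ⟨e⟩ ⟨f⟩ => ⟨e.trans f⟩⟩

/-- Isomorphism classes of finite-dimensional `L`-modules with property `p`. -/
def IsoClass (p : FDMod.{u} L → Prop) : Type (u + 1) := Quotient (isoSetoid p)

/-- The isomorphism class of a module. -/
def isoClass {p : FDMod.{u} L → Prop} (U : {U : FDMod.{u} L // p U}) : IsoClass p :=
  Quotient.mk (isoSetoid p) U

end FDMod

/-! ### The Lie algebra `W_n^+` -/

/-- The derivation `z^α ∂/∂z_j` of `ℂ[z_1, …, z_n]`. -/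
def zField {n : ℕ} (α : Fin n →₀ ℕ) (j : Fin n) :
    Derivation ℂ (MvPolynomial (Fin n) ℂ) (MvPolynomial (Fin n) ℂ) :=
  MvPolynomial.monomial α (1 : ℂ) • MvPolynomial.pderiv j

theorem zField_lie {n : ℕ} (α β : Fin n →₀ ℕ) (j k : Fin n) :
    ⁅zField α j, zField β k⁆ =
      (β j : ℂ) • zField (α + (β - Finsupp.single j 1)) k
        - (α k : ℂ) • zField (β + (α - Finsupp.single k 1)) j := by
  classical
  apply MvPolynomial.derivation_ext
  intro i
  simp only [zField, Derivation.commutator_apply, Derivation.sub_apply, Derivation.smul_apply,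
    MvPolynomial.pderiv_X, Pi.single_apply]
  by_cases hk : k = i <;> by_cases hj : j = i <;>
    simp [hk, hj, eq_comm, MvPolynomial.pderiv_monomial, MvPolynomial.monomial_mul,
      MvPolynomial.smul_monomial]

/-- `W_n^+`, the span of the `z^α ∂/∂z_j` with `α ≠ 0`. -/
def WPlus (n : ℕ) :
    LieSubalgebra ℂ (Derivation ℂ (MvPolynomial (Fin n) ℂ) (MvPolynomial (Fin n) ℂ)) where
  toSubmodule := Submodule.span ℂ {D | ∃ (α : Fin n →₀ ℕ) (j : Fin n), α ≠ 0 ∧ D = zField α j}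
  lie_mem' := by
    intro x y hx hy
    induction hx, hy using Submodule.span_induction₂ with
    | mem_mem x y hx hy =>
      obtain ⟨α, j, hα, rfl⟩ := hx
      obtain ⟨β, k, hβ, rfl⟩ := hy
      rw [zField_lie]
      refine Submodule.sub_mem _ (Submodule.smul_mem _ _ (Submodule.subset_span ⟨_, _, ?_, rfl⟩))
        (Submodule.smul_mem _ _ (Submodule.subset_span ⟨_, _, ?_, rfl⟩))
      · simp [hα]
      · simp [hβ]
    | zero_left y hy => simp
    | zero_right x hx => simp
    | add_left x y z _ _ _ h1 h2 => rw [add_lie]; exact Submodule.add_mem _ h1 h2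
    | add_right x y z _ _ _ h1 h2 => rw [lie_add]; exact Submodule.add_mem _ h1 h2
    | smul_left r x y _ _ h => rw [smul_lie]; exact Submodule.smul_mem _ _ h
    | smul_right r x y _ _ h => rw [lie_smul]; exact Submodule.smul_mem _ _ h

/-- The nonzero multi-indices `α ∈ ℤ₊ⁿ`. -/
abbrev PosIndex (n : ℕ) : Type := {α : Fin n →₀ ℕ // α ≠ 0}

/-- The element `z^α ∂/∂z_j` of `W_n^+`, for `α ≠ 0`. -/
def zPlus {n : ℕ} (α : PosIndex n) (j : Fin n) : WPlus n :=
  ⟨zField α.1 j, Submodule.subset_span ⟨α.1, j, α.2, rfl⟩⟩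

/-! ### The structure operators and the explicit actions -/

/-- `s^α / α!` for `s ∈ ℤⁿ` and a multi-index `α`. -/
def powFact {n : ℕ} (s : Fin n → ℤ) (α : Fin n →₀ ℕ) : ℂ :=
  (∏ i, (s i : ℂ) ^ α i) / (∏ i, (Nat.factorial (α i) : ℂ))

/-- The operators `D_j(s)` on `U = J_μ` are those with `d_j(s) v = e^{2πi s·x} D_j(s) v`. -/
def IsStructureOps {n : ℕ} (J : JMod.{u} n) (μ : Fin n → ℂ)
    (D : Fin n → (Fin n → ℤ) → Module.End ℂ (J.weightSpace μ)) : Prop :=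
  ∀ (j : Fin n) (s : Fin n → ℤ) (v : J.weightSpace μ),
    ⁅dField j s, (v : J)⁆ = fexp s • ((D j s v : J.weightSpace μ) : J)

/-- `D_j(s) = ∑_α (s^α / α!) D_j^{(α)}`, a finite sum, for all `j` and all `s ∈ ℤⁿ`: the operators
`D_j(s)` depend polynomially on `s` and their Taylor coefficients are the `T j α = D_j^{(α)}`. -/
def IsTaylorExpansion {n : ℕ} {U : Type u} [AddCommGroup U] [Module ℂ U]
    (D : Fin n → (Fin n → ℤ) → Module.End ℂ U)
    (T : Fin n → ((Fin n →₀ ℕ) →₀ Module.End ℂ U)) : Prop :=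
  ∀ (j : Fin n) (s : Fin n → ℤ), D j s = (T j).sum fun α A => powFact s α • A

/-- `J` is the tensor product of the functions with `U`, where `W_n` acts by
`d_j(s)(e^{2πi m·x} v) = (m_j + λ_j) e^{2πi (m+s)·x} v
  + ∑_{β > 0} (s^β / β!) e^{2πi (m+s)·x} ρ(z^β ∂/∂z_j) v`. -/
def IsJetTensor {n : ℕ} (lam : Fin n → ℂ) (U : FDMod.{u} (WPlus n)) (J : JMod.{u} n) : Prop :=
  ∃ Φ : (TorusFun n ⊗[ℂ] U) ≃ₗ[TorusFun n] J,
    ∀ (j : Fin n) (s m : Fin n → ℤ) (v : U),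
      ⁅dField j s, Φ (fexp m ⊗ₜ[ℂ] v)⁆ =
        Φ (((m j : ℂ) + lam j) • (fexp (m + s) ⊗ₜ[ℂ] v)
          + fexp (m + s) ⊗ₜ[ℂ] (∑ᶠ β : PosIndex n, powFact s β.1 • ⁅zPlus β j, v⁆))

/-- `gl_n(ℂ)`; the elementary matrix `E^p_j`, with `1` in position `(p, j)`, is
`Matrix.single p j 1`. -/
abbrev Gl (n : ℕ) : Type := Matrix (Fin n) (Fin n) ℂ

/-- `J` is the tensor product of the functions with `V`, where `W_n` acts by
`d_j(s)(e^{2πi m·x} v) = (m_j + λ_j) e^{2πi (m+s)·x} v + ∑_p s_p e^{2πi (m+s)·x} ρ(E^p_j) v`. -/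
def IsTensorFieldModule {n : ℕ} (lam : Fin n → ℂ) (V : FDMod.{u} (Gl n)) (J : JMod.{u} n) :
    Prop :=
  ∃ Φ : (TorusFun n ⊗[ℂ] V) ≃ₗ[TorusFun n] J,
    ∀ (j : Fin n) (s m : Fin n → ℤ) (v : V),
      ⁅dField j s, Φ (fexp m ⊗ₜ[ℂ] v)⁆ =
        Φ (((m j : ℂ) + lam j) • (fexp (m + s) ⊗ₜ[ℂ] v)
          + ∑ p, (s p : ℂ) • (fexp (m + s) ⊗ₜ[ℂ] ⁅(Matrix.single p j 1 : Gl n), v⁆))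

/-- The subgroup `ℤⁿ` of `ℂⁿ`. -/
def intLattice (n : ℕ) : AddSubgroup (Fin n → ℂ) :=
  ((Int.castAddHom ℂ).compLeft (Fin n)).range

/-- `ℂⁿ / ℤⁿ`. -/
abbrev WeightCoset (n : ℕ) : Type := (Fin n → ℂ) ⧸ intLattice n

end JetModules

end

open JetModules

noncomputable section

namespace JetModules

variable {n : ℕ}

/-! ### Fourier exponentials and the spanning vector fields -/

/-! A module in `𝒥` is determined by one weight space and the operators induced on it.
Multiplication by `e^{2πi m·x}` identifies `J_λ` with `J_{λ+m}`, and `W_n` shifts weights by integer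
vectors only. So the weight spaces over one coset of `ℤⁿ` span a submodule, complemented by the span
of the others. An indecomposable `J` thus lives on a single coset and equals `ℱ ⊗ U` with `U = J_λ`
(`weightMap_injective`, `Indecomposable.weightMap_surjective`), and `U` is finite-dimensional
because base change preserves rank. The action of `W_n` is then encoded by the operators `D_j(s) =
e^{-2πi s·x} d_j(s)` on `U`, subject to the relations `IsJetFamily`.

The heart of the matter is that `D_j(s)` is polynomial in `s`. Extend `D_j` linearly from
exponentials to functions `f`. On functions vanishing at the origin the relations say that `f d_j ↦
D_j(f)` represents the Lie algebra of vector fields vanishing there (`IsJetFamily.comm_linExt`). Let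
`x_k` be the exponential of the `k`-th basis vector. As `End U` is finite-dimensional, the
polynomials `p` with `p(x_k)` in `annIdeal` form a nonzero ideal. Bracketing with `(x_k - 1) d_k`
shows that its generator `q` divides `(X - 1) q'`, so `1` is the only possible root of `q` and a
power of `x_k - 1` lies in `annIdeal`. Every `D_j` therefore factors through `ℱ / ((x_k - 1)^N)_k`.
There the `x_k` are unipotent, and `e^{2πi s·x} = ∏ x_k^{s_k}` is polynomial in `s` by the binomial
series (`exists_taylor_of_annihilates`).

When the constant terms are scalars, comparing coefficients of `s^α m^β` turns the relations of the
`D_j(s)` into the brackets of `W_n^+`, in both directions (`isJetFamily_iff`). One direction gives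
the representation on `U`. For the other, the Euler field bounds the degrees acting nontrivially on
a finite-dimensional `W_n^+`-module, so the series for `D_j(s)` is finite and makes `ℱ ⊗ U` an
object of `𝒥`. Stable submodules of `ℱ ⊗ U` correspond to `W_n^+`-stable subspaces of `U`, changing
`λ` by `ℤⁿ` amounts to multiplying by an exponential, and `U` is recovered as `J_λ`. This yields the
bijection for indecomposables.

If `U` is irreducible, an eigenvector of the Euler field whose eigenvalue has maximal real part is
killed by all `z^α ∂_j` with `|α| ≥ 2`. These fields span an ideal, so the vectors they kill form a
submodule, which must be all of `U`. The action then factors through the linear part `W_n^+ → gl_n`,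
which gives the bijection for irreducibles. -/

theorem fexp_add (s m : Fin n → ℤ) : fexp (s + m) = fexp s * fexp m := by
  simp [fexp, AddMonoidAlgebra.single_mul_single]

theorem fexp_zero : fexp (0 : Fin n → ℤ) = 1 := rfl

theorem span_fexp : Submodule.span ℂ (Set.range (fexp (n := n))) = ⊤ := by
  refine eq_top_iff.2 fun f _ => ?_
  induction f using AddMonoidAlgebra.induction_linear with
  | zero => exact Submodule.zero_mem _
  | add f g hf hg => exact Submodule.add_mem _ (hf trivial) (hg trivial)
  | single m x =>
    have : (AddMonoidAlgebra.single m x : TorusFun n) = x • fexp m := by simp [fexp]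
    rw [this]
    exact Submodule.smul_mem _ _ (Submodule.subset_span ⟨m, rfl⟩)

/-- Induction over the functions on the torus: linear statements are checked on exponentials. -/
theorem fexp_induction {p : TorusFun n → Prop} (f : TorusFun n) (hexp : ∀ m, p (fexp m))
    (h0 : p 0) (hadd : ∀ f g, p f → p g → p (f + g)) (hsmul : ∀ (c : ℂ) f, p f → p (c • f)) :
    p f := by
  have hf : f ∈ Submodule.span ℂ (Set.range (fexp (n := n))) := by rw [span_fexp]; trivial
  induction hf using Submodule.span_induction with
  | mem x hx => obtain ⟨m, rfl⟩ := hx; exact hexp m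
  | zero => exact h0
  | add x y _ _ hx hy => exact hadd x y hx hy
  | smul c x _ hx => exact hsmul c x hx

theorem linearMap_ext_fexp {V : Type*} [AddCommMonoid V] [Module ℂ V] {R S : TorusFun n →ₗ[ℂ] V}
    (h : ∀ m, R (fexp m) = S (fexp m)) : R = S := by
  refine LinearMap.ext_on_range (v := fexp (n := n)) span_fexp h

theorem dPartial_fexp (j : Fin n) (m : Fin n → ℤ) :
    dPartial j (fexp m) = (m j : ℂ) • fexp m := by
  simp [dPartial, fexp, partialLin_single]

theorem dField_zero (j : Fin n) : dField j 0 = dPartial j := by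
  simp [dField, fexp_zero]

theorem derivation_ext_fexp {X Y : W n} (h : ∀ m, X (fexp m) = Y (fexp m)) : X = Y :=
  Derivation.ext fun f => LinearMap.congr_fun
    (linearMap_ext_fexp (R := X.toLinearMap) (S := Y.toLinearMap) h) f

/-- By the Leibniz rule the logarithmic derivative `m ↦ e^{-2πi m·x} X(e^{2πi m·x})` is additive, so
its values on the standard basis of `ℤⁿ` determine it. -/
theorem derivation_apply_fexp (X : W n) (m : Fin n → ℤ) :
    X (fexp m) = fexp m * ∑ j, (m j : ℂ) • (fexp (-Pi.single j 1) * X (fexp (Pi.single j 1))) := by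
  let L : (Fin n → ℤ) →+ TorusFun n :=
    { toFun := fun m => fexp (-m) * X (fexp m)
      map_zero' := by simp [fexp_zero]
      map_add' := fun s m => by
        have hs : fexp (-s) * fexp s = 1 := by rw [← fexp_add, neg_add_cancel, fexp_zero]
        have hm : fexp (-m) * fexp m = 1 := by rw [← fexp_add, neg_add_cancel, fexp_zero]
        rw [neg_add, fexp_add, fexp_add, Derivation.leibniz, smul_eq_mul, smul_eq_mul]
        linear_combination (fexp (-m) * X (fexp m)) * hs + (fexp (-s) * X (fexp s)) * hm }
  have key : L m = ∑ j, (m j) • L (Pi.single j 1) := by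
    conv_lhs => rw [← Finset.univ_sum_single m]
    rw [map_sum]
    refine Finset.sum_congr rfl fun j _ => ?_
    rw [← map_zsmul, ← Pi.single_smul]
    simp
  have hm : fexp m * fexp (-m) = 1 := by rw [← fexp_add, add_neg_cancel, fexp_zero]
  have : X (fexp m) = fexp m * L m := by
    change _ = fexp m * (fexp (-m) * X (fexp m))
    rw [← mul_assoc, hm, one_mul]
  rw [this, key]
  congr 1
  refine Finset.sum_congr rfl fun j _ => ?_
  rw [Int.cast_smul_eq_zsmul]
  rfl

/-- The `j`-th coefficient of a vector field. -/
def coord (X : W n) (j : Fin n) : TorusFun n := fexp (-Pi.single j 1) * X (fexp (Pi.single j 1))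

theorem eq_sum_coord (X : W n) : X = ∑ j, coord X j • dPartial j := by
  refine derivation_ext_fexp fun m => ?_
  have hsum : (∑ j, coord X j • dPartial j : W n) (fexp m) =
      ∑ j, (coord X j • dPartial j : W n) (fexp m) := by
    simp only [← Derivation.coeFnAddMonoidHom_apply, map_sum, Finset.sum_apply]
  rw [derivation_apply_fexp, hsum, Finset.mul_sum]
  refine Finset.sum_congr rfl fun j _ => ?_
  simp only [Derivation.smul_apply, dPartial_fexp, smul_eq_mul, coord]
  rw [mul_smul_comm, mul_smul_comm, mul_comm (fexp m)]

theorem coord_dField (i j : Fin n) (s : Fin n → ℤ) :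
    coord (dField i s) j = if i = j then fexp s else 0 := by
  rw [coord, dField_fexp]
  split_ifs with h
  · subst h
    simp [← fexp_add]
  · simp [h]

theorem span_dField :
    Submodule.span ℂ {X : W n | ∃ (j : Fin n) (s : Fin n → ℤ), X = dField j s} = ⊤ := by
  refine eq_top_iff.2 fun X _ => ?_
  rw [eq_sum_coord X]
  refine Submodule.sum_mem _ fun j _ => ?_
  induction coord X j using fexp_induction with
  | hexp m => exact Submodule.subset_span ⟨j, m, rfl⟩
  | h0 => rw [zero_smul]; exact Submodule.zero_mem _
  | hadd f g hf hg => rw [add_smul]; exact Submodule.add_mem _ hf hg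
  | hsmul c f hf => rw [smul_assoc]; exact Submodule.smul_mem _ _ hf

/-- Linear statements about vector fields are checked on the fields `d_j(s)`. -/
theorem dField_induction {p : W n → Prop} (X : W n) (hd : ∀ j s, p (dField j s))
    (h0 : p 0) (hadd : ∀ X Y, p X → p Y → p (X + Y)) (hsmul : ∀ (c : ℂ) X, p X → p (c • X)) :
    p X := by
  have hX : X ∈ Submodule.span ℂ {X : W n | ∃ (j : Fin n) (s : Fin n → ℤ), X = dField j s} := by
    rw [span_dField]; trivial
  induction hX using Submodule.span_induction with
  | mem x hx => obtain ⟨j, s, rfl⟩ := hx; exact hd j s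
  | zero => exact h0
  | add x y _ _ hx hy => exact hadd x y hx hy
  | smul c x _ hx => exact hsmul c x hx

theorem lie_dField (i j : Fin n) (s m : Fin n → ℤ) :
    ⁅dField i s, dField j m⁆ = (m i : ℂ) • dField j (s + m) - (s j : ℂ) • dField i (s + m) := by
  refine derivation_ext_fexp fun k => ?_
  rw [Derivation.commutator_apply, Derivation.sub_apply, Derivation.smul_apply,
    Derivation.smul_apply]
  simp only [dField_fexp, Derivation.map_smul, smul_smul]
  have h1 : s + (m + k) = s + m + k := by abel
  have h2 : m + (s + k) = s + m + k := by abel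
  rw [h1, h2, ← sub_smul, ← sub_smul]
  congr 1
  simp only [Pi.add_apply]
  push_cast
  ring

/-! ### Separation of simultaneous eigenvectors -/

/-- The eigenvectors other than `x a` are eliminated one at a time. Their characters may coincide
with one another; only the difference from `χ a` matters. -/
theorem mem_of_add_sum_mem {ι κ V : Type*} [AddCommGroup V] [Module ℂ V] (T : ι → Module.End ℂ V)
    (P : Submodule ℂ V) (hP : ∀ i, ∀ v ∈ P, T i v ∈ P) (χ : κ → ι → ℂ) (a : κ) (S : Finset κ)
    (hS : ∀ b ∈ S, χ b ≠ χ a) (x : κ → V) (hx : ∀ b i, T i (x b) = χ b i • x b)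
    (h : x a + ∑ b ∈ S, x b ∈ P) : x a ∈ P := by
  classical
  induction S using Finset.induction_on generalizing x with
  | empty => simpa using h
  | insert b S hb ih =>
    obtain ⟨i, hi⟩ : ∃ i, χ b i ≠ χ a i := by
      by_contra! hc
      exact hS b (Finset.mem_insert_self _ _) (funext hc)
    -- Applying `T i - χ b i` kills `x b`, multiplies `x a` by a nonzero scalar and rescales the
    -- remaining eigenvectors.
    have key : (χ a i - χ b i) • x a + ∑ c ∈ S, (χ c i - χ b i) • x c ∈ P := by
      have := P.sub_mem (hP i _ h) (P.smul_mem (χ b i) h)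
      rw [Finset.sum_insert hb, map_add, map_add, map_sum, hx a, hx b, smul_add, smul_add,
        Finset.smul_sum] at this
      simp only [hx, sub_smul, Finset.sum_sub_distrib] at this ⊢
      convert this using 1
      abel
    have := ih (fun c hc => hS c (Finset.mem_insert_of_mem hc))
      (fun c => (χ c i - χ b i) • x c)
      (fun c k => by rw [map_smul, hx, smul_comm]) key
    exact (P.smul_mem_iff (sub_ne_zero.2 hi.symm)).1 this

theorem mem_of_sum_mem {ι κ V : Type*} [AddCommGroup V] [Module ℂ V] (T : ι → Module.End ℂ V)
    (P : Submodule ℂ V) (hP : ∀ i, ∀ v ∈ P, T i v ∈ P) (χ : κ → ι → ℂ)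
    (hχ : Function.Injective χ) (S : Finset κ) (x : κ → V)
    (hx : ∀ b i, T i (x b) = χ b i • x b) (h : ∑ b ∈ S, x b ∈ P) {a : κ} (ha : a ∈ S) :
    x a ∈ P := by
  classical
  refine mem_of_add_sum_mem T P hP χ a (S.erase a)
    (fun b hb hc => (Finset.mem_erase.1 hb).1 (hχ hc)) x hx ?_
  rwa [Finset.add_sum_erase _ _ ha]

namespace JMod

/-! ### Weight spaces -/

variable (J : JMod.{u} n)

/-- The character `m ↦ (m_1, …, m_n)` of the integral lattice. -/
def intVec (m : Fin n → ℤ) : Fin n → ℂ := fun j => (m j : ℂ)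

theorem intVec_add (s m : Fin n → ℤ) : intVec (s + m) = intVec s + intVec m := by
  ext j; simp [intVec]

theorem intVec_neg (s : Fin n → ℤ) : intVec (-s) = -intVec s := by
  ext j; simp [intVec]

theorem intVec_zero : intVec (0 : Fin n → ℤ) = 0 := by
  ext j; simp [intVec]

theorem intVec_injective : Function.Injective (intVec (n := n)) := fun s m h => by
  ext j; exact Int.cast_injective (congrFun h j)

theorem mem_intLattice {v : Fin n → ℂ} : v ∈ intLattice n ↔ ∃ m, intVec m = v := Iff.rfl

variable {J}

theorem field_smul_lie (c : ℂ) (X : W n) (w : J) : ⁅c • X, w⁆ = c • ⁅X, w⁆ := smul_lie c X w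

theorem fexp_smul_fexp_smul (s m : Fin n → ℤ) (w : J) :
    fexp s • fexp m • w = fexp (s + m) • w := by
  rw [smul_smul, fexp_add]

theorem fexp_neg_smul (s : Fin n → ℤ) (w : J) : fexp (-s) • fexp s • w = w := by
  rw [fexp_smul_fexp_smul, neg_add_cancel, fexp_zero, one_smul]

theorem fexp_smul_neg (s : Fin n → ℤ) (w : J) : fexp s • fexp (-s) • w = w := by
  rw [fexp_smul_fexp_smul, add_neg_cancel, fexp_zero, one_smul]

theorem fexp_smul_injective (s : Fin n → ℤ) : Function.Injective fun w : J => fexp s • w :=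
  Function.LeftInverse.injective (fexp_neg_smul s)

theorem smul_fun_comm (c : ℂ) (f : TorusFun n) (w : J) : f • c • w = c • f • w := by
  rw [← algebraMap_smul (TorusFun n) c w, smul_smul, mul_comm, ← smul_smul, algebraMap_smul]

theorem lie_dField_fexp_smul (j : Fin n) (s m : Fin n → ℤ) (w : J) :
    ⁅dField j s, fexp m • w⁆ = (m j : ℂ) • fexp (m + s) • w + fexp m • ⁅dField j s, w⁆ := by
  rw [J.leibniz, dField_fexp, add_comm s m, smul_assoc]

theorem fexp_smul_mem_weightSpace {μ : Fin n → ℂ} {w : J} (hw : w ∈ J.weightSpace μ)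
    (m : Fin n → ℤ) : fexp m • w ∈ J.weightSpace (μ + intVec m) := by
  intro j
  rw [← dField_zero, lie_dField_fexp_smul, dField_zero, hw j, add_zero, smul_fun_comm, ← add_smul,
    Pi.add_apply, add_comm]
  rfl

theorem lie_dField_mem_weightSpace {μ : Fin n → ℂ} {w : J} (hw : w ∈ J.weightSpace μ)
    (j : Fin n) (s : Fin n → ℤ) : ⁅dField j s, w⁆ ∈ J.weightSpace (μ + intVec s) := by
  intro i
  rw [leibniz_lie, ← dField_zero, lie_dField, dField_zero, hw i]
  simp only [zero_add, lie_smul, Pi.zero_apply, Int.cast_zero, zero_smul, sub_zero, Pi.add_apply,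
    add_smul, intVec]
  rw [add_comm, field_smul_lie]

variable (J) in
theorem iSup_weightSpace : ⨆ μ, J.weightSpace μ = ⊤ := by
  rw [eq_top_iff, ← J.diagonalizable, Submodule.span_le]
  rintro w ⟨μ, hw⟩
  exact Submodule.mem_iSup_of_mem μ hw

variable (J) in
/-- The operators by which the fields `d_1, …, d_n` act. -/
def dOp (j : Fin n) : Module.End ℂ J := LieModule.toEnd ℂ (W n) J (dPartial j)

variable (J) in
theorem iSupIndep_weightSpace : iSupIndep J.weightSpace := by
  rw [iSupIndep_iff_finsetSum_eq_zero_imp_eq_zero]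
  intro S x hx h0 i hi
  classical
  -- Nothing is known about `x` outside `S`, so it is replaced there by zero, an eigenvector for
  -- every character.
  have h := mem_of_sum_mem (dOp J) ⊥ (by simp) (fun μ : Fin n → ℂ => μ) Function.injective_id S
    (fun μ => if μ ∈ S then x μ else 0) (fun μ j => ?_) ?_ hi
  · simpa [hi] using h
  · split_ifs with hμ
    · exact hx μ hμ j
    · simp
  · rw [Submodule.mem_bot, ← h0]
    exact Finset.sum_congr rfl fun μ hμ => if_pos hμ

end JMod

/-! ### Linear extension from exponentials and the augmentation -/

/-- The linear map on the functions with prescribed values on the exponentials. -/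
def linExt {V : Type*} [AddCommGroup V] [Module ℂ V] (F : (Fin n → ℤ) → V) :
    TorusFun n →ₗ[ℂ] V :=
  (Finsupp.lsum ℂ fun m => LinearMap.toSpanSingleton ℂ V (F m)) ∘ₗ
    (AddMonoidAlgebra.coeffLinearEquiv ℂ).toLinearMap

@[simp]
theorem linExt_fexp {V : Type*} [AddCommGroup V] [Module ℂ V] (F : (Fin n → ℤ) → V)
    (m : Fin n → ℤ) : linExt F (fexp m) = F m := by
  simp [linExt, fexp]

/-- Evaluation of functions at the origin of the torus. -/
def aug : TorusFun n →ₐ[ℂ] ℂ := AddMonoidAlgebra.lift ℂ ℂ (Fin n → ℤ) 1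

@[simp]
theorem aug_fexp (m : Fin n → ℤ) : aug (fexp m) = 1 := by
  simp [aug, fexp]

/-! ### Families of operators satisfying the commutation relations of `d_j(s)` in degree zero -/

/-- The commutation relations of the operators `D_j(s) = e^{-2πi s·x} d_j(s)`. -/
def IsJetFamily {U : Type*} [AddCommGroup U] [Module ℂ U]
    (D : Fin n → (Fin n → ℤ) → Module.End ℂ U) : Prop :=
  ∀ i j s m, D i s * D j m - D j m * D i s =
    (m i : ℂ) • (D j (s + m) - D j m) - (s j : ℂ) • (D i (s + m) - D i s)

section Polynomiality

variable {U : Type*} [AddCommGroup U] [Module ℂ U] {D : Fin n → (Fin n → ℤ) → Module.End ℂ U}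

/-- Bilinear form of the defining relations. For `f` and `g` vanishing at the origin it is the
bracket of the vector fields `f d_i` and `g d_j`. -/
theorem IsJetFamily.comm_linExt (h : IsJetFamily D) (i j : Fin n) (f g : TorusFun n) :
    linExt (D i) f * linExt (D j) g - linExt (D j) g * linExt (D i) f =
      linExt (D j) ((f - algebraMap ℂ _ (aug f)) * dPartial i g) -
        linExt (D i) ((g - algebraMap ℂ _ (aug g)) * dPartial j f) := by
  induction f using fexp_induction with
  | h0 => simp
  | hadd f f' hf hf' =>
    simp only [map_add, map_sub, mul_add, add_mul, sub_mul] at hf hf' ⊢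
    exact (by abel : _ = _).trans ((congrArg₂ (· + ·) hf hf').trans (by abel))
  | hsmul c f hf =>
    have := congrArg (c • ·) hf
    simp only [map_smul, Derivation.map_smul, smul_mul_assoc, mul_smul_comm, smul_sub, sub_mul,
      smul_eq_mul, map_mul, map_sub, ← Algebra.smul_def] at this ⊢
    rw [this, smul_comm c (aug g)]
  | hexp s =>
    induction g using fexp_induction with
    | h0 => simp
    | hadd f f' hf hf' =>
      simp only [map_add, map_sub, mul_add, add_mul, sub_mul] at hf hf' ⊢
      exact (by abel : _ = _).trans ((congrArg₂ (· + ·) hf hf').trans (by abel))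
    | hsmul c f hf =>
      have := congrArg (c • ·) hf
      simp only [map_smul, Derivation.map_smul, smul_mul_assoc, mul_smul_comm, smul_sub, sub_mul,
        smul_eq_mul, map_mul, map_sub, ← Algebra.smul_def] at this ⊢
      rw [this, smul_comm c (aug (fexp s))]
    | hexp m =>
      simp only [linExt_fexp, h i j s m, dPartial_fexp, aug_fexp, map_one, sub_mul, one_mul,
        mul_smul_comm, ← fexp_add, map_sub, map_smul, add_comm m s, smul_sub]

/-- With `a` the exponential of the `i`-th basis vector, the brackets `[f d_i, g d_i]` and `[a f
d_i, a⁻¹ g d_i]` both act by zero and differ by `2 f g d_i`. Finitely many linear conditions on `f`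
thus annihilate all products `f g`. -/
theorem IsJetFamily.apply_mul_eq_zero (h : IsJetFamily D) (i : Fin n) {f : TorusFun n}
    (h0 : aug f = 0) (h1 : linExt (D i) f = 0)
    (h2 : linExt (D i) (fexp (Pi.single i 1) * f) = 0) {g : TorusFun n} (hg : aug g = 0) :
    linExt (D i) (f * g) = 0 := by
  set a : TorusFun n := fexp (Pi.single i 1) with ha
  set b : TorusFun n := fexp (-Pi.single i 1) with hb
  have hab : a * b = 1 := by rw [ha, hb, ← fexp_add, add_neg_cancel, fexp_zero]
  have hda : dPartial i a = a := by rw [ha, dPartial_fexp]; simp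
  have e1 := h.comm_linExt i i f (a * (b * g))
  have e2 := h.comm_linExt i i (a * f) (b * g)
  simp only [h1, h2, zero_mul, mul_zero, sub_zero, map_mul, h0, hg, map_zero, Derivation.leibniz,
    smul_eq_mul, hda] at e1 e2
  have e3 : (2 : ℂ) • linExt (D i) (f * g) = 0 := by
    -- The two terms containing the derivative of `b` cancel, so only `a b = 1` is needed.
    have e4 : (2 : ℂ) • (f * g) =
        (f * (a * (b * dPartial i g + g * dPartial i b) + b * g * a)
          - a * (b * g) * dPartial i f) -
        (a * f * (b * dPartial i g + g * dPartial i b)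
          - b * g * (a * dPartial i f + f * a)) := by
      rw [ofNat_smul_eq_nsmul, nsmul_eq_mul]
      push_cast
      linear_combination (-2 * f * g) * hab
    rw [← map_smul, e4, map_sub, map_sub, map_sub, ← e1, ← e2, sub_zero]
  exact (smul_eq_zero.1 e3).resolve_left two_ne_zero

/-- The functions `b` such that the fields `b g ∂_i` with `g(0) = 0` act by zero. -/
def annIdeal (D : Fin n → (Fin n → ℤ) → Module.End ℂ U) : Ideal (TorusFun n) where
  carrier := {b | ∀ i g, aug g = 0 → linExt (D i) (b * g) = 0}
  add_mem' ha hb i g hg := by rw [add_mul, map_add, ha i g hg, hb i g hg, add_zero]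
  zero_mem' i g _ := by rw [zero_mul, map_zero]
  smul_mem' c b hb i g hg := by
    rw [smul_eq_mul, mul_comm c, mul_assoc]
    exact hb i _ (by rw [map_mul, hg, mul_zero])

/-- Bracket `g d_j` with `b c d_i`, which acts by zero. By the Leibniz rule, every term of the
result except `(g d_j b) c d_i` is `b` times a function vanishing at the origin. -/
theorem IsJetFamily.mul_dPartial_mem (h : IsJetFamily D) {b g : TorusFun n}
    (hb : b ∈ annIdeal D) (hg : aug g = 0) (j : Fin n) : g * dPartial j b ∈ annIdeal D := by
  intro i c hc
  have e := h.comm_linExt j i g (b * c)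
  have h1 : aug (g * dPartial j c) = 0 := by rw [map_mul, hg, zero_mul]
  have h2 : aug (c * dPartial i g) = 0 := by rw [map_mul, hc, zero_mul]
  have e1 := hb i _ h1
  have e2 := hb j _ h2
  have e3 : g * dPartial j (b * c) = g * dPartial j b * c + b * (g * dPartial j c) := by
    rw [Derivation.leibniz, smul_eq_mul, smul_eq_mul]; ring
  have h3 : aug (b * c) = 0 := by rw [map_mul, hc, mul_zero]
  rw [hb i c hc, mul_zero, zero_mul, sub_zero, hg, h3, map_zero, sub_zero, sub_zero, e3, map_add, e1, mul_assoc b c, e2, add_zero, sub_zero] at e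
  exact e.symm

/-- A root `r ≠ 1` of multiplicity `k` in `q` has multiplicity only `k - 1` in `(X - 1) q'`. Hence
`1` is the only possible root, and `q` splits over `ℂ`. -/
theorem dvd_X_sub_one_pow {q : Polynomial ℂ} (hq : q ≠ 0)
    (h : q ∣ (Polynomial.X - 1) * Polynomial.derivative q) :
    q ∣ (Polynomial.X - 1) ^ q.natDegree := by
  have hroots : ∀ r ∈ q.roots, r = 1 := by
    intro r hr
    by_contra hne
    have hroot : q.IsRoot r := Polynomial.isRoot_of_mem_roots hr
    have hd : Polynomial.derivative q ≠ 0 := by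
      intro h0
      have := Polynomial.derivative_eq_zero.1 h0
      rw [Polynomial.eq_C_of_natDegree_eq_zero this] at hr
      simp at hr
    have hX : (Polynomial.X - 1 : Polynomial ℂ) ≠ 0 := Polynomial.X_sub_C_ne_zero 1
    have h1 := Polynomial.rootMultiplicity_le_rootMultiplicity_of_dvd (mul_ne_zero hX hd) h r
    rw [Polynomial.rootMultiplicity_mul (mul_ne_zero hX hd),
      Polynomial.derivative_rootMultiplicity_of_root hroot] at h1
    have h2 : Polynomial.rootMultiplicity r (Polynomial.X - 1 : Polynomial ℂ) = 0 := by
      refine Polynomial.rootMultiplicity_eq_zero ?_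
      simp [sub_eq_zero, hne]
    have h3 : 0 < Polynomial.rootMultiplicity r q := (Polynomial.rootMultiplicity_pos hq).2 hroot
    omega
  have hs : q.Splits := IsAlgClosed.splits q
  have h1 := hs.eq_prod_roots
  have h2 : q.roots = Multiset.replicate q.natDegree 1 := by
    rw [Multiset.eq_replicate]
    exact ⟨hs.natDegree_eq_card_roots.symm, hroots⟩
  rw [h2, Multiset.map_replicate, Multiset.prod_replicate, map_one] at h1
  conv_lhs => rw [h1]
  have hu : IsUnit (Polynomial.C q.leadingCoeff) :=
    Polynomial.isUnit_C.2 (isUnit_iff_ne_zero.2 (Polynomial.leadingCoeff_ne_zero.2 hq))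
  exact hu.mul_left_dvd.2 dvd_rfl

variable [FiniteDimensional ℂ U]

/-- Finite dimension of `U` makes the ideal of polynomials in one exponential that land in
`annIdeal` nonzero; stability under `(X - 1) d/dX` then forces a power of `X - 1` into it. -/
theorem IsJetFamily.exists_pow_mem (h : IsJetFamily D) (k : Fin n) :
    ∃ N : ℕ, (fexp (Pi.single k 1) - 1) ^ N ∈ annIdeal D := by
  set x : TorusFun n := fexp (Pi.single k 1) with hx
  let I : Ideal (Polynomial ℂ) := (annIdeal D).comap (Polynomial.aeval x)
  -- The components of `F` are exactly the hypotheses of `apply_mul_eq_zero` for all `i`, so `ker F`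
  -- lies in `I`. The target is finite-dimensional while `ℂ[X]` is not.
  let F : Polynomial ℂ →ₗ[ℂ] (Fin n → ℂ × Module.End ℂ U × Module.End ℂ U) :=
    (LinearMap.pi fun i => aug.toLinearMap.prod ((linExt (D i)).prod
      (linExt (D i) ∘ₗ LinearMap.mulLeft ℂ (fexp (Pi.single i 1))))) ∘ₗ
    (Polynomial.aeval x).toLinearMap
  have hF : ∀ q, F q = 0 → q ∈ I := by
    intro q hq i g hg
    have := congrFun hq i
    exact h.apply_mul_eq_zero i (congrArg Prod.fst this) (congrArg (fun y => y.2.1) this)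
      (congrArg (fun y => y.2.2) this) hg
  have hI : I ≠ ⊥ := by
    intro hbot
    have hinj : Function.Injective F := by
      rw [← LinearMap.ker_eq_bot, eq_bot_iff]
      intro q hq
      have := hF q hq
      rwa [hbot] at this
    have := Module.Finite.of_injective F hinj
    exact Polynomial.not_finite this
  set q := Submodule.IsPrincipal.generator I with hq
  have hqI : q ∈ I := Submodule.IsPrincipal.generator_mem I
  have hq0 : q ≠ 0 := fun h0 => hI ((Submodule.IsPrincipal.eq_bot_iff_generator_eq_zero I).2 h0)
  -- Take `g = x - 1` in `mul_dPartial_mem`. Since `d_k x = x`, this gives `(x - 1) x q'(x)`, and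
  -- the factor `x` is a unit.
  have hder : (Polynomial.X - 1) * Polynomial.derivative q ∈ I := by
    have h1 : aug (x - 1) = 0 := by simp [hx]
    have h2 := h.mul_dPartial_mem (b := Polynomial.aeval x q) hqI h1 k
    rw [Derivation.map_aeval, hx, dPartial_fexp, ← hx, Pi.single_eq_same, Int.cast_one, one_smul,
      smul_eq_mul] at h2
    have hu : fexp (-Pi.single k 1) * x = 1 := by rw [hx, ← fexp_add, neg_add_cancel, fexp_zero]
    have h3 := (annIdeal D).mul_mem_left (fexp (-Pi.single k 1)) h2
    change Polynomial.aeval x _ ∈ annIdeal D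
    rw [map_mul, map_sub, map_one, Polynomial.aeval_X]
    convert h3 using 1
    linear_combination (-(x - 1) * Polynomial.aeval x (Polynomial.derivative q)) * hu
  have hdvd := dvd_X_sub_one_pow hq0 ((Submodule.IsPrincipal.mem_iff_generator_dvd I).1 hder)
  have hmem := (Submodule.IsPrincipal.mem_iff_generator_dvd I).2 hdvd
  refine ⟨q.natDegree, ?_⟩
  change Polynomial.aeval x _ ∈ annIdeal D at hmem
  simpa using hmem

theorem IsJetFamily.exists_pow_annihilates (h : IsJetFamily D) :
    ∃ N : ℕ, ∀ i k f, linExt (D i) ((fexp (Pi.single k 1) - 1) ^ N * f) = 0 := by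
  choose N hN using h.exists_pow_mem
  -- Membership in `annIdeal` controls only products with functions vanishing at the origin; the
  -- extra factor `x_k - 1` makes `(x_k - 1) f` such a function.
  refine ⟨Finset.univ.sup N + 1, fun i k f => ?_⟩
  have h1 : N k ≤ Finset.univ.sup N := Finset.le_sup (Finset.mem_univ k)
  have h2 := (annIdeal D).mul_mem_right
    ((fexp (Pi.single k 1) - 1) ^ (Finset.univ.sup N - N k)) (hN k)
  rw [← pow_add, Nat.add_sub_cancel' h1] at h2
  rw [pow_succ, mul_assoc]
  exact h2 i _ (by simp)

end Polynomiality

/-! ### Taylor expansions of polynomial families -/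

section Taylor

variable {V : Type*} [AddCommGroup V] [Module ℂ V]

theorem powFact_eq_mul_prod (s : Fin n → ℤ) (α : Fin n →₀ ℕ) :
    powFact s α = (∏ i, (Nat.factorial (α i) : ℂ))⁻¹ * ∏ i, (s i : ℂ) ^ α i := by
  rw [powFact, div_eq_inv_mul]

theorem prod_factorial_ne_zero (α : Fin n →₀ ℕ) : (∏ i, (Nat.factorial (α i) : ℂ)) ≠ 0 :=
  Finset.prod_ne_zero_iff.2 fun i _ => by exact_mod_cast Nat.factorial_ne_zero _

/-- The Taylor coefficients of a polynomial family of scalars vanish if its values do. -/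
theorem finsupp_eq_zero_of_powFact_sum {c : (Fin n →₀ ℕ) →₀ ℂ}
    (h : ∀ s : Fin n → ℤ, (c.sum fun α a => powFact s α * a) = 0) : c = 0 := by
  let p : MvPolynomial (Fin n) ℂ :=
    ∑ α ∈ c.support, MvPolynomial.monomial α ((∏ i, (Nat.factorial (α i) : ℂ))⁻¹ * c α)
  have hp : p = 0 := by
    refine MvPolynomial.funext_set (fun _ => Set.range ((↑) : ℤ → ℂ))
      (fun _ => Set.infinite_range_of_injective Int.cast_injective) fun x hx => ?_
    choose s hs using fun i => hx i trivial
    rw [map_zero, ← h s, Finsupp.sum, map_sum]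
    refine Finset.sum_congr rfl fun α _ => ?_
    rw [MvPolynomial.eval_monomial, powFact_eq_mul_prod,
      Finsupp.prod_fintype _ _ (fun i => pow_zero _)]
    simp only [hs]
    ring
  ext α
  by_contra hα
  have h1 := congrArg (MvPolynomial.coeff α) hp
  rw [MvPolynomial.coeff_sum, MvPolynomial.coeff_zero,
    Finset.sum_eq_single_of_mem α (Finsupp.mem_support_iff.2 hα)
      (fun β _ hβ => by rw [MvPolynomial.coeff_monomial, if_neg hβ]),
    MvPolynomial.coeff_monomial, if_pos rfl] at h1
  exact (mul_ne_zero (inv_ne_zero (prod_factorial_ne_zero α)) hα) h1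

/-- A functional that vanishes on `P` but not at `T α` would reduce this to the scalar case. It
gives uniqueness of Taylor coefficients for `P = ⊥`, and later passes stability of a subspace from
the `D_j(s)` to their coefficients. -/
theorem powFact_sum_mem {P : Submodule ℂ V} {T : (Fin n →₀ ℕ) →₀ V}
    (h : ∀ s : Fin n → ℤ, (T.sum fun α a => powFact s α • a) ∈ P) (α : Fin n →₀ ℕ) : T α ∈ P := by
  by_contra hα
  obtain ⟨φ, hφ, hφ0⟩ := Submodule.exists_le_ker_of_notMem hα
  have key : T.mapRange φ (map_zero φ) = 0 := by
    refine finsupp_eq_zero_of_powFact_sum fun s => ?_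
    rw [Finsupp.sum_mapRange_index (by simp)]
    have := hφ0 (h s)
    rw [LinearMap.mem_ker, Finsupp.sum, map_sum] at this
    simpa [Finsupp.sum] using this
  exact hφ (by simpa using DFunLike.congr_fun key α)

theorem eq_zero_of_powFact_sum {T : (Fin n →₀ ℕ) →₀ V}
    (h : ∀ s : Fin n → ℤ, (T.sum fun α a => powFact s α • a) = 0) : T = 0 := by
  ext α
  have := powFact_sum_mem (P := ⊥) (T := T) (fun s => by simp [h s]) α
  simpa using this

theorem eq_of_powFact_sum {T T' : (Fin n →₀ ℕ) →₀ V}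
    (h : ∀ s : Fin n → ℤ, (T.sum fun α a => powFact s α • a) =
      T'.sum fun α a => powFact s α • a) : T = T' := by
  rw [← sub_eq_zero]
  refine eq_zero_of_powFact_sum fun s => ?_
  rw [Finsupp.sum_sub_index (fun α b c => smul_sub _ b c), h s, sub_self]

theorem powFact_zero_left (α : Fin n →₀ ℕ) :
    powFact (0 : Fin n → ℤ) α = if α = 0 then 1 else 0 := by
  split_ifs with h
  · simp [h, powFact]
  · obtain ⟨i, hi⟩ := Finsupp.ne_iff.1 h
    rw [powFact, Finset.prod_eq_zero (Finset.mem_univ i), zero_div]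
    simpa using hi

theorem powFact_zero_right (s : Fin n → ℤ) : powFact s 0 = 1 := by
  simp [powFact]

theorem powFact_sum_zero (T : (Fin n →₀ ℕ) →₀ V) :
    (T.sum fun α a => powFact (0 : Fin n → ℤ) α • a) = T 0 := by
  classical
  rw [Finsupp.sum]
  simp only [powFact_zero_left, ite_smul, one_smul, zero_smul]
  simp +contextual [eq_comm]

/-! ### Polynomiality of linear maps annihilating powers of the augmentation ideal -/

/-- Binomial series for a unipotent unit, also for negative exponents. By Pascal's rule and the
nilpotency of `u - 1`, the right side is multiplied by `u` when `s` increases by one. -/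
theorem unit_zpow_eq_sum {A : Type*} [CommRing A] [Algebra ℂ A] {N : ℕ} (u : Aˣ)
    (h : ((u : A) - 1) ^ N = 0) (s : ℤ) :
    ((u ^ s : Aˣ) : A) = ∑ l ∈ Finset.range N, ((Ring.choose s l : ℤ) : A) * ((u : A) - 1) ^ l := by
  have step : ∀ s : ℤ, (∑ l ∈ Finset.range N, ((Ring.choose (s + 1) l : ℤ) : A) * ((u : A) - 1) ^ l) =
      u * ∑ l ∈ Finset.range N, ((Ring.choose s l : ℤ) : A) * ((u : A) - 1) ^ l := by
    intro s
    cases N with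
    | zero => simp
    | succ N =>
      have e1 : (u : A) * ∑ l ∈ Finset.range (N + 1), ((Ring.choose s l : ℤ) : A) * ((u : A) - 1) ^ l =
          ∑ l ∈ Finset.range (N + 1), ((Ring.choose s l : ℤ) : A) * ((u : A) - 1) ^ l +
          ∑ l ∈ Finset.range (N + 1), ((Ring.choose s l : ℤ) : A) * ((u : A) - 1) ^ (l + 1) := by
        rw [Finset.mul_sum, ← Finset.sum_add_distrib]
        exact Finset.sum_congr rfl fun l _ => by ring
      rw [e1, Finset.sum_range_succ (fun l => _ * _ ^ (l + 1)) N, h, mul_zero, add_zero,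
        Finset.sum_range_succ' _ N, Finset.sum_range_succ' _ N]
      simp only [Ring.choose_succ_succ, Ring.choose_zero_right, Int.cast_add, add_mul,
        Finset.sum_add_distrib]
      ring
  induction s using Int.induction_on with
  | zero =>
    cases N with
    | zero =>
      simp only [pow_zero] at h
      simp [h]
    | succ N =>
      rw [Finset.sum_range_succ']
      simp [Ring.choose_zero_succ]
  | succ s ih => rw [step s, ← ih, zpow_add_one, Units.val_mul, mul_comm]
  | pred s ih =>
    have := step (-s - 1)
    rw [sub_add_cancel, ← ih] at this
    refine (Units.mul_right_inj u).1 ?_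
    rw [← this, ← Units.val_mul, ← zpow_one_add, add_sub_cancel]

theorem exists_polynomial_zpow {A : Type*} [CommRing A] [Algebra ℂ A] {N : ℕ} (u : Aˣ)
    (h : ((u : A) - 1) ^ N = 0) :
    ∃ p : Polynomial A, ∀ s : ℤ, ((u ^ s : Aˣ) : A) = p.eval (s : A) := by
  refine ⟨∑ l ∈ Finset.range N, Polynomial.C (((Nat.factorial l : ℂ)⁻¹) • ((u : A) - 1) ^ l) *
    descPochhammer A l, fun s => ?_⟩
  rw [unit_zpow_eq_sum u h, Polynomial.eval_finsetSum]
  refine Finset.sum_congr rfl fun l _ => ?_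
  rw [Polynomial.eval_mul, Polynomial.eval_C]
  have h1 : (descPochhammer A l).eval (s : A) = (Nat.factorial l : A) * ((Ring.choose s l : ℤ) : A) := by
    have h2 := Ring.descPochhammer_eq_factorial_smul_choose s l
    rw [← Polynomial.eval_eq_smeval] at h2
    rw [← descPochhammer_map (Int.castRingHom A), Polynomial.eval_intCast_map, Int.cast_id, h2]
    simp
  have h3 : (Nat.factorial l : ℂ) ≠ 0 := by exact_mod_cast Nat.factorial_ne_zero _
  have h4 : (Nat.factorial l : A) = algebraMap ℂ A (Nat.factorial l : ℂ) := by simp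
  have h5 : algebraMap ℂ A (Nat.factorial l : ℂ)⁻¹ * algebraMap ℂ A (Nat.factorial l : ℂ) = 1 := by
    rw [← map_mul, inv_mul_cancel₀ h3, map_one]
  rw [h1, h4, Algebra.smul_def]
  linear_combination (-((Ring.choose s l : ℤ) : A) * ((u : A) - 1) ^ l) * h5

/-- The map `R` factors through the quotient by the powers `(x_k - 1)^N`. There each `x_k` is
unipotent, so the class of `e^{2πi s·x} = ∏ x_k^{s_k}` is a polynomial in `s`; its coefficients are
pushed through `R`. -/
theorem exists_taylor_of_annihilates (R : TorusFun n →ₗ[ℂ] V) {N : ℕ}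
    (h : ∀ k f, R ((fexp (Pi.single k 1) - 1) ^ N * f) = 0) :
    ∃ T : (Fin n →₀ ℕ) →₀ V, ∀ s, R (fexp s) = T.sum fun α a => powFact s α • a := by
  classical
  let I : Ideal (TorusFun n) :=
    Ideal.span (Set.range fun k : Fin n => (fexp (Pi.single k 1) - 1) ^ N)
  have hI : I.restrictScalars ℂ ≤ LinearMap.ker R := by
    intro f hf
    -- `R` is only `ℂ`-linear, so the span induction needs the vanishing on all multiples of `f`.
    suffices h1 : ∀ a : TorusFun n, R (a * f) = 0 by simpa using h1 1
    change f ∈ Ideal.span _ at hf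
    induction hf using Submodule.span_induction with
    | mem x hx =>
      obtain ⟨k, rfl⟩ := hx
      intro a
      rw [mul_comm]
      exact h k a
    | zero => simp
    | add x y _ _ hx hy => intro a; rw [mul_add, map_add, hx, hy, add_zero]
    | smul b x _ hx => intro a; rw [smul_eq_mul, ← mul_assoc, hx]
  let A := TorusFun n ⧸ I
  let R' : A →ₗ[ℂ] V := (I.restrictScalars ℂ).liftQ R hI
  let u : Fin n → Aˣ := fun k =>
    { val := Ideal.Quotient.mk I (fexp (Pi.single k 1))
      inv := Ideal.Quotient.mk I (fexp (-Pi.single k 1))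
      val_inv := by rw [← map_mul, ← fexp_add, add_neg_cancel, fexp_zero, map_one]
      inv_val := by rw [← map_mul, ← fexp_add, neg_add_cancel, fexp_zero, map_one] }
  have hu : ∀ k, ((u k : A) - 1) ^ N = 0 := fun k => by
    change (Ideal.Quotient.mk I (fexp (Pi.single k 1)) - 1) ^ N = 0
    rw [← map_one (Ideal.Quotient.mk I), ← map_sub, ← map_pow, Ideal.Quotient.eq_zero_iff_mem]
    exact Ideal.subset_span ⟨k, rfl⟩
  choose p hp using fun k => exists_polynomial_zpow (u k) (hu k)
  have hexp : ∀ s : Fin n → ℤ, Ideal.Quotient.mk I (fexp s) = ∏ k, ((u k ^ s k : Aˣ) : A) := by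
    intro s
    let L : Multiplicative (Fin n → ℤ) →* A :=
      { toFun := fun m => Ideal.Quotient.mk I (fexp m.toAdd)
        map_one' := by rw [toAdd_one, fexp_zero, map_one]
        map_mul' := fun x y => by rw [toAdd_mul, fexp_add, map_mul] }
    have h1 : ∀ k (z : ℤ), L (Multiplicative.ofAdd (Pi.single k z)) = ((u k ^ z : Aˣ) : A) := by
      intro k z
      have h2 : (Pi.single k z : Fin n → ℤ) = z • Pi.single k 1 := by
        rw [← Pi.single_smul]; simp
      rw [h2, ofAdd_zsmul, ← MonoidHom.coe_toHomUnits L, map_zpow]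
      congr 2
    have h3 : L (Multiplicative.ofAdd s) = Ideal.Quotient.mk I (fexp s) := rfl
    rw [← h3]
    conv_lhs => rw [← Finset.univ_sum_single s, ofAdd_sum, map_prod]
    exact Finset.prod_congr rfl fun k _ => h1 k (s k)
  let P : MvPolynomial (Fin n) A :=
    ∏ k, Polynomial.eval₂ MvPolynomial.C (MvPolynomial.X k) (p k)
  have hP : ∀ s : Fin n → ℤ, Ideal.Quotient.mk I (fexp s) =
      P.eval fun k => ((s k : ℤ) : A) := by
    intro s
    rw [hexp, map_prod]
    refine Finset.prod_congr rfl fun k _ => ?_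
    rw [hp, Polynomial.hom_eval₂, MvPolynomial.eval_X]
    have h1 : (MvPolynomial.eval fun k => ((s k : ℤ) : A)).comp MvPolynomial.C = RingHom.id A :=
      RingHom.ext fun a => MvPolynomial.eval_C a
    rw [h1]
    rfl
  have hR' : ∀ (c : ℂ) (x : A), R' (algebraMap ℂ A c * x) = c • R' x := fun c x => by
    rw [← Algebra.smul_def]
    exact map_smul R' c x
  -- The factor `α!` compensates the division built into `powFact`.
  refine ⟨∑ α ∈ P.support, Finsupp.single α
    ((∏ i, (Nat.factorial (α i) : ℂ)) • R' (MvPolynomial.coeff α P)), fun s => ?_⟩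
  have h1 : R (fexp s) = R' (Ideal.Quotient.mk I (fexp s)) := rfl
  rw [h1, hP, MvPolynomial.eval_eq, map_sum, ← Finsupp.sum_finsetSum_index (by simp)
    (fun α b c => smul_add _ b c)]
  refine Finset.sum_congr rfl fun α _ => ?_
  rw [Finsupp.sum_single_index (h := fun α a => powFact s α • a) (smul_zero _), smul_smul, powFact,
    div_mul_cancel₀ _ (prod_factorial_ne_zero α), ← hR', mul_comm]
  rw [Finset.prod_subset (Finset.subset_univ _) (fun i _ hi => by
    rw [Finsupp.notMem_support_iff.1 hi, pow_zero])]
  simp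

end Taylor

/-! ### Taylor expansions in two variables -/

theorem powFact_eq_prod (s : Fin n → ℤ) (α : Fin n →₀ ℕ) :
    powFact s α = ∏ i, (s i : ℂ) ^ α i / (Nat.factorial (α i) : ℂ) := by
  rw [powFact, Finset.prod_div_distrib]

theorem add_pow_div_factorial (a b : ℂ) (k : ℕ) :
    (a + b) ^ k / (Nat.factorial k : ℂ) = ∑ p ∈ Finset.HasAntidiagonal.antidiagonal k,
      (a ^ p.1 / (Nat.factorial p.1 : ℂ)) * (b ^ p.2 / (Nat.factorial p.2 : ℂ)) := by
  rw [(Commute.all a b).add_pow', Finset.sum_div]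
  refine Finset.sum_congr rfl fun p hp => ?_
  rw [Finset.HasAntidiagonal.mem_antidiagonal] at hp
  have h := Nat.add_choose_mul_factorial_mul_factorial p.2 p.1
  rw [add_comm, hp] at h
  have h1 : (Nat.factorial p.1 : ℂ) ≠ 0 := by exact_mod_cast Nat.factorial_ne_zero _
  have h2 : (Nat.factorial p.2 : ℂ) ≠ 0 := by exact_mod_cast Nat.factorial_ne_zero _
  have h3 : (Nat.factorial k : ℂ) ≠ 0 := by exact_mod_cast Nat.factorial_ne_zero _
  rw [nsmul_eq_mul]
  field_simp
  rw [← h]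
  push_cast
  ring

/-- The binomial theorem in each coordinate, with the product of sums expanded. -/
theorem powFact_add (s m : Fin n → ℤ) (γ : Fin n →₀ ℕ) :
    powFact (s + m) γ = ∑ p ∈ Finset.HasAntidiagonal.antidiagonal γ, powFact s p.1 * powFact m p.2 := by
  classical
  simp only [powFact_eq_prod, Pi.add_apply, Int.cast_add, add_pow_div_factorial,
    ← Finset.prod_mul_distrib]
  rw [Finset.prod_univ_sum]
  refine Finset.sum_bij'
    (fun p _ => (Finsupp.equivFunOnFinite.symm fun i => (p i).1,
      Finsupp.equivFunOnFinite.symm fun i => (p i).2))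
    (fun q _ i => (q.1 i, q.2 i)) ?_ ?_ ?_ ?_ ?_
  · intro p hp
    rw [Fintype.mem_piFinset] at hp
    rw [Finset.HasAntidiagonal.mem_antidiagonal]
    ext i
    simpa using Finset.HasAntidiagonal.mem_antidiagonal.1 (hp i)
  · intro q hq
    rw [Finset.HasAntidiagonal.mem_antidiagonal] at hq
    rw [Fintype.mem_piFinset]
    intro i
    rw [Finset.HasAntidiagonal.mem_antidiagonal, ← hq]
    rfl
  · intro p _; rfl
  · intro q _; ext <;> rfl
  · intro p _; rfl

theorem powFact_add_single (s : Fin n → ℤ) (α : Fin n →₀ ℕ) (i : Fin n) :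
    powFact s (α + Finsupp.single i 1) * ((α i : ℂ) + 1) = (s i : ℂ) * powFact s α := by
  classical
  rw [powFact_eq_prod, powFact_eq_prod, ← Finset.mul_prod_erase _ _ (Finset.mem_univ i),
    ← Finset.mul_prod_erase Finset.univ (fun k => (s k : ℂ) ^ α k / (Nat.factorial (α k) : ℂ))
      (Finset.mem_univ i)]
  have h : ∀ k ∈ Finset.univ.erase i, (s k : ℂ) ^ (α + Finsupp.single i 1 : Fin n →₀ ℕ) k /
      (Nat.factorial ((α + Finsupp.single i 1 : Fin n →₀ ℕ) k) : ℂ) =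
        (s k : ℂ) ^ α k / (Nat.factorial (α k) : ℂ) := by
    intro k hk
    have : (α + Finsupp.single i 1 : Fin n →₀ ℕ) k = α k := by
      simp [(Finset.ne_of_mem_erase hk).symm]
    rw [this]
  rw [Finset.prod_congr rfl h]
  have h1 : (Nat.factorial (α i) : ℂ) ≠ 0 := by exact_mod_cast Nat.factorial_ne_zero _
  have h2 : (α i : ℂ) + 1 ≠ 0 := by exact_mod_cast Nat.succ_ne_zero (α i)
  have h3 : (α + Finsupp.single i 1 : Fin n →₀ ℕ) i = α i + 1 := by simp
  rw [h3, Nat.factorial_succ]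
  push_cast
  field_simp
  ring

section Double

variable {V : Type*} [AddCommGroup V] [Module ℂ V]

/-- `F s m` is the finite sum of the `s^α/α! m^β/β! C α β`. -/
def HasTaylor₂ (F : (Fin n → ℤ) → (Fin n → ℤ) → V) (C : (Fin n →₀ ℕ) → (Fin n →₀ ℕ) → V) : Prop :=
  ∃ S : Finset ((Fin n →₀ ℕ) × (Fin n →₀ ℕ)), (∀ α β, (α, β) ∉ S → C α β = 0) ∧
    ∀ s m, F s m = ∑ p ∈ S, (powFact s p.1 * powFact m p.2) • C p.1 p.2

namespace HasTaylor₂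

variable {F G : (Fin n → ℤ) → (Fin n → ℤ) → V} {C E : (Fin n →₀ ℕ) → (Fin n →₀ ℕ) → V}

theorem sub (hF : HasTaylor₂ F C) (hG : HasTaylor₂ G E) :
    HasTaylor₂ (fun s m => F s m - G s m) (fun α β => C α β - E α β) := by
  classical
  obtain ⟨S, hS, hF⟩ := hF
  obtain ⟨S', hS', hG⟩ := hG
  refine ⟨S ∪ S', fun α β h => ?_, fun s m => ?_⟩
  · rw [Finset.mem_union, not_or] at h
    beta_reduce
    rw [hS _ _ h.1, hS' _ _ h.2, sub_zero]
  · simp only [smul_sub, Finset.sum_sub_distrib]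
    rw [hF, hG]
    congr 1
    · exact Finset.sum_subset Finset.subset_union_left fun p _ hp => by
        rw [hS p.1 p.2 hp, smul_zero]
    · exact Finset.sum_subset Finset.subset_union_right fun p _ hp => by
        rw [hS' p.1 p.2 hp, smul_zero]

theorem swap (hF : HasTaylor₂ F C) : HasTaylor₂ (fun s m => F m s) (fun α β => C β α) := by
  classical
  obtain ⟨S, hS, hF⟩ := hF
  refine ⟨S.map (Equiv.prodComm _ _).toEmbedding, fun α β h => hS _ _ fun h' => h ?_, fun s m => ?_⟩
  · exact Finset.mem_map.2 ⟨(β, α), h', rfl⟩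
  · beta_reduce
    rw [hF, Finset.sum_map]
    exact Finset.sum_congr rfl fun p _ => by simp [mul_comm]

/-- Since `m_i m^β/β! = (β_i + 1) m^{β+ε_i}/(β+ε_i)!`, coefficients move up by `ε_i`. When `β i = 0`
the truncated subtraction is harmless, being multiplied by zero. -/
theorem smul_right (hF : HasTaylor₂ F C) (i : Fin n) :
    HasTaylor₂ (fun s m => (m i : ℂ) • F s m)
      (fun α β => (β i : ℂ) • C α (β - Finsupp.single i 1)) := by
  classical
  obtain ⟨S, hS, hF⟩ := hF
  have hinj : Function.Injective fun p : (Fin n →₀ ℕ) × (Fin n →₀ ℕ) =>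
      (p.1, p.2 + Finsupp.single i 1) := by
    rintro ⟨a, b⟩ ⟨c, d⟩ h
    simpa using h
  refine ⟨S.map ⟨_, hinj⟩, fun α β h => ?_, fun s m => ?_⟩
  · by_cases hβ : β i = 0
    · simp [hβ]
    · beta_reduce
      rw [hS, smul_zero]
      intro h'
      refine h (Finset.mem_map.2 ⟨_, h', ?_⟩)
      have : Finsupp.single i 1 ≤ β := by
        rw [Finsupp.single_le_iff]; omega
      simp [tsub_add_cancel_of_le this]
  · beta_reduce
    rw [hF, Finset.sum_map, Finset.smul_sum]
    refine Finset.sum_congr rfl fun p _ => ?_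
    simp only [Function.Embedding.coeFn_mk, add_tsub_cancel_right, smul_smul]
    congr 1
    have := powFact_add_single m p.2 i
    rw [Finsupp.add_apply, Finsupp.single_eq_same]
    push_cast
    linear_combination (-powFact s p.1) * this

theorem smul_left (hF : HasTaylor₂ F C) (j : Fin n) :
    HasTaylor₂ (fun s m => (s j : ℂ) • F s m)
      (fun α β => (α j : ℂ) • C (α - Finsupp.single j 1) β) :=
  (hF.swap.smul_right j).swap

theorem mul {A : Type*} [Ring A] [Algebra ℂ A] (T T' : (Fin n →₀ ℕ) →₀ A) :
    HasTaylor₂ (fun s m => (T.sum fun α a => powFact s α • a) *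
      (T'.sum fun α a => powFact m α • a)) (fun α β => T α * T' β) := by
  classical
  refine ⟨T.support ×ˢ T'.support, fun α β h => ?_, fun s m => ?_⟩
  · rw [Finset.mem_product, not_and_or, Finsupp.notMem_support_iff,
      Finsupp.notMem_support_iff] at h
    rcases h with h | h
    · exact mul_eq_zero_of_left h _
    · exact mul_eq_zero_of_right _ h
  · simp only [Finsupp.sum]
    rw [Finset.sum_mul_sum, Finset.sum_product]
    simp only [smul_mul_smul_comm]

theorem translate (T : (Fin n →₀ ℕ) →₀ V) :
    HasTaylor₂ (fun s m => T.sum fun α a => powFact (s + m) α • a) (fun α β => T (α + β)) := by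
  classical
  refine ⟨T.support.biUnion fun γ => Finset.HasAntidiagonal.antidiagonal γ, fun α β h => ?_, fun s m => ?_⟩
  · by_contra h0
    exact h (Finset.mem_biUnion.2
      ⟨α + β, Finsupp.mem_support_iff.2 h0, Finset.HasAntidiagonal.mem_antidiagonal.2 rfl⟩)
  · simp only [Finsupp.sum]
    rw [Finset.sum_biUnion]
    · refine Finset.sum_congr rfl fun γ _ => ?_
      rw [powFact_add, Finset.sum_smul]
      refine Finset.sum_congr rfl fun p hp => ?_
      rw [Finset.HasAntidiagonal.mem_antidiagonal.1 hp]
    · intro γ _ γ' _ hne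
      rw [Function.onFun, Finset.disjoint_left]
      intro p hp hp'
      exact hne ((Finset.HasAntidiagonal.mem_antidiagonal.1 hp).symm.trans (Finset.HasAntidiagonal.mem_antidiagonal.1 hp'))

/-- Uniqueness of Taylor coefficients, applied first in `s` with `m` fixed and then in `m`. -/
theorem eq_zero_iff (hF : HasTaylor₂ F C) : (∀ s m, F s m = 0) ↔ ∀ α β, C α β = 0 := by
  classical
  obtain ⟨S, hS, hF⟩ := hF
  constructor
  · intro h0
    let A := S.image Prod.fst
    let B := S.image Prod.snd
    have hC : ∀ α β, α ∉ A ∨ β ∉ B → C α β = 0 := by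
      intro α β h
      refine hS α β fun h' => ?_
      rcases h with h | h
      · exact h (Finset.mem_image_of_mem _ h')
      · exact h (Finset.mem_image_of_mem _ h')
    have h1 : ∀ s m, ∑ α ∈ A, powFact s α • ∑ β ∈ B, powFact m β • C α β = 0 := by
      intro s m
      rw [← h0 s m, hF]
      simp only [Finset.smul_sum, smul_smul]
      rw [← Finset.sum_product', ← Finset.sum_subset (s₁ := S)]
      · exact fun p hp => Finset.mem_product.2
          ⟨Finset.mem_image_of_mem _ hp, Finset.mem_image_of_mem _ hp⟩
      · intro p _ hp
        rw [hS p.1 p.2 hp, smul_zero]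
    have h2 : ∀ m α, ∑ β ∈ B, powFact m β • C α β = 0 := by
      intro m α
      let T : (Fin n →₀ ℕ) →₀ V := Finsupp.onFinset A (fun α => ∑ β ∈ B, powFact m β • C α β)
        fun α hα => by
          by_contra h
          exact hα (Finset.sum_eq_zero fun β _ => by rw [hC α β (Or.inl h), smul_zero])
      have hT : T = 0 := eq_zero_of_powFact_sum fun s => by
        rw [Finsupp.onFinset_sum _ (fun α => smul_zero _)]
        exact h1 s m
      exact DFunLike.congr_fun hT α
    intro α β
    let T : (Fin n →₀ ℕ) →₀ V := Finsupp.onFinset B (fun β => C α β)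
      fun β hβ => by
        by_contra h
        exact hβ (hC α β (Or.inr h))
    have hT : T = 0 := eq_zero_of_powFact_sum fun m => by
      rw [Finsupp.onFinset_sum _ (fun α => smul_zero _)]
      exact h2 m α
    exact DFunLike.congr_fun hT β
  · intro h0 s m
    rw [hF]
    exact Finset.sum_eq_zero fun p _ => by rw [h0, smul_zero]

end HasTaylor₂

end Double

/-! ### From the relations of the `D_j(s)` to the brackets of `W_n^+` -/

section JetCoefficients

variable {U : Type u} [AddCommGroup U] [Module ℂ U]

/-- The commutation relations of `W_n^+` for the operators `T j α`, `α ≠ 0`. -/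
def IsWPlusFamily (T : Fin n → (Fin n →₀ ℕ) → Module.End ℂ U) : Prop :=
  ∀ i j α β, α ≠ 0 → β ≠ 0 → T i α * T j β - T j β * T i α =
    (β i : ℂ) • T j (α + (β - Finsupp.single i 1))
      - (α j : ℂ) • T i (β + (α - Finsupp.single j 1))

/-- Compare coefficients of `s^α m^β` in the relations. Products of Taylor series give `T i α * T j
β`, translated arguments give coefficients at `α + β`, and multiplication by `m_i` or `s_j` produces
the shifts by `ε_i` and `ε_j` seen in the bracket. -/
theorem isJetFamily_iff {D : Fin n → (Fin n → ℤ) → Module.End ℂ U}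
    {T : Fin n → ((Fin n →₀ ℕ) →₀ Module.End ℂ U)} (h : IsTaylorExpansion D T)
    {lam : Fin n → ℂ} (h0 : ∀ j, T j 0 = lam j • (1 : Module.End ℂ U)) :
    IsJetFamily D ↔ IsWPlusFamily fun j α => T j α := by
  classical
  -- The Taylor series of the constant `1`, used to write `D j m` and `D i s` as functions of both
  -- variables.
  let I : (Fin n →₀ ℕ) →₀ Module.End ℂ U := Finsupp.single 0 1
  have hI : ∀ s : Fin n → ℤ, (I.sum fun α a => powFact s α • a) = 1 := fun s => by
    rw [Finsupp.sum_single_index (h := fun α a => powFact s α • a) (smul_zero _), powFact_zero_right, one_smul]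
  have key : ∀ i j, (∀ s m, D i s * D j m - D j m * D i s -
      ((m i : ℂ) • (D j (s + m) - D j m) - (s j : ℂ) • (D i (s + m) - D i s)) = 0) ↔
      ∀ α β, T i α * T j β - T j β * T i α -
        ((β i : ℂ) • (T j (α + (β - Finsupp.single i 1)) - I α * T j (β - Finsupp.single i 1)) -
          (α j : ℂ) • (T i (α - Finsupp.single j 1 + β) - T i (α - Finsupp.single j 1) * I β)) =
            0 := by
    intro i j
    rw [← HasTaylor₂.eq_zero_iff
      (((HasTaylor₂.mul (T i) (T j)).sub (HasTaylor₂.mul (T j) (T i)).swap).sub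
      ((((HasTaylor₂.translate (T j)).sub (HasTaylor₂.mul I (T j))).smul_right i).sub
        (((HasTaylor₂.translate (T i)).sub (HasTaylor₂.mul (T i) I)).smul_left j)))]
    simp only [hI, ← h _ _, one_mul, mul_one]
  have key2 : IsJetFamily D ↔ ∀ i j s m, D i s * D j m - D j m * D i s -
      ((m i : ℂ) • (D j (s + m) - D j m) - (s j : ℂ) • (D i (s + m) - D i s)) = 0 := by
    simp only [IsJetFamily, sub_eq_zero]
  rw [key2]
  simp only [key, IsWPlusFamily]
  refine forall₄_congr fun i j α β => ?_
  rw [sub_eq_zero]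
  -- For `α = 0` or `β = 0` both sides vanish because the constant terms are scalar; otherwise the
  -- corrections involving `I` disappear.
  by_cases hα : α = 0
  · simp [hα, I, h0]
  · by_cases hβ : β = 0
    · simp [hβ, I, h0]
    · have hIα : I α = 0 := Finsupp.single_eq_of_ne hα
      have hIβ : I β = 0 := Finsupp.single_eq_of_ne hβ
      rw [hIα, hIβ, zero_mul, mul_zero, sub_zero, sub_zero, add_comm (α - _) β]
      exact ⟨fun H _ _ => H, fun H => H hα hβ⟩

theorem IsTaylorExpansion.apply_zero {D : Fin n → (Fin n → ℤ) → Module.End ℂ U}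
    {T : Fin n → ((Fin n →₀ ℕ) →₀ Module.End ℂ U)} (h : IsTaylorExpansion D T) (j : Fin n) :
    D j 0 = T j 0 := by
  rw [h j 0, powFact_sum_zero]

theorem IsTaylorExpansion.unique {D : Fin n → (Fin n → ℤ) → Module.End ℂ U}
    {T T' : Fin n → ((Fin n →₀ ℕ) →₀ Module.End ℂ U)} (h : IsTaylorExpansion D T)
    (h' : IsTaylorExpansion D T') : T = T' :=
  funext fun j => eq_of_powFact_sum fun s => (h j s).symm.trans (h' j s)

theorem IsJetFamily.exists_taylorExpansion [FiniteDimensional ℂ U]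
    {D : Fin n → (Fin n → ℤ) → Module.End ℂ U} (h : IsJetFamily D) :
    ∃ T : Fin n → ((Fin n →₀ ℕ) →₀ Module.End ℂ U), IsTaylorExpansion D T := by
  obtain ⟨N, hN⟩ := h.exists_pow_annihilates
  choose T hT using fun j => exists_taylor_of_annihilates (linExt (D j)) (hN j)
  exact ⟨T, fun j s => by rw [← hT j s, linExt_fexp]⟩

end JetCoefficients

/-! ### Representations of `W_n^+` and families of operators -/

theorem span_zPlus :
    Submodule.span ℂ {D : WPlus n | ∃ (α : PosIndex n) (j : Fin n), D = zPlus α j} = ⊤ := by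
  have h : (Submodule.span ℂ {D : WPlus n | ∃ (α : PosIndex n) (j : Fin n), D = zPlus α j}).map
      (WPlus n).toSubmodule.subtype = (WPlus n).toSubmodule := by
    rw [Submodule.map_span]
    change _ = Submodule.span ℂ _
    congr 1
    ext D
    constructor
    · rintro ⟨_, ⟨α, j, rfl⟩, rfl⟩
      exact ⟨α.1, j, α.2, rfl⟩
    · rintro ⟨α, j, hα, rfl⟩
      exact ⟨zPlus ⟨α, hα⟩ j, ⟨⟨α, hα⟩, j, rfl⟩, rfl⟩
  rw [eq_top_iff]
  intro D _
  have hD : (D : Derivation ℂ _ _) ∈ (WPlus n).toSubmodule := D.2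
  rw [← h] at hD
  obtain ⟨D', hD', he⟩ := hD
  have : D' = D := Subtype.ext he
  rwa [← this]

/-- Linear statements about `W_n^+` are checked on the `z^α ∂_j`. -/
theorem zPlus_induction {p : WPlus n → Prop} (X : WPlus n) (hz : ∀ α j, p (zPlus α j))
    (h0 : p 0) (hadd : ∀ X Y, p X → p Y → p (X + Y)) (hsmul : ∀ (c : ℂ) X, p X → p (c • X)) :
    p X := by
  have hX : X ∈ Submodule.span ℂ {D : WPlus n | ∃ (α : PosIndex n) (j : Fin n), D = zPlus α j} := by
    rw [span_zPlus]; trivial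
  induction hX using Submodule.span_induction with
  | mem x hx => obtain ⟨α, j, rfl⟩ := hx; exact hz α j
  | zero => exact h0
  | add x y _ _ hx hy => exact hadd x y hx hy
  | smul c x _ hx => exact hsmul c x hx

theorem add_tsub_ne_zero {α : Fin n →₀ ℕ} (hα : α ≠ 0) (β : Fin n →₀ ℕ) : α + β ≠ 0 := fun h =>
  hα (add_eq_zero.1 h).1

theorem zPlus_lie (α β : PosIndex n) (j k : Fin n) :
    ⁅zPlus α j, zPlus β k⁆ =
      (β.1 j : ℂ) • zPlus ⟨α.1 + (β.1 - Finsupp.single j 1), add_tsub_ne_zero α.2 _⟩ k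
        - (α.1 k : ℂ) • zPlus ⟨β.1 + (α.1 - Finsupp.single k 1), add_tsub_ne_zero β.2 _⟩ j :=
  Subtype.ext (zField_lie α.1 β.1 j k)

section Family

variable {U : Type u} [AddCommGroup U] [Module ℂ U]

/-- The linear map on `W_n^+` sending `z^α ∂_j` to `T j α`. -/
def wplusLin (T : Fin n → ((Fin n →₀ ℕ) →₀ Module.End ℂ U)) : WPlus n →ₗ[ℂ] Module.End ℂ U :=
  ∑ j, ∑ α ∈ (T j).support,
    { toFun := fun D => MvPolynomial.coeff α (D.1 (MvPolynomial.X j)) • T j α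
      map_add' := fun D D' => by
        rw [← add_smul]; rfl
      map_smul' := fun c D => by
        rw [RingHom.id_apply, smul_smul]; rfl }

theorem wplusLin_zPlus (T : Fin n → ((Fin n →₀ ℕ) →₀ Module.End ℂ U)) (α : PosIndex n)
    (j : Fin n) : wplusLin T (zPlus α j) = T j α.1 := by
  classical
  simp only [wplusLin, LinearMap.sum_apply, LinearMap.coe_mk, AddHom.coe_mk]
  have h : ∀ k (β : Fin n →₀ ℕ), MvPolynomial.coeff β ((zPlus α j).1 (MvPolynomial.X k)) =
      if j = k ∧ α.1 = β then 1 else 0 := by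
    intro k β
    change MvPolynomial.coeff β (zField α.1 j (MvPolynomial.X k)) = _
    rw [zField, Derivation.smul_apply, MvPolynomial.pderiv_X, Pi.single_apply]
    by_cases hjk : k = j
    · subst hjk
      simp [MvPolynomial.coeff_monomial]
    · simp [hjk, Ne.symm hjk]
  simp only [h]
  rw [Finset.sum_eq_single j]
  · simp +contextual [ite_smul, eq_comm]
  · intro k _ hk
    simp [Ne.symm hk]
  · simp

/-- The representation of `W_n^+` attached to a family satisfying the commutation relations. -/
def wplusRep (T : Fin n → ((Fin n →₀ ℕ) →₀ Module.End ℂ U))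
    (h : IsWPlusFamily fun j α => T j α) : WPlus n →ₗ⁅ℂ⁆ Module.End ℂ U :=
  { wplusLin T with
    map_lie' := by
      intro X Y
      change wplusLin T ⁅X, Y⁆ = ⁅wplusLin T X, wplusLin T Y⁆
      induction X using zPlus_induction with
      | h0 => simp
      | hadd X X' hX hX' => rw [add_lie, map_add, map_add, hX, hX', add_lie]
      | hsmul c X hX => rw [smul_lie, map_smul, map_smul, hX, smul_lie]
      | hz α j =>
        induction Y using zPlus_induction with
        | h0 => simp
        | hadd X X' hX hX' => rw [lie_add, map_add, map_add, hX, hX', lie_add]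
        | hsmul c X hX => rw [lie_smul, map_smul, map_smul, hX, lie_smul]
        | hz β k =>
          rw [zPlus_lie, map_sub, map_smul, map_smul]
          simp only [wplusLin_zPlus]
          rw [LieRing.of_associative_ring_bracket, h j k α.1 β.1 α.2 β.2] }

theorem wplusRep_zPlus (T : Fin n → ((Fin n →₀ ℕ) →₀ Module.End ℂ U))
    (h : IsWPlusFamily fun j α => T j α) (α : PosIndex n) (j : Fin n) :
    wplusRep T h (zPlus α j) = T j α.1 :=
  wplusLin_zPlus T α j

theorem wplus_hom_ext {L : Type*} [LieRing L] [LieAlgebra ℂ L] {ρ ρ' : WPlus n →ₗ⁅ℂ⁆ L}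
    (h : ∀ α j, ρ (zPlus α j) = ρ' (zPlus α j)) : ρ = ρ' := by
  ext X
  induction X using zPlus_induction with
  | hz α j => exact h α j
  | h0 => simp
  | hadd X Y hX hY => rw [map_add, map_add, hX, hY]
  | hsmul c X hX => rw [map_smul, map_smul, hX]

open Classical in
/-- The operators `ρ(z^α ∂_j)` for `α ≠ 0`, completed by the scalars `lam j` for `α = 0`. -/
def opFamily (lam : Fin n → ℂ) (ρ : WPlus n →ₗ⁅ℂ⁆ Module.End ℂ U) (j : Fin n) (α : Fin n →₀ ℕ) :
    Module.End ℂ U :=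
  if h : α ≠ 0 then ρ (zPlus ⟨α, h⟩ j) else lam j • 1

theorem opFamily_pos (lam : Fin n → ℂ) (ρ : WPlus n →ₗ⁅ℂ⁆ Module.End ℂ U) (j : Fin n)
    (α : PosIndex n) : opFamily lam ρ j α.1 = ρ (zPlus α j) := dif_pos α.2

theorem opFamily_zero (lam : Fin n → ℂ) (ρ : WPlus n →ₗ⁅ℂ⁆ Module.End ℂ U) (j : Fin n) :
    opFamily lam ρ j 0 = lam j • 1 := dif_neg (by simp)

theorem isWPlusFamily_opFamily (lam : Fin n → ℂ) (ρ : WPlus n →ₗ⁅ℂ⁆ Module.End ℂ U) :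
    IsWPlusFamily (opFamily lam ρ) := by
  intro i j α β hα hβ
  have := congrArg ρ (zPlus_lie ⟨α, hα⟩ ⟨β, hβ⟩ i j)
  rw [LieHom.map_lie, LieRing.of_associative_ring_bracket, map_sub, map_smul, map_smul] at this
  simpa only [← opFamily_pos lam] using this

/-! ### Nilpotency of finite-dimensional representations -/

/-- The Euler field `∑ z_i ∂_i`. -/
def euler (n : ℕ) : WPlus n :=
  ∑ i : Fin n, zPlus ⟨Finsupp.single i 1, by simp⟩ i

theorem euler_lie (β : PosIndex n) (j : Fin n) :
    ⁅euler n, zPlus β j⁆ = ((β.1.degree : ℂ) - 1) • zPlus β j := by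
  classical
  have h1 : ∀ i : Fin n, ⁅zPlus ⟨Finsupp.single i 1, by simp⟩ i, zPlus β j⁆ =
      ((β.1 i : ℂ) - if i = j then 1 else 0) • zPlus β j := by
    intro i
    rw [zPlus_lie, sub_smul]
    refine congrArg₂ (· - ·) ?_ ?_
    · by_cases h : β.1 i = 0
      · rw [h, Nat.cast_zero, zero_smul, zero_smul]
      · have h2 : Finsupp.single i 1 ≤ β.1 := by rw [Finsupp.single_le_iff]; omega
        have h3 : (⟨Finsupp.single i 1 + (β.1 - Finsupp.single i 1),
          add_tsub_ne_zero (by simp) _⟩ : PosIndex n) = β :=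
            Subtype.ext (add_tsub_cancel_of_le h2)
        rw [h3]
    · by_cases h : i = j
      · subst h
        have h3 : (⟨β.1 + (Finsupp.single i 1 - Finsupp.single i 1),
          add_tsub_ne_zero β.2 _⟩ : PosIndex n) = β :=
            Subtype.ext (by change β.1 + _ = β.1; rw [tsub_self, add_zero])
        rw [h3, if_pos rfl, Finsupp.single_eq_same, Nat.cast_one]
      · rw [if_neg h, Finsupp.single_eq_of_ne (Ne.symm h), Nat.cast_zero, zero_smul, zero_smul]
  have h2 : ((β.1.degree : ℂ) - 1) = ∑ i, ((β.1 i : ℂ) - if i = j then 1 else 0) := by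
    rw [Finset.sum_sub_distrib, Finset.sum_ite_eq' Finset.univ j, if_pos (Finset.mem_univ j),
      Finsupp.degree_eq_sum]
    push_cast
    rfl
  rw [h2, Finset.sum_smul, euler, sum_lie]
  exact Finset.sum_congr rfl fun i _ => h1 i

/-- A nonzero `ρ(z^β ∂_j)` is an eigenvector of `ad ρ(euler)` with eigenvalue `|β| - 1`. On the
finite-dimensional space `End U` there are finitely many eigenvalues, so `|β|` is bounded. -/
theorem finite_setOf_ne_zero [FiniteDimensional ℂ U] (ρ : WPlus n →ₗ⁅ℂ⁆ Module.End ℂ U) (j : Fin n) :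
    {β : PosIndex n | ρ (zPlus β j) ≠ 0}.Finite := by
  let E : Module.End ℂ (Module.End ℂ U) := LieAlgebra.ad ℂ (Module.End ℂ U) (ρ (euler n))
  have hE : ∀ β : PosIndex n, E (ρ (zPlus β j)) = ((β.1.degree : ℂ) - 1) • ρ (zPlus β j) := by
    intro β
    rw [LieAlgebra.ad_apply, ← LieHom.map_lie, euler_lie, map_smul]
  have hfin : {μ | E.HasEigenvalue μ}.Finite := E.finite_hasEigenvalue
  have h2 : {d : ℕ | E.HasEigenvalue ((d : ℂ) - 1)}.Finite :=
    hfin.preimage (f := fun d : ℕ => (d : ℂ) - 1) fun a _ b _ h => by simpa using h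
  obtain ⟨N, hN⟩ := h2.bddAbove
  have h3 : {β : Fin n →₀ ℕ | β.degree ≤ N}.Finite := Finsupp.finite_of_degree_le N
  refine (h3.preimage (f := fun β : PosIndex n => β.1) Subtype.val_injective.injOn).subset ?_
  intro β hβ
  exact hN (Module.End.hasEigenvalue_of_hasEigenvector ⟨Module.End.mem_eigenspace_iff.2 (hE β), hβ⟩)

/-- The finitely supported family of the operators `ρ(z^α ∂_j)`, with `lam j` for `α = 0`. -/
def taylorOps [FiniteDimensional ℂ U] (lam : Fin n → ℂ) (ρ : WPlus n →ₗ⁅ℂ⁆ Module.End ℂ U)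
    (j : Fin n) : (Fin n →₀ ℕ) →₀ Module.End ℂ U :=
  Finsupp.ofSupportFinite (opFamily lam ρ j) (by
    refine (((finite_setOf_ne_zero ρ j).image Subtype.val).union (Set.finite_singleton 0)).subset ?_
    intro α hα
    by_cases h : α = 0
    · exact Or.inr h
    · refine Or.inl ⟨⟨α, h⟩, ?_, rfl⟩
      rwa [Function.mem_support, opFamily_pos lam ρ j ⟨α, h⟩] at hα)

theorem coe_taylorOps [FiniteDimensional ℂ U] (lam : Fin n → ℂ) (ρ : WPlus n →ₗ⁅ℂ⁆ Module.End ℂ U)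
    (j : Fin n) : (taylorOps lam ρ j : (Fin n →₀ ℕ) → Module.End ℂ U) = opFamily lam ρ j := rfl

/-- The operators `D_j(s) = λ_j + ∑_β s^β/β! ρ(z^β ∂_j)`. -/
def jetOps [FiniteDimensional ℂ U] (lam : Fin n → ℂ) (ρ : WPlus n →ₗ⁅ℂ⁆ Module.End ℂ U)
    (j : Fin n) (s : Fin n → ℤ) : Module.End ℂ U :=
  (taylorOps lam ρ j).sum fun α A => powFact s α • A

theorem isTaylorExpansion_jetOps [FiniteDimensional ℂ U] (lam : Fin n → ℂ)
    (ρ : WPlus n →ₗ⁅ℂ⁆ Module.End ℂ U) : IsTaylorExpansion (jetOps lam ρ) (taylorOps lam ρ) :=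
  fun _ _ => rfl

theorem isJetFamily_jetOps [FiniteDimensional ℂ U] (lam : Fin n → ℂ)
    (ρ : WPlus n →ₗ⁅ℂ⁆ Module.End ℂ U) : IsJetFamily (jetOps lam ρ) :=
  (isJetFamily_iff (isTaylorExpansion_jetOps lam ρ) (opFamily_zero lam ρ)).2
    (isWPlusFamily_opFamily lam ρ)

theorem jetOps_zero [FiniteDimensional ℂ U] (lam : Fin n → ℂ)
    (ρ : WPlus n →ₗ⁅ℂ⁆ Module.End ℂ U) (j : Fin n) : jetOps lam ρ j 0 = lam j • 1 :=
  (isTaylorExpansion_jetOps lam ρ).apply_zero j |>.trans (opFamily_zero lam ρ j)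

theorem jetOps_apply [FiniteDimensional ℂ U] (lam : Fin n → ℂ)
    (ρ : WPlus n →ₗ⁅ℂ⁆ Module.End ℂ U) (j : Fin n) (s : Fin n → ℤ) (v : U) :
    jetOps lam ρ j s v = lam j • v + ∑ᶠ β : PosIndex n, powFact s β.1 • ρ (zPlus β j) v := by
  classical
  have hfin := finite_setOf_ne_zero ρ j
  rw [finsum_eq_sum_of_support_subset (s := hfin.toFinset) _ (by
    intro β hβ
    rw [hfin.coe_toFinset]
    intro h
    exact hβ (by simp [h]))]
  rw [jetOps, Finsupp.sum_of_support_subset _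
    (s := insert 0 (hfin.toFinset.map (Function.Embedding.subtype _)))]
  · rw [Finset.sum_insert (by simp), LinearMap.add_apply, LinearMap.sum_apply, Finset.sum_map,
      coe_taylorOps, opFamily_zero, powFact_zero_right, one_smul]
    congr 1
    refine Finset.sum_congr rfl fun β _ => ?_
    rw [Function.Embedding.subtype_apply, opFamily_pos]
    rfl
  · intro α hα
    rw [Finsupp.mem_support_iff, coe_taylorOps] at hα
    rw [Finset.mem_insert]
    by_cases h : α = 0
    · exact Or.inl h
    · rw [opFamily_pos lam ρ j ⟨α, h⟩] at hα
      exact Or.inr (Finset.mem_map.2 ⟨⟨α, h⟩, hfin.mem_toFinset.2 hα, rfl⟩)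
  · simp

end Family

/-! ### The module attached to a family of operators -/

section Construction

variable {U : Type u} [AddCommGroup U] [Module ℂ U]

theorem tensor_induction {p : TorusFun n ⊗[ℂ] U → Prop} (x : TorusFun n ⊗[ℂ] U)
    (hexp : ∀ m v, p (fexp m ⊗ₜ[ℂ] v)) (h0 : p 0) (hadd : ∀ x y, p x → p y → p (x + y)) : p x := by
  induction x using TensorProduct.induction_on with
  | zero => exact h0
  | add x y hx hy => exact hadd x y hx hy
  | tmul f v =>
    induction f using fexp_induction generalizing v with
    | hexp m => exact hexp m v
    | h0 => rw [TensorProduct.zero_tmul]; exact h0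
    | hadd f g hf hg => rw [TensorProduct.add_tmul]; exact hadd _ _ (hf v) (hg v)
    | hsmul c f hf => rw [TensorProduct.smul_tmul]; exact hf _

theorem fexp_smul_tmul (s m : Fin n → ℤ) (v : U) :
    fexp s • (fexp m ⊗ₜ[ℂ] v : TorusFun n ⊗[ℂ] U) = fexp (s + m) ⊗ₜ[ℂ] v := by
  rw [TensorProduct.smul_tmul', smul_eq_mul, fexp_add]

/-- The operator `e^{2πi m·x} v ↦ e^{2πi (m+s)·x} A v` on `ℱ ⊗ U`. -/
def shiftOp (s : Fin n → ℤ) : Module.End ℂ U →ₗ[ℂ] Module.End ℂ (TorusFun n ⊗[ℂ] U) :=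
  TensorProduct.mapBilinear (RingHom.id ℂ) (TorusFun n) U (TorusFun n) U (LinearMap.mulLeft ℂ (fexp s))

theorem shiftOp_tmul (s m : Fin n → ℤ) (A : Module.End ℂ U) (v : U) :
    shiftOp s A (fexp m ⊗ₜ[ℂ] v) = fexp (m + s) ⊗ₜ[ℂ] A v := by
  change (fexp s * fexp m) ⊗ₜ[ℂ] A v = _
  rw [add_comm m s, fexp_add]

variable (D : Fin n → (Fin n → ℤ) → Module.End ℂ U)

/-- The action of the vector fields on `ℱ ⊗ U` given by the operators `D_j(s)`. -/
def opAction : W n →ₗ[ℂ] Module.End ℂ (TorusFun n ⊗[ℂ] U) where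
  toFun X := TensorProduct.map X.toLinearMap LinearMap.id +
    ∑ j, linExt (fun s => shiftOp s (D j s)) (coord X j)
  map_add' X Y := by
    have h1 : ∀ j, coord (X + Y) j = coord X j + coord Y j := fun j => by
      simp [coord, mul_add]
    have h2 : (X + Y : W n).toLinearMap = X.toLinearMap + Y.toLinearMap := rfl
    simp only [h1, h2, map_add, Finset.sum_add_distrib, TensorProduct.map_add_left]
    abel
  map_smul' c X := by
    have h1 : ∀ j, coord (c • X) j = c • coord X j := fun j => by
      simp [coord]
    have h2 : (c • X : W n).toLinearMap = c • X.toLinearMap := rfl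
    simp only [h1, h2, map_smul, TensorProduct.map_smul_left, ← Finset.smul_sum, ← smul_add,
      RingHom.id_apply]

theorem opAction_dField (j : Fin n) (s m : Fin n → ℤ) (v : U) :
    opAction D (dField j s) (fexp m ⊗ₜ[ℂ] v) =
      (m j : ℂ) • (fexp (m + s) ⊗ₜ[ℂ] v) + fexp (m + s) ⊗ₜ[ℂ] D j s v := by
  change TensorProduct.map (dField j s).toLinearMap LinearMap.id (fexp m ⊗ₜ[ℂ] v) +
    (∑ i, linExt (fun s => shiftOp s (D i s)) (coord (dField j s) i)) (fexp m ⊗ₜ[ℂ] v) = _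
  congr 1
  · rw [TensorProduct.map_tmul]
    change dField j s (fexp m) ⊗ₜ[ℂ] v = _
    rw [dField_fexp, TensorProduct.smul_tmul', add_comm]
  · rw [Finset.sum_eq_single j]
    · rw [coord_dField, if_pos rfl, linExt_fexp, shiftOp_tmul]
    · intro i _ hi
      rw [coord_dField, if_neg (Ne.symm hi), map_zero]
    · simp

theorem opAction_smul (X : W n) (f : TorusFun n) (w : TorusFun n ⊗[ℂ] U) :
    opAction D X (f • w) = X f • w + f • opAction D X w := by
  induction w using tensor_induction with
  | h0 => simp
  | hadd x y hx hy =>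
    rw [smul_add, map_add, map_add, hx, hy, smul_add, smul_add]
    abel
  | hexp m v =>
    induction f using fexp_induction with
    | h0 => simp
    | hadd f g hf hg =>
      rw [add_smul, map_add, map_add, hf, hg, add_smul, add_smul]
      abel
    | hsmul c f hf =>
      rw [smul_assoc, map_smul, hf, Derivation.map_smul, smul_assoc, smul_assoc, smul_add]
    | hexp k =>
      induction X using dField_induction with
      | h0 => simp
      | hadd X Y hX hY =>
        rw [map_add, LinearMap.add_apply, LinearMap.add_apply, hX, hY, Derivation.add_apply,
          add_smul, smul_add]
        abel
      | hsmul c X hX =>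
        rw [map_smul (opAction D), LinearMap.smul_apply, LinearMap.smul_apply, hX,
          Derivation.smul_apply, smul_assoc, smul_add, smul_comm (fexp k) c]
      | hd j s =>
        have h1 : fexp k • ((m j : ℂ) • (fexp (m + s) ⊗ₜ[ℂ] v : TorusFun n ⊗[ℂ] U)) =
            (m j : ℂ) • (fexp (k + m + s) ⊗ₜ[ℂ] v) := by
          rw [smul_comm, fexp_smul_tmul, add_assoc]
        rw [fexp_smul_tmul, opAction_dField, opAction_dField, dField_fexp, smul_assoc,
          fexp_smul_tmul, smul_add, h1, fexp_smul_tmul, Pi.add_apply, Int.cast_add, add_smul,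
          add_assoc k m s, show s + k + m = k + (m + s) by abel]
        abel

variable {D}

/-- By linearity it suffices to take fields `d_i(s)`, `d_j(m)` and a tensor `e^{2πi k·x} ⊗ v`; the
terms in `k` cancel and the jet relation remains. -/
theorem opAction_lie (h : IsJetFamily D) (X Y : W n) (w : TorusFun n ⊗[ℂ] U) :
    opAction D ⁅X, Y⁆ w = opAction D X (opAction D Y w) - opAction D Y (opAction D X w) := by
  have add_left : ∀ X X' Y : W n, ⁅X + X', Y⁆ = ⁅X, Y⁆ + ⁅X', Y⁆ := fun X X' Y => by
    refine Derivation.ext fun f => ?_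
    simp only [Derivation.commutator_apply, Derivation.add_apply, map_add]
    abel
  have add_right : ∀ X Y Y' : W n, ⁅X, Y + Y'⁆ = ⁅X, Y⁆ + ⁅X, Y'⁆ := fun X Y Y' => by
    refine Derivation.ext fun f => ?_
    simp only [Derivation.commutator_apply, Derivation.add_apply, map_add]
    abel
  have smul_left : ∀ (c : ℂ) (X Y : W n), ⁅c • X, Y⁆ = c • ⁅X, Y⁆ := fun c X Y => by
    refine Derivation.ext fun f => ?_
    simp only [Derivation.commutator_apply, Derivation.smul_apply, Derivation.map_smul, smul_sub]
  have smul_right : ∀ (c : ℂ) (X Y : W n), ⁅X, c • Y⁆ = c • ⁅X, Y⁆ := fun c X Y => by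
    refine Derivation.ext fun f => ?_
    simp only [Derivation.commutator_apply, Derivation.smul_apply, Derivation.map_smul, smul_sub]
  have zero_left : ∀ Y : W n, ⁅(0 : W n), Y⁆ = 0 := fun Y => by
    refine Derivation.ext fun f => ?_
    simp only [Derivation.commutator_apply, Derivation.zero_apply, map_zero, sub_zero]
  have zero_right : ∀ X : W n, ⁅X, (0 : W n)⁆ = 0 := fun X => by
    refine Derivation.ext fun f => ?_
    simp only [Derivation.commutator_apply, Derivation.zero_apply, map_zero, sub_zero]
  induction X using dField_induction with
  | h0 => simp only [zero_left, map_zero, LinearMap.zero_apply, sub_zero]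
  | hadd X X' hX hX' =>
    simp only [add_left, map_add, LinearMap.add_apply, hX, hX']
    abel
  | hsmul c X hX => simp only [smul_left, map_smul, LinearMap.smul_apply, hX, smul_sub]
  | hd i s =>
    induction Y using dField_induction with
    | h0 => simp only [zero_right, map_zero, LinearMap.zero_apply, sub_zero]
    | hadd X X' hX hX' =>
      simp only [add_right, map_add, LinearMap.add_apply, hX, hX']
      abel
    | hsmul c X hX => simp only [smul_right, map_smul, LinearMap.smul_apply, hX, smul_sub]
    | hd j m =>
      induction w using tensor_induction with
      | h0 => simp only [map_zero, sub_zero]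
      | hadd x y hx hy =>
        simp only [map_add, hx, hy]
        abel
      | hexp k v =>
        have hv := LinearMap.congr_fun (h i j s m) v
        have e1 : k + m + s = k + (s + m) := by abel
        have e2 : k + s + m = k + (s + m) := by abel
        simp only [LinearMap.sub_apply, Module.End.mul_apply, LinearMap.smul_apply] at hv
        simp only [lie_dField, map_sub, map_smul, LinearMap.sub_apply, LinearMap.smul_apply,
          opAction_dField, map_add, e1, e2, Pi.add_apply, Int.cast_add,
          ← TensorProduct.tmul_smul, ← TensorProduct.tmul_add, ← TensorProduct.tmul_sub]
        congr 1
        linear_combination (norm := module) -hv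

/-- The module `ℱ ⊗ U` in `𝒥` attached to a family of operators. -/
def ofOps [FiniteDimensional ℂ U] (D : Fin n → (Fin n → ℤ) → Module.End ℂ U) (h : IsJetFamily D)
    {lam : Fin n → ℂ} (h0 : ∀ j, D j 0 = lam j • 1) : JMod.{u} n :=
  letI : LieRingModule (W n) (TorusFun n ⊗[ℂ] U) :=
    { bracket := fun X w => opAction D X w
      add_lie := fun X Y w => by
        change opAction D (X + Y) w = opAction D X w + opAction D Y w
        rw [map_add, LinearMap.add_apply]
      lie_add := fun X w w' => map_add (opAction D X) w w'
      leibniz_lie := fun X Y w => by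
        change opAction D X (opAction D Y w) =
          opAction D ⁅X, Y⁆ w + opAction D Y (opAction D X w)
        rw [opAction_lie h, sub_add_cancel] }
  letI : LieModule ℂ (W n) (TorusFun n ⊗[ℂ] U) :=
    { smul_lie := fun c X w => by
        change opAction D (c • X) w = c • opAction D X w
        rw [map_smul, LinearMap.smul_apply]
      lie_smul := fun c X w => map_smul (opAction D X) c w }
  { carrier := TorusFun n ⊗[ℂ] U
    diagonalizable := by
      refine eq_top_iff.2 fun w _ => ?_
      induction w using tensor_induction with
      | h0 => exact Submodule.zero_mem _
      | hadd x y hx hy => exact Submodule.add_mem _ (hx trivial) (hy trivial)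
      | hexp m v =>
        refine Submodule.subset_span ⟨fun j => (m j : ℂ) + lam j, fun j => ?_⟩
        change opAction D (dPartial j) _ = _
        rw [← dField_zero, opAction_dField, h0, add_zero, LinearMap.smul_apply,
          Module.End.one_apply, TensorProduct.tmul_smul, ← add_smul]
    free := inferInstance
    finite := inferInstance
    leibniz := fun X f w => opAction_smul D X f w }

end Construction

/-! ### Modules isomorphic to `ℱ ⊗ U` -/

section Model

variable {U : Type u} [AddCommGroup U] [Module ℂ U]

/-- `J` is `ℱ ⊗ U` as a module over the functions, by an isomorphism `Φ` with
`d_j(s) (1 ⊗ v) = e^{2πi s·x} ⊗ D_j(s) v`. -/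
structure Model (J : JMod.{u} n) (D : Fin n → (Fin n → ℤ) → Module.End ℂ U) where
  /-- The isomorphism. -/
  equiv : (TorusFun n ⊗[ℂ] U) ≃ₗ[TorusFun n] J
  lie_equiv : ∀ (j : Fin n) (s m : Fin n → ℤ) (v : U), ⁅dField j s, equiv (fexp m ⊗ₜ[ℂ] v)⁆ =
    (m j : ℂ) • equiv (fexp (m + s) ⊗ₜ[ℂ] v) + equiv (fexp (m + s) ⊗ₜ[ℂ] D j s v)

/-- The tautological model of the module attached to a family of operators. -/
def ofOpsModel [FiniteDimensional ℂ U] (D : Fin n → (Fin n → ℤ) → Module.End ℂ U)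
    (h : IsJetFamily D) {lam : Fin n → ℂ} (h0 : ∀ j, D j 0 = lam j • 1) : Model (ofOps D h h0) D where
  equiv := LinearEquiv.refl (TorusFun n) (TorusFun n ⊗[ℂ] U)
  lie_equiv j s m v := opAction_dField D j s m v

end Model

/-! ### Submodules and weights of a model -/

section TensorFacts

variable {U : Type u} [AddCommGroup U] [Module ℂ U]

theorem exists_finsupp_tensor (x : TorusFun n ⊗[ℂ] U) :
    ∃ v : (Fin n → ℤ) →₀ U, x = v.sum fun m u => fexp m ⊗ₜ[ℂ] u := by
  induction x using tensor_induction with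
  | hexp m v => exact ⟨Finsupp.single m v, by
      rw [Finsupp.sum_single_index (h := fun m u => fexp m ⊗ₜ[ℂ] u)
        (TensorProduct.tmul_zero _ _)]⟩
  | h0 => exact ⟨0, by rw [Finsupp.sum_zero_index]⟩
  | hadd x y hx hy =>
    obtain ⟨v, rfl⟩ := hx
    obtain ⟨w, rfl⟩ := hy
    exact ⟨v + w, by
      rw [Finsupp.sum_add_index' (fun _ => TensorProduct.tmul_zero _ _)
        (fun _ _ _ => TensorProduct.tmul_add _ _ _)]⟩

/-- Evaluation at the origin of the torus, `ℱ ⊗ U → U`. -/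
def augT : TorusFun n ⊗[ℂ] U →ₗ[ℂ] U :=
  (TensorProduct.lid ℂ U).toLinearMap ∘ₗ TensorProduct.map aug.toLinearMap LinearMap.id

theorem augT_tmul (f : TorusFun n) (v : U) : augT (f ⊗ₜ[ℂ] v) = aug f • v := by
  simp [augT]

@[simp]
theorem augT_fexp (m : Fin n → ℤ) (v : U) : augT (fexp m ⊗ₜ[ℂ] v) = v := by
  rw [augT_tmul, aug_fexp, one_smul]

theorem augT_smul (f : TorusFun n) (x : TorusFun n ⊗[ℂ] U) : augT (f • x) = aug f • augT x := by
  induction x using tensor_induction with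
  | h0 => simp
  | hadd x y hx hy => rw [smul_add, map_add, map_add, hx, hy, smul_add]
  | hexp m v =>
    rw [TensorProduct.smul_tmul', augT_tmul, augT_tmul, smul_eq_mul, map_mul, mul_smul]

end TensorFacts

namespace Model

variable {U : Type u} [AddCommGroup U] [Module ℂ U] {J : JMod.{u} n}
  {D : Fin n → (Fin n → ℤ) → Module.End ℂ U} (M : Model J D)

/-- The vector of `J` corresponding to `e^{2πi m·x} ⊗ v`. -/
def vec (m : Fin n → ℤ) : U →ₗ[ℂ] J where
  toFun v := M.equiv (fexp m ⊗ₜ[ℂ] v)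
  map_add' v w := by rw [TensorProduct.tmul_add, map_add]
  map_smul' c v := by
    rw [TensorProduct.tmul_smul, RingHom.id_apply]
    exact LinearMap.map_smul_of_tower M.equiv.toLinearMap c _

theorem vec_apply (m : Fin n → ℤ) (v : U) : M.vec m v = M.equiv (fexp m ⊗ₜ[ℂ] v) := rfl

theorem lie_vec (j : Fin n) (s m : Fin n → ℤ) (v : U) :
    ⁅dField j s, M.vec m v⁆ = (m j : ℂ) • M.vec (m + s) v + M.vec (m + s) (D j s v) :=
  M.lie_equiv j s m v

theorem fexp_smul_vec (s m : Fin n → ℤ) (v : U) : fexp s • M.vec m v = M.vec (s + m) v := by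
  rw [vec_apply, ← map_smul, fexp_smul_tmul, vec_apply]

theorem augT_symm_vec (m : Fin n → ℤ) (v : U) : augT (M.equiv.symm (M.vec m v)) = v := by
  rw [vec_apply, LinearEquiv.symm_apply_apply, augT_fexp]

theorem vec_injective (m : Fin n → ℤ) : Function.Injective (M.vec m) :=
  Function.LeftInverse.injective (g := fun w => augT (M.equiv.symm w)) (M.augT_symm_vec m)

theorem exists_eq_sum_vec (w : J) :
    ∃ v : (Fin n → ℤ) →₀ U, w = ∑ m ∈ v.support, M.vec m (v m) := by
  obtain ⟨v, hv⟩ := exists_finsupp_tensor (M.equiv.symm w)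
  refine ⟨v, ?_⟩
  rw [← M.equiv.apply_symm_apply w, hv, Finsupp.sum, map_sum]
  rfl

include M in
theorem nontrivial_iff : Nontrivial J ↔ Nontrivial U := by
  constructor
  · intro h
    by_contra hU
    rw [not_nontrivial_iff_subsingleton] at hU
    refine not_subsingleton J ⟨fun a b => ?_⟩
    obtain ⟨v, rfl⟩ := M.exists_eq_sum_vec a
    obtain ⟨w, rfl⟩ := M.exists_eq_sum_vec b
    have : ∀ x : U, x = 0 := fun x => Subsingleton.elim _ _
    simp [this]
  · intro h
    exact (M.vec_injective 0).nontrivial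

variable {lam : Fin n → ℂ} (h0 : ∀ j, D j 0 = lam j • 1)

include h0 in
theorem lie_dPartial_vec (j : Fin n) (m : Fin n → ℤ) (v : U) :
    ⁅dPartial j, M.vec m v⁆ = (lam + JMod.intVec m) j • M.vec m v := by
  rw [← dField_zero, lie_vec, add_zero, h0, LinearMap.smul_apply, map_smul, Module.End.one_apply,
    ← add_smul, Pi.add_apply, add_comm]
  rfl

include h0 in
theorem vec_mem_weightSpace (m : Fin n → ℤ) (v : U) :
    M.vec m v ∈ J.weightSpace (lam + JMod.intVec m) := fun j => M.lie_dPartial_vec h0 j m v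

include h0 in
-- Components of a weight vector in other weights must vanish.
theorem weightVector_eq {μ : Fin n → ℂ} {w : J} (hw : w ∈ J.weightSpace μ)
    (v : (Fin n → ℤ) →₀ U) (hv : w = ∑ m ∈ v.support, M.vec m (v m)) :
    w = ∑ m ∈ v.support with lam + JMod.intVec m = μ, M.vec m (v m) := by
  classical
  set y := ∑ m ∈ v.support with lam + JMod.intVec m = μ, M.vec m (v m) with hy
  have hyμ : y ∈ J.weightSpace μ := by
    refine Submodule.sum_mem _ fun m hm => ?_
    rw [← (Finset.mem_filter.1 hm).2]
    exact M.vec_mem_weightSpace h0 m _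
  have hsplit : y - w + ∑ m ∈ v.support with ¬ lam + JMod.intVec m = μ, M.vec m (v m) = 0 := by
    rw [hv, ← Finset.sum_filter_add_sum_filter_not v.support (fun m => lam + JMod.intVec m = μ)]
    abel
  -- The index `none` carries `y - w`, of weight `μ`; the indices `some m` carry the components of
  -- other weights. Their total is zero, so separation gives `y - w = 0`.
  have key := mem_of_add_sum_mem (κ := Option (Fin n → ℤ)) (JMod.dOp J) ⊥ (by simp)
    (fun o => o.elim μ fun m => lam + JMod.intVec m) none
    ((v.support.filter fun m => ¬ lam + JMod.intVec m = μ).map Function.Embedding.some)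
    (by
      intro o ho
      obtain ⟨m, hm, rfl⟩ := Finset.mem_map.1 ho
      exact (Finset.mem_filter.1 hm).2)
    (fun o => o.elim (y - w) fun m => M.vec m (v m))
    (by
      rintro (_ | m) j
      · exact Submodule.sub_mem _ hyμ hw j
      · exact M.lie_dPartial_vec h0 j m _)
    (by
      rw [Finset.sum_map]
      exact hsplit)
  exact (sub_eq_zero.1 key).symm

include h0 in
theorem exists_vec_of_mem_weightSpace {w : J} (hw : w ∈ J.weightSpace lam) :
    ∃ v, w = M.vec 0 v := by
  classical
  obtain ⟨v, hv⟩ := M.exists_eq_sum_vec w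
  refine ⟨v 0, ?_⟩
  have h := M.weightVector_eq h0 hw v hv
  have h1 : ∀ m : Fin n → ℤ, lam + JMod.intVec m = lam ↔ m = 0 := fun m => by
    rw [add_eq_left, ← JMod.intVec_zero, JMod.intVec_injective.eq_iff]
  simp only [h1] at h
  rw [h, Finset.sum_filter]
  simp +contextual

include M h0 in
theorem sub_mem_intLattice {μ : Fin n → ℂ} (hμ : J.weightSpace μ ≠ ⊥) : μ - lam ∈ intLattice n := by
  classical
  obtain ⟨w, hw, hw0⟩ := Submodule.exists_mem_ne_zero_of_ne_bot hμ
  obtain ⟨v, hv⟩ := M.exists_eq_sum_vec w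
  have h := M.weightVector_eq h0 hw v hv
  rw [h] at hw0
  obtain ⟨m, hm, -⟩ := Finset.exists_ne_zero_of_sum_ne_zero hw0
  refine JMod.mem_intLattice.2 ⟨m, ?_⟩
  rw [← (Finset.mem_filter.1 hm).2, add_sub_cancel_left]

/-- The fibre at the origin of a submodule of `J`. -/
def fibre (P : Submodule (TorusFun n) J) : Submodule ℂ U := (P.restrictScalars ℂ).comap (M.vec 0)

theorem mem_fibre {P : Submodule (TorusFun n) J} {v : U} : v ∈ M.fibre P ↔ M.vec 0 v ∈ P := Iff.rfl

theorem vec_mem_iff {P : Submodule (TorusFun n) J} {v : U} (m : Fin n → ℤ) :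
    M.vec m v ∈ P ↔ v ∈ M.fibre P := by
  rw [mem_fibre]
  constructor
  · intro h
    have := P.smul_mem (fexp (-m)) h
    rwa [fexp_smul_vec, neg_add_cancel] at this
  · intro h
    have := P.smul_mem (fexp m) h
    rwa [fexp_smul_vec, add_zero] at this

/-- Stability of a subspace under a family of operators. -/
def IsOpStable (D : Fin n → (Fin n → ℤ) → Module.End ℂ U) (Q : Submodule ℂ U) : Prop :=
  ∀ j s, ∀ v ∈ Q, D j s v ∈ Q

theorem isOpStable_fibre {P : Submodule (TorusFun n) J} (hP : J.IsStable P) :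
    IsOpStable D (M.fibre P) := by
  intro j s v hv
  have := hP (dField j s) _ hv
  rw [lie_vec, Pi.zero_apply, Int.cast_zero, zero_smul, zero_add] at this
  exact (M.vec_mem_iff _).1 this

include h0 in
-- A stable submodule contains the weight components of its elements, and multiplication by an
-- exponential moves each component to the fibre.
theorem le_of_fibre_le {P P' : Submodule (TorusFun n) J} (hP : J.IsStable P)
    (h : M.fibre P ≤ M.fibre P') : P ≤ P' := by
  intro w hw
  obtain ⟨v, rfl⟩ := M.exists_eq_sum_vec w
  refine Submodule.sum_mem _ fun m hm => ?_
  rw [vec_mem_iff]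
  refine h ((M.vec_mem_iff m).1 ?_)
  exact mem_of_sum_mem (JMod.dOp J) (P.restrictScalars ℂ) (fun j w hw => hP _ w hw)
    (fun m => lam + JMod.intVec m) (fun a b hab => JMod.intVec_injective (add_left_cancel hab))
    v.support (fun m => M.vec m (v m)) (fun m j => M.lie_dPartial_vec h0 j m _) hw hm

/-- The submodule of `J` generated by a subspace of the fibre. -/
def extend (Q : Submodule ℂ U) : Submodule (TorusFun n) J :=
  Submodule.span (TorusFun n) (M.vec 0 '' Q)

theorem vec_mem_extend {Q : Submodule ℂ U} (m : Fin n → ℤ) {v : U} (hv : v ∈ Q) :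
    M.vec m v ∈ M.extend Q :=
  (M.vec_mem_iff m).2 (Submodule.subset_span ⟨v, hv, rfl⟩)

/-- Evaluation at the origin sends the submodule generated by `Q` into `Q`, so nothing new appears
in the fibre. -/
theorem fibre_extend (Q : Submodule ℂ U) : M.fibre (M.extend Q) = Q := by
  apply le_antisymm
  · intro v hv
    have key : ∀ w ∈ M.extend Q, augT (M.equiv.symm w) ∈ Q := by
      intro w hw
      induction hw using Submodule.span_induction with
      | mem x hx =>
        obtain ⟨v, hv, rfl⟩ := hx
        rwa [augT_symm_vec]
      | zero => simp
      | add x y _ _ hx hy => rw [map_add, map_add]; exact Q.add_mem hx hy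
      | smul f x _ hx => rw [map_smul, augT_smul]; exact Q.smul_mem _ hx
    have := key _ hv
    rwa [augT_symm_vec] at this
  · intro v hv
    exact M.vec_mem_extend 0 hv

theorem isStable_extend {Q : Submodule ℂ U} (hQ : IsOpStable D Q) : J.IsStable (M.extend Q) := by
  intro X w hw
  induction hw using Submodule.span_induction with
  | zero => rw [lie_zero]; exact Submodule.zero_mem _
  | add x y _ _ hx hy => rw [lie_add]; exact Submodule.add_mem _ hx hy
  | smul f x hx hx' =>
    rw [J.leibniz]
    exact Submodule.add_mem _ (Submodule.smul_mem _ _ hx) (Submodule.smul_mem _ _ hx')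
  | mem x hx =>
    obtain ⟨v, hv, rfl⟩ := hx
    induction X using dField_induction with
    | h0 => rw [zero_lie]; exact Submodule.zero_mem _
    | hadd X Y hX hY => rw [add_lie]; exact Submodule.add_mem _ hX hY
    | hsmul c X hX => rw [JMod.field_smul_lie]; exact Submodule.smul_of_tower_mem _ c hX
    | hd j s =>
      rw [lie_vec, Pi.zero_apply, Int.cast_zero, zero_smul, zero_add]
      exact M.vec_mem_extend _ (hQ j s v hv)

theorem fibre_bot : M.fibre ⊥ = ⊥ := by
  rw [eq_bot_iff]
  intro v hv
  exact M.vec_injective 0 (((Submodule.mem_bot (TorusFun n)).1 hv).trans (map_zero _).symm)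

theorem fibre_top : M.fibre ⊤ = ⊤ := eq_top_iff.2 fun _ _ => Submodule.mem_top

theorem isStable_top : J.IsStable ⊤ := fun _ _ _ => Submodule.mem_top

include h0 in
theorem eq_bot_of_fibre {P : Submodule (TorusFun n) J} (hP : J.IsStable P)
    (h : M.fibre P = ⊥) : P = ⊥ :=
  eq_bot_iff.2 (M.le_of_fibre_le h0 hP (by rw [h]; exact bot_le))

include h0 in
theorem eq_top_of_fibre {P : Submodule (TorusFun n) J} (h : M.fibre P = ⊤) : P = ⊤ :=
  eq_top_iff.2 (M.le_of_fibre_le h0 isStable_top (by rw [h]; exact le_top))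

include M h0 in
theorem irreducible_iff : J.Irreducible ↔
    Nontrivial U ∧ ∀ Q : Submodule ℂ U, IsOpStable D Q → Q = ⊥ ∨ Q = ⊤ := by
  rw [JMod.Irreducible, M.nontrivial_iff]
  refine and_congr_right fun _ => ⟨fun h Q hQ => ?_, fun h P hP => ?_⟩
  · rw [← M.fibre_extend Q]
    rcases h _ (M.isStable_extend hQ) with h | h <;> rw [h]
    · exact Or.inl M.fibre_bot
    · exact Or.inr M.fibre_top
  · rcases h _ (M.isOpStable_fibre hP) with h | h
    · exact Or.inl (M.eq_bot_of_fibre h0 hP h)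
    · exact Or.inr (M.eq_top_of_fibre h0 h)

include M h0 in
-- The maps `fibre` and `extend` carry complementary pairs to complementary pairs.
theorem indecomposable_iff : J.Indecomposable ↔
    Nontrivial U ∧ ∀ Q Q' : Submodule ℂ U, IsOpStable D Q → IsOpStable D Q' → IsCompl Q Q' →
      Q = ⊥ ∨ Q' = ⊥ := by
  rw [JMod.Indecomposable, M.nontrivial_iff]
  refine and_congr_right fun _ => ⟨fun h Q Q' hQ hQ' hc => ?_, fun h P P' hP hP' hc => ?_⟩
  · have hs : J.IsStable (M.extend Q ⊓ M.extend Q') := fun X w hw =>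
      ⟨M.isStable_extend hQ X w hw.1, M.isStable_extend hQ' X w hw.2⟩
    have h1 : IsCompl (M.extend Q) (M.extend Q') := by
      refine ⟨disjoint_iff.2 (M.eq_bot_of_fibre h0 hs ?_),
        codisjoint_iff.2 (M.eq_top_of_fibre h0 ?_)⟩
      · have h2 : M.fibre (M.extend Q ⊓ M.extend Q') = M.fibre (M.extend Q) ⊓ M.fibre (M.extend Q') :=
          rfl
        rw [h2, fibre_extend, fibre_extend, hc.inf_eq_bot]
      · rw [eq_top_iff, ← hc.sup_eq_top]
        refine sup_le ?_ ?_
        · exact fun v hv => Submodule.mem_sup_left (M.vec_mem_extend 0 hv)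
        · exact fun v hv => Submodule.mem_sup_right (M.vec_mem_extend 0 hv)
    rw [← M.fibre_extend Q, ← M.fibre_extend Q']
    rcases h _ _ (M.isStable_extend hQ) (M.isStable_extend hQ') h1 with h | h <;> rw [h]
    · exact Or.inl M.fibre_bot
    · exact Or.inr M.fibre_bot
  · have h1 : IsCompl (M.fibre P) (M.fibre P') := by
      refine ⟨disjoint_iff.2 ?_, codisjoint_iff.2 ?_⟩
      · have h2 : M.fibre P ⊓ M.fibre P' = M.fibre (P ⊓ P') := rfl
        rw [h2, hc.inf_eq_bot, fibre_bot]
      · have h2 : M.extend (M.fibre P ⊔ M.fibre P') = ⊤ := by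
          rw [eq_top_iff, ← hc.sup_eq_top]
          refine sup_le (M.le_of_fibre_le h0 hP ?_) (M.le_of_fibre_le h0 hP' ?_)
          · rw [fibre_extend]; exact le_sup_left
          · rw [fibre_extend]; exact le_sup_right
        rw [← M.fibre_extend (M.fibre P ⊔ M.fibre P'), h2, fibre_top]
    rcases h _ _ (M.isOpStable_fibre hP) (M.isOpStable_fibre hP') h1 with h | h
    · exact Or.inl (M.eq_bot_of_fibre h0 hP h)
    · exact Or.inr (M.eq_bot_of_fibre h0 hP' h)

/-! ### Comparison of models -/

variable {U' : Type u} [AddCommGroup U'] [Module ℂ U'] {J' : JMod.{u} n}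
  {D' : Fin n → (Fin n → ℤ) → Module.End ℂ U'}

include M h0 in
-- Both fibres are identified with the same weight space `J_λ`, on which the operators are
-- determined by `J`.
theorem exists_intertwiner (M' : Model J D') (h0' : ∀ j, D' j 0 = lam j • 1) :
    ∃ φ : U ≃ₗ[ℂ] U', ∀ j s v, φ (D j s v) = D' j s (φ v) := by
  have hφ : ∀ v, M'.vec 0 (augT (M'.equiv.symm (M.vec 0 v))) = M.vec 0 v := fun v => by
    have h := M.vec_mem_weightSpace h0 0 v
    rw [JMod.intVec_zero, add_zero] at h
    obtain ⟨v', hv'⟩ := M'.exists_vec_of_mem_weightSpace h0' h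
    rw [hv', augT_symm_vec]
  have hψ : ∀ v, M.vec 0 (augT (M.equiv.symm (M'.vec 0 v))) = M'.vec 0 v := fun v => by
    have h := M'.vec_mem_weightSpace h0' 0 v
    rw [JMod.intVec_zero, add_zero] at h
    obtain ⟨v', hv'⟩ := M.exists_vec_of_mem_weightSpace h0 h
    rw [hv', augT_symm_vec]
  let φ : U ≃ₗ[ℂ] U' :=
    { toFun := fun v => augT (M'.equiv.symm (M.vec 0 v))
      map_add' := fun v w => by rw [map_add, map_add, map_add]
      map_smul' := fun c v => by
        apply M'.vec_injective 0
        rw [RingHom.id_apply, hφ, map_smul (M.vec 0), map_smul (M'.vec 0), hφ]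
      invFun := fun v => augT (M.equiv.symm (M'.vec 0 v))
      left_inv := fun v => by
        apply M.vec_injective 0
        rw [hψ, hφ]
      right_inv := fun v => by
        apply M'.vec_injective 0
        rw [hφ, hψ] }
  refine ⟨φ, fun j s v => ?_⟩
  have hφ' : ∀ s v, M'.vec s (φ v) = M.vec s v := fun s v => by
    have : fexp s • M'.vec 0 (φ v) = fexp s • M.vec 0 v := congrArg _ (hφ v)
    rwa [fexp_smul_vec, fexp_smul_vec, add_zero] at this
  apply M'.vec_injective s
  rw [hφ']
  have h1 := M.lie_vec j s 0 v
  have h2 := M'.lie_vec j s 0 (φ v)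
  rw [hφ', h1] at h2
  simpa using h2

/-- Transport of a model along an intertwiner. -/
def congrFibre (φ : U ≃ₗ[ℂ] U') (hφ : ∀ j s v, φ (D j s v) = D' j s (φ v)) : Model J D' where
  equiv := (TensorProduct.AlgebraTensorModule.congr (LinearEquiv.refl (TorusFun n) (TorusFun n))
    φ.symm).trans M.equiv
  lie_equiv j s m v := by
    have h1 : ∀ m v, ((TensorProduct.AlgebraTensorModule.congr
        (LinearEquiv.refl (TorusFun n) (TorusFun n)) φ.symm).trans M.equiv) (fexp m ⊗ₜ[ℂ] v) =
          M.vec m (φ.symm v) := fun _ _ => rfl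
    rw [h1, h1, h1, lie_vec, ← φ.symm_apply_apply (D j s (φ.symm v)), hφ, φ.apply_symm_apply]

/-- Transport of a model along an isomorphism. -/
def congrModule (φ : J ≃ₗ[TorusFun n] J') (hφ : ∀ (X : W n) (w : J), φ ⁅X, w⁆ = ⁅X, φ w⁆) :
    Model J' D where
  equiv := M.equiv.trans φ
  lie_equiv j s m v := by
    rw [LinearEquiv.trans_apply, ← hφ, M.lie_equiv, map_add]
    congr 1
    exact LinearMap.map_smul_of_tower φ.toLinearMap _ _

include M in
theorem iso (M' : Model J' D) : JMod.Iso J J' := by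
  refine ⟨M.equiv.symm.trans M'.equiv, fun X w => ?_⟩
  set φ := M.equiv.symm.trans M'.equiv with hφ
  have h1 : ∀ m v, φ (M.vec m v) = M'.vec m v := fun m v => by
    rw [hφ, LinearEquiv.trans_apply, vec_apply, LinearEquiv.symm_apply_apply, vec_apply]
  have hsmul : ∀ (c : ℂ) (w : J), φ (c • w) = c • φ w := fun c w =>
    LinearMap.map_smul_of_tower φ.toLinearMap c w
  induction X using dField_induction with
  | h0 => simp
  | hadd X Y hX hY => rw [add_lie, map_add, hX, hY, add_lie]
  | hsmul c X hX => rw [JMod.field_smul_lie, hsmul, hX, JMod.field_smul_lie]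
  | hd j s =>
    obtain ⟨v, rfl⟩ := M.exists_eq_sum_vec w
    simp only [lie_sum, map_sum]
    refine Finset.sum_congr rfl fun m _ => ?_
    rw [lie_vec, map_add, hsmul, h1, h1, h1, lie_vec]

/-- Passage to another representative of the weight modulo `ℤⁿ`. -/
def shift (k : Fin n → ℤ) {E : Fin n → (Fin n → ℤ) → Module.End ℂ U}
    (hE : ∀ j s v, E j s v = D j s v + (k j : ℂ) • v) : Model J E where
  equiv := M.equiv.trans
    { toFun := fun w => fexp k • w
      map_add' := fun w w' => smul_add _ w w'
      map_smul' := fun f w => smul_comm (fexp k) f w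
      invFun := fun w => fexp (-k) • w
      left_inv := JMod.fexp_neg_smul k
      right_inv := JMod.fexp_smul_neg k }
  lie_equiv j s m v := by
    change ⁅dField j s, fexp k • M.vec m v⁆ = (m j : ℂ) • fexp k • M.vec (m + s) v +
      fexp k • M.vec (m + s) (E j s v)
    rw [fexp_smul_vec, lie_vec, fexp_smul_vec, fexp_smul_vec, hE, map_add, map_smul,
      add_assoc k m s, Pi.add_apply, Int.cast_add, add_smul]
    abel

end Model

/-! ### Indecomposable modules are generated by any weight space -/

namespace JMod

variable (J : JMod.{u} n)

/-- The submodule spanned by the weight vectors with weights in a set stable under `ℤⁿ`. -/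
def weightSub (S : Set (Fin n → ℂ)) (hS : ∀ μ ∈ S, ∀ m, μ + intVec m ∈ S) :
    Submodule (TorusFun n) J :=
  { Submodule.span ℂ {w : J | ∃ μ ∈ S, w ∈ J.weightSpace μ} with
    smul_mem' := fun f w hw => by
      change w ∈ Submodule.span ℂ _ at hw
      change f • w ∈ Submodule.span ℂ _
      induction hw using Submodule.span_induction with
      | zero => rw [smul_zero]; exact Submodule.zero_mem _
      | add x y _ _ hx hy => rw [smul_add]; exact Submodule.add_mem _ hx hy
      | smul c x _ hx => rw [smul_fun_comm]; exact Submodule.smul_mem _ c hx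
      | mem x hx =>
        obtain ⟨μ, hμ, hx⟩ := hx
        induction f using fexp_induction with
        | hexp m =>
          exact Submodule.subset_span ⟨_, hS μ hμ m, fexp_smul_mem_weightSpace hx m⟩
        | h0 => rw [zero_smul]; exact Submodule.zero_mem _
        | hadd f g hf hg => rw [add_smul]; exact Submodule.add_mem _ hf hg
        | hsmul c f hf => rw [smul_assoc]; exact Submodule.smul_mem _ c hf }

variable {J} {S : Set (Fin n → ℂ)} (hS : ∀ μ ∈ S, ∀ m, μ + intVec m ∈ S)

theorem mem_weightSub {w : J} : w ∈ J.weightSub S hS ↔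
    w ∈ Submodule.span ℂ {w : J | ∃ μ ∈ S, w ∈ J.weightSpace μ} := Iff.rfl

theorem weightSub_le_iSup {w : J} (hw : w ∈ J.weightSub S hS) : w ∈ ⨆ μ ∈ S, J.weightSpace μ := by
  rw [mem_weightSub] at hw
  refine Submodule.span_le.2 ?_ hw
  rintro x ⟨μ, hμ, hx⟩
  exact Submodule.mem_iSup_of_mem μ (Submodule.mem_iSup_of_mem hμ hx)

theorem isStable_weightSub : J.IsStable (J.weightSub S hS) := by
  intro X w hw
  rw [mem_weightSub] at hw ⊢
  induction hw using Submodule.span_induction with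
  | zero => rw [lie_zero]; exact Submodule.zero_mem _
  | add x y _ _ hx hy => rw [lie_add]; exact Submodule.add_mem _ hx hy
  | smul c x _ hx => rw [lie_smul]; exact Submodule.smul_mem _ c hx
  | mem x hx =>
    obtain ⟨μ, hμ, hx⟩ := hx
    induction X using dField_induction with
    | h0 => rw [zero_lie]; exact Submodule.zero_mem _
    | hadd X Y hX hY => rw [add_lie]; exact Submodule.add_mem _ hX hY
    | hsmul c X hX => rw [field_smul_lie]; exact Submodule.smul_mem _ c hX
    | hd j s =>
      exact Submodule.subset_span ⟨_, hS μ hμ s, lie_dField_mem_weightSpace hx j s⟩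

/-- Disjointness is the independence of weight spaces; the sum is everything by diagonalizability.
-/
theorem isCompl_weightSub (hS' : ∀ μ ∈ Sᶜ, ∀ m, μ + intVec m ∈ Sᶜ) :
    IsCompl (J.weightSub S hS) (J.weightSub Sᶜ hS') := by
  refine ⟨?_, ?_⟩
  · rw [Submodule.disjoint_def]
    intro w hw hw'
    have := J.iSupIndep_weightSpace.disjoint_biSup_biSup (s := S) (t := Sᶜ) disjoint_compl_right
    exact Submodule.disjoint_def.1 this w (weightSub_le_iSup hS hw) (weightSub_le_iSup hS' hw')
  · rw [codisjoint_iff, eq_top_iff]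
    intro w _
    have hw : w ∈ Submodule.span ℂ {w : J | ∃ μ : Fin n → ℂ, ∀ j, ⁅dPartial j, w⁆ = μ j • w} := by
      rw [J.diagonalizable]; trivial
    induction hw using Submodule.span_induction with
    | zero => exact Submodule.zero_mem _
    | add x y _ _ hx hy => exact Submodule.add_mem _ (hx trivial) (hy trivial)
    | smul c x _ hx => exact Submodule.smul_of_tower_mem _ c (hx trivial)
    | mem x hx =>
      obtain ⟨μ, hx⟩ := hx
      by_cases hμ : μ ∈ S
      · exact Submodule.mem_sup_left (Submodule.subset_span ⟨μ, hμ, hx⟩)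
      · exact Submodule.mem_sup_right (Submodule.subset_span ⟨μ, hμ, hx⟩)

variable (J) in
theorem exists_weightSpace_ne_bot [Nontrivial J] : ∃ μ, J.weightSpace μ ≠ ⊥ := by
  by_contra! h
  have := J.iSup_weightSpace
  simp only [h, iSup_bot] at this
  exact bot_ne_top this

/-- The coset `λ + ℤⁿ` and its complement split `J` into two stable submodules, and the first is
nonzero. -/
theorem Indecomposable.weightSpace_eq_bot (hJ : J.Indecomposable) {lam μ : Fin n → ℂ}
    (hlam : J.weightSpace lam ≠ ⊥) (hμ : ∀ m, μ ≠ lam + intVec m) : J.weightSpace μ = ⊥ := by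
  have hS : ∀ μ ∈ Set.range fun m => lam + intVec m, ∀ m,
      μ + intVec m ∈ Set.range fun m => lam + intVec m := by
    rintro _ ⟨k, rfl⟩ m
    exact ⟨k + m, by simp only [intVec_add]; abel⟩
  have hS' : ∀ μ ∈ (Set.range fun m => lam + intVec m)ᶜ, ∀ m,
      μ + intVec m ∈ (Set.range fun m => lam + intVec m)ᶜ := by
    rintro μ hμ m ⟨k, hk⟩
    refine hμ ⟨k - m, ?_⟩
    simp only at hk ⊢
    rw [sub_eq_add_neg, intVec_add, intVec_neg, ← add_assoc, hk]
    abel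
  rcases hJ.2 _ _ (isStable_weightSub hS) (isStable_weightSub hS') (isCompl_weightSub hS hS')
    with h | h
  · refine absurd ?_ hlam
    rw [eq_bot_iff]
    intro w hw
    have : w ∈ J.weightSub _ hS :=
      Submodule.subset_span ⟨lam, ⟨0, by simp only [intVec_zero, add_zero]⟩, hw⟩
    rw [h] at this
    exact (Submodule.mem_bot (TorusFun n)).1 this
  · rw [eq_bot_iff]
    intro w hw
    have : w ∈ J.weightSub _ hS' :=
      Submodule.subset_span ⟨μ, fun ⟨m, hm⟩ => hμ m hm.symm, hw⟩
    rw [h] at this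
    exact (Submodule.mem_bot (TorusFun n)).1 this

variable (J) in
/-- The canonical map `ℱ ⊗ J_μ → J`. -/
def weightMap (lam : Fin n → ℂ) : (TorusFun n ⊗[ℂ] J.weightSpace lam) →ₗ[TorusFun n] J :=
  (J.weightSpace lam).subtype.liftBaseChange (TorusFun n)

theorem weightMap_tmul (lam : Fin n → ℂ) (f : TorusFun n) (v : J.weightSpace lam) :
    J.weightMap lam (f ⊗ₜ[ℂ] v) = f • (v : J) := by
  simp [weightMap]

/-- The summands `e^{2πi m·x} v_m` have distinct weights `λ + m`, so they vanish separately. -/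
theorem weightMap_injective (lam : Fin n → ℂ) : Function.Injective (J.weightMap lam) := by
  rw [injective_iff_map_eq_zero]
  intro x hx
  obtain ⟨v, rfl⟩ := exists_finsupp_tensor x
  refine Finset.sum_eq_zero fun m hm => ?_
  rw [Finsupp.sum, map_sum] at hx
  simp only [weightMap_tmul] at hx
  have := mem_of_sum_mem J.dOp ⊥ (by simp) (fun m => lam + intVec m)
    (fun a b hab => intVec_injective (add_left_cancel hab)) v.support
    (fun m => fexp m • (v m : J)) (fun m j => fexp_smul_mem_weightSpace (v m).2 m j)
    (by rw [hx]; exact Submodule.zero_mem _) hm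
  have h0 : (v m : J) = 0 := fexp_smul_injective m (by simpa using this)
  change fexp m ⊗ₜ[ℂ] v m = 0
  rw [Subtype.ext (a1 := v m) (a2 := 0) h0, TensorProduct.tmul_zero]

theorem Indecomposable.weightMap_surjective (hJ : J.Indecomposable) {lam : Fin n → ℂ}
    (hlam : J.weightSpace lam ≠ ⊥) : Function.Surjective (J.weightMap lam) := by
  rw [← LinearMap.range_eq_top, eq_top_iff]
  intro w _
  have hw : w ∈ Submodule.span ℂ {w : J | ∃ μ : Fin n → ℂ, ∀ j, ⁅dPartial j, w⁆ = μ j • w} := by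
    rw [J.diagonalizable]; trivial
  induction hw using Submodule.span_induction with
  | zero => exact Submodule.zero_mem _
  | add x y _ _ hx hy => exact Submodule.add_mem _ (hx trivial) (hy trivial)
  | smul c x _ hx => exact Submodule.smul_of_tower_mem _ c (hx trivial)
  | mem x hx =>
    obtain ⟨μ, hx⟩ := hx
    by_cases hμ : ∀ m, μ ≠ lam + intVec m
    · have h1 : x ∈ J.weightSpace μ := hx
      rw [hJ.weightSpace_eq_bot hlam hμ, Submodule.mem_bot] at h1
      rw [h1]
      exact Submodule.zero_mem _
    · push Not at hμ
      obtain ⟨m, rfl⟩ := hμ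
      have h1 := fexp_smul_mem_weightSpace (show x ∈ J.weightSpace (lam + intVec m) from hx) (-m)
      rw [intVec_neg, add_neg_cancel_right] at h1
      exact ⟨fexp m ⊗ₜ[ℂ] ⟨_, h1⟩, by rw [weightMap_tmul]; exact fexp_smul_neg m x⟩

/-- The canonical isomorphism `ℱ ⊗ J_μ ≃ J` for indecomposable `J`. -/
def Indecomposable.weightEquiv (hJ : J.Indecomposable) {lam : Fin n → ℂ}
    (hlam : J.weightSpace lam ≠ ⊥) : (TorusFun n ⊗[ℂ] J.weightSpace lam) ≃ₗ[TorusFun n] J :=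
  LinearEquiv.ofBijective (J.weightMap lam)
    ⟨weightMap_injective lam, hJ.weightMap_surjective hlam⟩

/-- The rank of `ℱ ⊗ U` over `ℱ` is the dimension of `U`, and it is finite because `J` is finite
over `ℱ`. -/
theorem Indecomposable.finiteDimensional (hJ : J.Indecomposable) {lam : Fin n → ℂ}
    (hlam : J.weightSpace lam ≠ ⊥) : FiniteDimensional ℂ (J.weightSpace lam) := by
  have h1 : Module.Finite (TorusFun n) J := J.finite
  have h2 : Module.Finite (TorusFun n) (TorusFun n ⊗[ℂ] J.weightSpace lam) :=
    Module.Finite.equiv (hJ.weightEquiv hlam).symm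
  have h3 := Module.rank_lt_aleph0 (TorusFun n) (TorusFun n ⊗[ℂ] J.weightSpace lam)
  rw [Module.rank_baseChange, Cardinal.lift_lt_aleph0] at h3
  exact Module.rank_lt_aleph0_iff.1 h3

/-! ### The structure operators of a weight space -/

variable (J) in
/-- The operators `v ↦ e^{-2πi s·x} d_j(s) v` on a weight space. -/
def structOps (lam : Fin n → ℂ) (j : Fin n) (s : Fin n → ℤ) : Module.End ℂ (J.weightSpace lam) where
  toFun v := ⟨fexp (-s) • ⁅dField j s, (v : J)⁆, by
    have := fexp_smul_mem_weightSpace (lie_dField_mem_weightSpace v.2 j s) (-s)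
    rwa [intVec_neg, add_neg_cancel_right] at this⟩
  map_add' v w := Subtype.ext (by
    change fexp (-s) • ⁅dField j s, (v : J) + w⁆ = fexp (-s) • ⁅dField j s, (v : J)⁆ +
      fexp (-s) • ⁅dField j s, (w : J)⁆
    rw [lie_add, smul_add])
  map_smul' c v := Subtype.ext (by
    change fexp (-s) • ⁅dField j s, c • (v : J)⁆ = c • fexp (-s) • ⁅dField j s, (v : J)⁆
    rw [lie_smul, smul_fun_comm])

variable (J) in
theorem isStructureOps_structOps (lam : Fin n → ℂ) : IsStructureOps J lam (J.structOps lam) :=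
  fun j s v => (fexp_smul_neg s ⁅dField j s, (v : J)⁆).symm

end JMod

namespace IsStructureOps

variable {J : JMod.{u} n} {lam : Fin n → ℂ}
  {D D' : Fin n → (Fin n → ℤ) → Module.End ℂ (J.weightSpace lam)}

theorem unique (h : IsStructureOps J lam D) (h' : IsStructureOps J lam D') : D = D' := by
  funext j s
  refine LinearMap.ext fun v => Subtype.ext (JMod.fexp_smul_injective s ?_)
  exact (h j s v).symm.trans (h' j s v)

theorem apply_zero (h : IsStructureOps J lam D) (j : Fin n) : D j 0 = lam j • 1 := by
  refine LinearMap.ext fun v => Subtype.ext (JMod.fexp_smul_injective 0 ?_)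
  have h1 := h j 0 v
  rw [dField_zero, v.2 j] at h1
  change fexp 0 • ((D j 0 v : J.weightSpace lam) : J) = fexp 0 • lam j • (v : J)
  rw [← h1, fexp_zero, one_smul]

theorem lie_smul_coe (h : IsStructureOps J lam D) (j : Fin n) (s m : Fin n → ℤ)
    (v : J.weightSpace lam) : ⁅dField j s, fexp m • (v : J)⁆ =
      fexp (m + s) • ((m j : ℂ) • (v : J) + (D j s v : J.weightSpace lam)) := by
  rw [JMod.lie_dField_fexp_smul, h, JMod.fexp_smul_fexp_smul, smul_add, JMod.smul_fun_comm]

/-- Let `[d_i(s), d_j(m)]` act on the weight space and cancel the common invertible factor `e^{2πi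
(s+m)·x}`. -/
theorem isJetFamily (h : IsStructureOps J lam D) : IsJetFamily D := by
  intro i j s m
  refine LinearMap.ext fun v => Subtype.ext (JMod.fexp_smul_injective (s + m) ?_)
  have h1 := leibniz_lie (dField i s) (dField j m) (v : J)
  rw [lie_dField, sub_lie, JMod.field_smul_lie, JMod.field_smul_lie, h, h, h, h,
    h.lie_smul_coe, h.lie_smul_coe, add_comm m s] at h1
  simp only [← JMod.smul_fun_comm, ← smul_sub, ← smul_add] at h1
  have h2 := JMod.fexp_smul_injective (s + m) h1
  refine congrArg (fexp (s + m) • ·) ?_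
  simp only [LinearMap.sub_apply, Module.End.mul_apply, LinearMap.smul_apply, Submodule.coe_sub,
    Submodule.coe_smul]
  linear_combination (norm := module) h2

/-- The canonical model of an indecomposable module. -/
def model (h : IsStructureOps J lam D) (hJ : J.Indecomposable) (hlam : J.weightSpace lam ≠ ⊥) :
    Model J D where
  equiv := hJ.weightEquiv hlam
  lie_equiv j s m v := by
    change ⁅dField j s, J.weightMap lam (fexp m ⊗ₜ[ℂ] v)⁆ =
      (m j : ℂ) • J.weightMap lam (fexp (m + s) ⊗ₜ[ℂ] v) +
        J.weightMap lam (fexp (m + s) ⊗ₜ[ℂ] D j s v)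
    simp only [JMod.weightMap_tmul]
    rw [h.lie_smul_coe, smul_add, JMod.smul_fun_comm]

end IsStructureOps

/-! ### Jet modules -/

/-- Operators preserving `Q` form a linear subspace, so it contains all `D_j(s)` exactly when it
contains all their Taylor coefficients. -/
theorem isOpStable_iff {U : Type u} [AddCommGroup U] [Module ℂ U] [FiniteDimensional ℂ U]
    (lam : Fin n → ℂ) (ρ : WPlus n →ₗ⁅ℂ⁆ Module.End ℂ U) (Q : Submodule ℂ U) :
    Model.IsOpStable (jetOps lam ρ) Q ↔ ∀ X, ∀ v ∈ Q, ρ X v ∈ Q := by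
  let E : Submodule ℂ (Module.End ℂ U) :=
    { carrier := {A | ∀ v ∈ Q, A v ∈ Q}
      add_mem' := fun ha hb v hv => Q.add_mem (ha v hv) (hb v hv)
      zero_mem' := fun v _ => Q.zero_mem
      smul_mem' := fun c A hA v hv => Q.smul_mem c (hA v hv) }
  constructor
  · intro h X
    change ρ X ∈ E
    induction X using zPlus_induction with
    | hz α j =>
      have := powFact_sum_mem (P := E) (T := taylorOps lam ρ j) (fun s => h j s) α.1
      rwa [coe_taylorOps, opFamily_pos] at this
    | h0 => rw [map_zero]; exact E.zero_mem
    | hadd X Y hX hY => rw [map_add]; exact E.add_mem hX hY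
    | hsmul c X hX => rw [map_smul]; exact E.smul_mem c hX
  · intro h j s
    change jetOps lam ρ j s ∈ E
    refine E.sum_mem fun α _ => E.smul_mem _ ?_
    rw [coe_taylorOps]
    by_cases hα : α = 0
    · rw [hα, opFamily_zero]
      exact E.smul_mem _ fun v hv => hv
    · rw [opFamily_pos lam ρ j ⟨α, hα⟩]
      exact h _

namespace FDMod

/-- The representation of `L` on a module. -/
abbrev rep {L : Type} [LieRing L] [LieAlgebra ℂ L] (U : FDMod.{u} L) : L →ₗ⁅ℂ⁆ Module.End ℂ U :=
  LieModule.toEnd ℂ L U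

/-- The module of a representation. -/
def ofRep {L : Type} [LieRing L] [LieAlgebra ℂ L] {U : Type u} [AddCommGroup U] [Module ℂ U]
    [FiniteDimensional ℂ U] (ρ : L →ₗ⁅ℂ⁆ Module.End ℂ U) : FDMod.{u} L :=
  letI : LieRingModule L U := LieRingModule.compLieHom U ρ
  letI : LieModule ℂ L U := LieModule.compLieHom U ρ
  { carrier := U
    finiteDimensional := inferInstance }

theorem irreducible_iff {L : Type} [LieRing L] [LieAlgebra ℂ L] (U : FDMod.{u} L) :
    U.Irreducible ↔ Nontrivial U ∧
      ∀ Q : Submodule ℂ U, (∀ x, ∀ v ∈ Q, U.rep x v ∈ Q) → Q = ⊥ ∨ Q = ⊤ := by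
  constructor
  · intro h
    have h' : IsSimpleOrder (LieSubmodule ℂ L U) := h
    refine ⟨(LieSubmodule.nontrivial_iff ℂ L U).1 inferInstance, fun Q hQ => ?_⟩
    rcases eq_bot_or_eq_top (⟨Q, fun {x v} hv => hQ x v hv⟩ : LieSubmodule ℂ L U) with h1 | h1
    · exact Or.inl (congrArg LieSubmodule.toSubmodule h1)
    · exact Or.inr (congrArg LieSubmodule.toSubmodule h1)
  · rintro ⟨h1, h2⟩
    refine LieModule.IsIrreducible.mk fun N hN => ?_
    rcases h2 N.toSubmodule (fun x v hv => N.lie_mem hv) with h | h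
    · exact absurd (LieSubmodule.toSubmodule_injective h) hN
    · exact LieSubmodule.toSubmodule_injective h

theorem indecomposable_iff {L : Type} [LieRing L] [LieAlgebra ℂ L] (U : FDMod.{u} L) :
    U.Indecomposable ↔ Nontrivial U ∧
      ∀ Q Q' : Submodule ℂ U, (∀ x, ∀ v ∈ Q, U.rep x v ∈ Q) → (∀ x, ∀ v ∈ Q', U.rep x v ∈ Q') →
        IsCompl Q Q' → Q = ⊥ ∨ Q' = ⊥ := by
  refine and_congr_right fun _ => ⟨fun h Q Q' hQ hQ' hc => ?_, fun h P Q hc => ?_⟩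
  · have := h ⟨Q, fun {x v} hv => hQ x v hv⟩ ⟨Q', fun {x v} hv => hQ' x v hv⟩
      (LieSubmodule.isCompl_toSubmodule.1 hc)
    exact this.imp (congrArg LieSubmodule.toSubmodule) (congrArg LieSubmodule.toSubmodule)
  · have := h P.toSubmodule Q.toSubmodule (fun x v hv => P.lie_mem hv) (fun x v hv => Q.lie_mem hv)
      (LieSubmodule.isCompl_toSubmodule.2 hc)
    exact this.imp (fun h => LieSubmodule.toSubmodule_injective h)
      (fun h => LieSubmodule.toSubmodule_injective h)

end FDMod

theorem isJetTensor_iff {lam : Fin n → ℂ} {U : FDMod.{u} (WPlus n)} {J : JMod.{u} n} :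
    IsJetTensor lam U J ↔ Nonempty (Model J (jetOps lam U.rep)) := by
  have key : ∀ (Φ : (TorusFun n ⊗[ℂ] U) ≃ₗ[TorusFun n] J) (j : Fin n) (s m : Fin n → ℤ) (v : U),
      Φ (((m j : ℂ) + lam j) • (fexp (m + s) ⊗ₜ[ℂ] v)
          + fexp (m + s) ⊗ₜ[ℂ] (∑ᶠ β : PosIndex n, powFact s β.1 • ⁅zPlus β j, v⁆)) =
        (m j : ℂ) • Φ (fexp (m + s) ⊗ₜ[ℂ] v) + Φ (fexp (m + s) ⊗ₜ[ℂ] jetOps lam U.rep j s v) := by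
    intro Φ j s m v
    rw [jetOps_apply, TensorProduct.tmul_add, map_add, map_add, add_smul, map_add,
      TensorProduct.tmul_smul, add_assoc]
    congr 1
    exact LinearMap.map_smul_of_tower Φ.toLinearMap _ _
  constructor
  · rintro ⟨Φ, hΦ⟩
    exact ⟨⟨Φ, fun j s m v => by rw [hΦ, key]⟩⟩
  · rintro ⟨M⟩
    exact ⟨M.equiv, fun j s m v => by rw [M.lie_equiv, key]⟩

namespace IsJetTensor

variable {lam lam' : Fin n → ℂ} {U U' : FDMod.{u} (WPlus n)} {J J' : JMod.{u} n}

theorem indecomposable_iff (h : IsJetTensor lam U J) : J.Indecomposable ↔ U.Indecomposable := by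
  obtain ⟨M⟩ := isJetTensor_iff.1 h
  rw [M.indecomposable_iff (jetOps_zero lam U.rep), U.indecomposable_iff]
  simp only [isOpStable_iff]

theorem irreducible_iff (h : IsJetTensor lam U J) : J.Irreducible ↔ U.Irreducible := by
  obtain ⟨M⟩ := isJetTensor_iff.1 h
  rw [M.irreducible_iff (jetOps_zero lam U.rep), U.irreducible_iff]
  simp only [isOpStable_iff]

theorem of_iso (h : IsJetTensor lam U J) (hJ : JMod.Iso J J') : IsJetTensor lam U J' := by
  obtain ⟨M⟩ := isJetTensor_iff.1 h
  obtain ⟨φ, hφ⟩ := hJ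
  exact isJetTensor_iff.2 ⟨M.congrModule φ hφ⟩

theorem of_equiv (h : IsJetTensor lam U J) (e : U ≃ₗ⁅ℂ,WPlus n⁆ U') : IsJetTensor lam U' J := by
  obtain ⟨M⟩ := isJetTensor_iff.1 h
  refine isJetTensor_iff.2 ⟨M.congrFibre e.toLinearEquiv fun j s v => ?_⟩
  have hfin : (Function.support fun β : PosIndex n => powFact s β.1 • U.rep (zPlus β j) v).Finite :=
    (finite_setOf_ne_zero U.rep j).subset fun β hβ h0 => hβ (by simp [h0])
  rw [jetOps_apply, jetOps_apply, map_add, map_smul]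
  congr 1
  rw [← LinearEquiv.coe_toLinearMap, ← LinearMap.toAddMonoidHom_coe, AddMonoidHom.map_finsum _ hfin]
  refine finsum_congr fun β => ?_
  rw [LinearMap.toAddMonoidHom_coe, map_smul]
  congr 1
  exact e.map_lie (zPlus β j) v

theorem shift (h : IsJetTensor lam U J) (hl : lam' - lam ∈ intLattice n) : IsJetTensor lam' U J := by
  obtain ⟨M⟩ := isJetTensor_iff.1 h
  obtain ⟨k, hk⟩ := JMod.mem_intLattice.1 hl
  refine isJetTensor_iff.2 ⟨M.shift k fun j s v => ?_⟩
  have : lam' j = lam j + (k j : ℂ) := by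
    have := congrFun hk j
    rw [Pi.sub_apply] at this
    exact (sub_eq_iff_eq_add'.1 this.symm)
  rw [jetOps_apply, jetOps_apply, this, add_smul]
  abel

theorem iso (h : IsJetTensor lam U J) (h' : IsJetTensor lam U J') : JMod.Iso J J' := by
  obtain ⟨M⟩ := isJetTensor_iff.1 h
  obtain ⟨M'⟩ := isJetTensor_iff.1 h'
  exact M.iso M'

theorem sub_mem [Nontrivial U'] (h : IsJetTensor lam U J) (h' : IsJetTensor lam' U' J) :
    lam' - lam ∈ intLattice n := by
  obtain ⟨M⟩ := isJetTensor_iff.1 h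
  obtain ⟨M'⟩ := isJetTensor_iff.1 h'
  refine M.sub_mem_intLattice (jetOps_zero lam U.rep) fun hbot => ?_
  obtain ⟨v, hv⟩ := exists_ne (0 : U')
  have h1 := M'.vec_mem_weightSpace (jetOps_zero lam' U'.rep) 0 v
  rw [JMod.intVec_zero, add_zero, hbot, Submodule.mem_bot] at h1
  exact hv (M'.vec_injective 0 (h1.trans (map_zero _).symm))

/-- The intertwiner of the `D_j(s)` also intertwines their Taylor coefficients, by uniqueness of
expansions. -/
theorem nonempty_equiv (h : IsJetTensor lam U J) (h' : IsJetTensor lam U' J) :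
    Nonempty (U ≃ₗ⁅ℂ,WPlus n⁆ U') := by
  obtain ⟨M⟩ := isJetTensor_iff.1 h
  obtain ⟨M'⟩ := isJetTensor_iff.1 h'
  obtain ⟨φ, hφ⟩ := M.exists_intertwiner (jetOps_zero lam U.rep) M' (jetOps_zero lam U'.rep)
  let A : Module.End ℂ U →ₗ[ℂ] (U →ₗ[ℂ] U') := LinearMap.compRight ℂ φ.toLinearMap
  let B : Module.End ℂ U' →ₗ[ℂ] (U →ₗ[ℂ] U') := LinearMap.lcomp ℂ U' φ.toLinearMap
  -- Composition with `φ` on either side puts both families in `Hom(U, U')`, where the expansions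
  -- can be compared.
  have key : ∀ j, (taylorOps lam U.rep j).mapRange A (map_zero A) =
      (taylorOps lam U'.rep j).mapRange B (map_zero B) := fun j => by
    refine eq_of_powFact_sum fun s => ?_
    rw [Finsupp.sum_mapRange_index (fun _ => smul_zero _),
      Finsupp.sum_mapRange_index (fun _ => smul_zero _)]
    have h1 : A (jetOps lam U.rep j s) = B (jetOps lam U'.rep j s) :=
      LinearMap.ext fun v => hφ j s v
    simpa only [jetOps, Finsupp.sum, map_sum, map_smul] using h1
  have hρ : ∀ X v, φ (U.rep X v) = U'.rep X (φ v) := by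
    intro X v
    induction X using zPlus_induction with
    | hz α j =>
      have h1 := DFunLike.congr_fun (key j) α.1
      rw [Finsupp.mapRange_apply, Finsupp.mapRange_apply, coe_taylorOps, coe_taylorOps,
        opFamily_pos, opFamily_pos] at h1
      exact LinearMap.congr_fun h1 v
    | h0 => rw [map_zero, map_zero, LinearMap.zero_apply, LinearMap.zero_apply, map_zero]
    | hadd X Y hX hY =>
      rw [map_add, map_add, LinearMap.add_apply, LinearMap.add_apply, map_add, hX, hY]
    | hsmul c X hX =>
      rw [map_smul, map_smul, LinearMap.smul_apply, LinearMap.smul_apply, map_smul, hX]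
  exact ⟨{ φ with map_lie' := fun {X v} => hρ X v }⟩

theorem exists_of_rep (lam : Fin n → ℂ) (U : FDMod.{u} (WPlus n)) :
    ∃ J : JMod.{u} n, IsJetTensor lam U J :=
  ⟨_, isJetTensor_iff.2 ⟨ofOpsModel (jetOps lam U.rep) (isJetFamily_jetOps lam U.rep)
    (jetOps_zero lam U.rep)⟩⟩

end IsJetTensor

/-! ### The representation of `W_n^+` on a weight space -/

section WeightSpace

variable {J : JMod.{u} n} {lam : Fin n → ℂ}
  {D : Fin n → (Fin n → ℤ) → Module.End ℂ (J.weightSpace lam)}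
  {T : Fin n → ((Fin n →₀ ℕ) →₀ Module.End ℂ (J.weightSpace lam))}

theorem IsStructureOps.taylor_zero (h : IsStructureOps J lam D) (hT : IsTaylorExpansion D T)
    (j : Fin n) : T j 0 = lam j • 1 := (hT.apply_zero j).symm.trans (h.apply_zero j)

theorem IsStructureOps.isWPlusFamily (h : IsStructureOps J lam D) (hT : IsTaylorExpansion D T) :
    IsWPlusFamily fun j α => T j α :=
  (isJetFamily_iff hT (h.taylor_zero hT)).1 h.isJetFamily

theorem IsStructureOps.existsUnique_rep (h : IsStructureOps J lam D) (hT : IsTaylorExpansion D T) :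
    ∃! ρ : WPlus n →ₗ⁅ℂ⁆ Module.End ℂ (J.weightSpace lam),
      ∀ (α : PosIndex n) (j : Fin n), ρ (zPlus α j) = T j α.1 :=
  ⟨wplusRep T (h.isWPlusFamily hT), wplusRep_zPlus T _, fun ρ' hρ' =>
    wplus_hom_ext fun α j => by rw [hρ', wplusRep_zPlus]⟩

theorem JMod.Indecomposable.exists_isJetTensor (hJ : J.Indecomposable)
    (hlam : J.weightSpace lam ≠ ⊥) : ∃ U : FDMod.{u} (WPlus n), IsJetTensor lam U J := by
  have hfin := hJ.finiteDimensional hlam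
  have h := J.isStructureOps_structOps lam
  obtain ⟨T, hT⟩ := h.isJetFamily.exists_taylorExpansion
  let ρ := wplusRep T (h.isWPlusFamily hT)
  refine ⟨FDMod.ofRep ρ, isJetTensor_iff.2 ⟨?_⟩⟩
  have h1 : jetOps lam ρ = J.structOps lam := by
    funext j s
    rw [hT j s, jetOps]
    congr 1
    ext1 α
    rw [coe_taylorOps]
    by_cases hα : α = 0
    · rw [hα, opFamily_zero, h.taylor_zero hT]
    · rw [opFamily_pos lam ρ j ⟨α, hα⟩]
      exact wplusRep_zPlus T _ ⟨α, hα⟩ j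
  have M : Model J (jetOps lam ρ) := by
    rw [h1]
    exact h.model hJ hlam
  exact M

end WeightSpace

/-! ### Bijections from relations -/

/-- `h3` makes the correspondence well defined and injective on classes, `h2` makes it surjective,
and `h4` makes `R` constant on classes of `Y`. -/
theorem exists_quotient_equiv {X Y : Type*} (sX : Setoid X) (sY : Setoid Y)
    (R : (Fin n → ℂ) → X → Y → Prop) (h1 : ∀ l x, ∃ y, R l x y) (h2 : ∀ y, ∃ l x, R l x y)
    (h3 : ∀ l x y l' x' y', R l x y → R l' x' y' → (sY.r y y' ↔ l' - l ∈ intLattice n ∧ sX.r x x'))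
    (h4 : ∀ l x y y', R l x y → sY.r y y' → R l x y') :
    ∃ e : WeightCoset n × Quotient sX ≃ Quotient sY, ∀ l x y,
      e (QuotientAddGroup.mk l, Quotient.mk sX x) = Quotient.mk sY y ↔ R l x y := by
  have hco : ∀ l l' : Fin n → ℂ, (QuotientAddGroup.mk l : WeightCoset n) = QuotientAddGroup.mk l' ↔
      l' - l ∈ intLattice n := fun l l' => by
    rw [QuotientAddGroup.eq, sub_eq_neg_add]
  choose F hF using h1
  let f : WeightCoset n → Quotient sX → Quotient sY := fun a b =>
    Quotient.liftOn₂' a b (fun l x => Quotient.mk sY (F l x)) (by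
      intro l x l' x' hl hx
      have hl' : (QuotientAddGroup.mk l : WeightCoset n) = QuotientAddGroup.mk l' :=
        Quotient.sound' hl
      exact Quotient.sound ((h3 _ _ _ _ _ _ (hF l x) (hF l' x')).2 ⟨(hco l l').1 hl', hx⟩))
  have hf : ∀ l x y, f (QuotientAddGroup.mk l) (Quotient.mk sX x) = Quotient.mk sY y ↔ R l x y := by
    intro l x y
    have h5 : f (QuotientAddGroup.mk l) (Quotient.mk sX x) = Quotient.mk sY (F l x) := rfl
    rw [h5]
    constructor
    · intro h
      exact h4 _ _ _ _ (hF l x) (Quotient.exact h)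
    · intro h
      refine Quotient.sound ((h3 _ _ _ _ _ _ (hF l x) h).2 ⟨?_, sX.refl x⟩)
      rw [sub_self]
      exact zero_mem _
  refine ⟨Equiv.ofBijective (fun p => f p.1 p.2) ⟨?_, ?_⟩, hf⟩
  · rintro ⟨a, b⟩ ⟨a', b'⟩ h
    induction a using QuotientAddGroup.induction_on with | _ l => ?_
    induction a' using QuotientAddGroup.induction_on with | _ l' => ?_
    induction b using Quotient.inductionOn with | _ x => ?_
    induction b' using Quotient.inductionOn with | _ x' => ?_
    have h5 := (h3 _ _ _ _ _ _ (hF l x) (hF l' x')).1 (Quotient.exact h)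
    rw [(hco l l').2 h5.1, Quotient.sound (s := sX) h5.2]
  · intro c
    induction c using Quotient.inductionOn with | _ y => ?_
    obtain ⟨l, x, h⟩ := h2 y
    exact ⟨(QuotientAddGroup.mk l, Quotient.mk sX x), (hf l x y).2 h⟩

/-! ### Irreducible representations of `W_n^+` and of `gl_n` -/

section Irreducible

/-- The linear part of `z^α ∂_j`: the elementary matrix `E^p_j` if `α = ε_p`, and zero otherwise. -/
def linPart (j : Fin n) (α : Fin n →₀ ℕ) : Gl n :=
  open Classical in Matrix.of fun p q => if α = Finsupp.single p 1 ∧ q = j then 1 else 0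

theorem single_one_injective : Function.Injective fun p : Fin n => Finsupp.single p (1 : ℕ) :=
  Finsupp.single_left_injective one_ne_zero

theorem linPart_single (p j : Fin n) :
    linPart j (Finsupp.single p 1) = Matrix.single p j 1 := by
  classical
  ext a b
  rw [linPart, Matrix.of_apply, Matrix.single_apply]
  exact if_congr (and_congr single_one_injective.eq_iff eq_comm) rfl rfl

theorem linPart_eq_zero {j : Fin n} {α : Fin n →₀ ℕ} (h : ∀ p, α ≠ Finsupp.single p 1) :
    linPart j α = 0 := by
  ext a b
  rw [linPart, Matrix.of_apply, if_neg fun h' => h a h'.1, Matrix.zero_apply]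

/-- Elementary matrices multiply by `E^p_i E^q_j = δ_{iq} E^p_j`, and in degree at least two both
sides vanish. Antisymmetrizing shows that taking linear parts respects the brackets of `W_n^+`. -/
theorem linPart_mul (i j : Fin n) {α : Fin n →₀ ℕ} (hα : α ≠ 0) (β : Fin n →₀ ℕ) :
    linPart i α * linPart j β = (β i : ℂ) • linPart j (α + (β - Finsupp.single i 1)) := by
  classical
  by_cases hβ : β i = 0
  · rw [hβ, Nat.cast_zero, zero_smul]
    ext p q
    rw [Matrix.mul_apply, Matrix.zero_apply]
    refine Finset.sum_eq_zero fun r _ => ?_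
    simp only [linPart, Matrix.of_apply]
    by_cases hr : r = i
    · rw [if_neg (c := β = _ ∧ _), mul_zero]
      rintro ⟨h, -⟩
      rw [h, hr, Finsupp.single_eq_same] at hβ
      exact one_ne_zero hβ
    · rw [if_neg fun h => hr h.2, zero_mul]
  · have hle : Finsupp.single i 1 ≤ β := by rw [Finsupp.single_le_iff]; omega
    obtain ⟨γ, rfl⟩ := exists_add_of_le hle
    rw [add_tsub_cancel_left]
    by_cases hγ : γ = 0
    · subst hγ
      rw [add_zero, add_zero, Finsupp.single_eq_same, Nat.cast_one, one_smul]
      ext p q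
      rw [Matrix.mul_apply, Finset.sum_eq_single i]
      · simp only [linPart, Matrix.of_apply]
        by_cases h1 : α = Finsupp.single p 1 <;> by_cases h2 : q = j <;> simp [h1, h2]
      · intro r _ hr
        simp [linPart, hr]
      · simp
    · rw [linPart_eq_zero (j := j) (α := α + γ), smul_zero]
      · rw [linPart_eq_zero (j := j) (α := Finsupp.single i 1 + γ), mul_zero]
        intro p hp
        have := congrArg Finsupp.degree hp
        rw [map_add, Finsupp.degree_single, Finsupp.degree_single] at this
        exact hγ ((Finsupp.degree_eq_zero_iff γ).1 (by omega))
      · intro p hp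
        have := congrArg Finsupp.degree hp
        rw [map_add, Finsupp.degree_single] at this
        have h1 : Finsupp.degree α ≠ 0 := fun h => hα ((Finsupp.degree_eq_zero_iff α).1 h)
        have h2 : Finsupp.degree γ ≠ 0 := fun h => hγ ((Finsupp.degree_eq_zero_iff γ).1 h)
        omega

theorem eq_sum_linPart (x : Gl n) :
    x = ∑ p, ∑ j, x p j • linPart j (Finsupp.single p 1) := by
  conv_lhs => rw [Matrix.matrix_eq_sum_single x]
  simp only [linPart_single, Matrix.smul_single, smul_eq_mul, mul_one]

/-! ### Inflation of `gl_n`-modules to `W_n^+` -/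

section Inflation

variable (V : FDMod.{u} (Gl n))

/-- The family of operators `ρ(E^p_j)`, indexed by the multi-indices `ε_p`. -/
def glFamily (j : Fin n) : (Fin n →₀ ℕ) →₀ Module.End ℂ V :=
  Finsupp.ofSupportFinite (fun α => V.rep (linPart j α)) (by
    refine (Set.finite_range fun p : Fin n => Finsupp.single p (1 : ℕ)).subset fun α hα => ?_
    by_contra h
    refine hα ?_
    change V.rep (linPart j α) = 0
    rw [linPart_eq_zero fun p hp => h ⟨p, hp.symm⟩, map_zero])

theorem glFamily_apply (j : Fin n) (α : Fin n →₀ ℕ) : glFamily V j α = V.rep (linPart j α) := rfl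

theorem isWPlusFamily_glFamily : IsWPlusFamily fun j α => glFamily V j α := by
  intro i j α β hα hβ
  simp only [glFamily_apply]
  rw [← LieRing.of_associative_ring_bracket, ← LieHom.map_lie, LieRing.of_associative_ring_bracket,
    linPart_mul i j hα, linPart_mul j i hβ, map_sub, map_smul, map_smul]

/-- The inflation of a `gl_n`-module to `W_n^+`, whose fields vanishing to second order act by
zero. -/
def inflate : FDMod.{u} (WPlus n) :=
  FDMod.ofRep (wplusRep (glFamily V) (isWPlusFamily_glFamily V))

theorem rep_inflate_zPlus (α : PosIndex n) (j : Fin n) (v : V) :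
    (inflate V).rep (zPlus α j) v = V.rep (linPart j α.1) v :=
  LinearMap.congr_fun (wplusRep_zPlus (glFamily V) (isWPlusFamily_glFamily V) α j) v

/-- The linear parts of the `z^α ∂_j` span `gl_n`, so inflation keeps the same stable subspaces. -/
theorem stable_inflate_iff (Q : Submodule ℂ V) :
    (∀ X, ∀ v ∈ Q, (inflate V).rep X v ∈ Q) ↔ ∀ x, ∀ v ∈ Q, V.rep x v ∈ Q := by
  constructor
  · intro h x v hv
    rw [eq_sum_linPart x, map_sum, LinearMap.sum_apply]
    refine Q.sum_mem fun p _ => ?_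
    rw [map_sum, LinearMap.sum_apply]
    refine Q.sum_mem fun j _ => ?_
    rw [map_smul, LinearMap.smul_apply]
    refine Q.smul_mem _ ?_
    have := h (zPlus ⟨Finsupp.single p 1, by simp⟩ j) v hv
    rwa [rep_inflate_zPlus] at this
  · intro h X v hv
    induction X using zPlus_induction with
    | hz α j => rw [rep_inflate_zPlus]; exact h _ v hv
    | h0 => rw [map_zero]; exact Q.zero_mem
    | hadd X Y hX hY => rw [map_add]; exact Q.add_mem hX hY
    | hsmul c X hX => rw [map_smul]; exact Q.smul_mem c hX

theorem inflate_irreducible_iff : (inflate V).Irreducible ↔ V.Irreducible := by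
  rw [FDMod.irreducible_iff, FDMod.irreducible_iff]
  exact and_congr_right fun _ => forall_congr' fun Q => imp_congr_left (stable_inflate_iff V Q)

/-- A linear equivalence commuting with the `z^α ∂_j` is an equivalence of `W_n^+`-modules. -/
def wplusEquiv {U U' : FDMod.{u} (WPlus n)} (φ : U ≃ₗ[ℂ] U')
    (hφ : ∀ α j v, φ (U.rep (zPlus α j) v) = U'.rep (zPlus α j) (φ v)) : U ≃ₗ⁅ℂ,WPlus n⁆ U' :=
  { φ with
    map_lie' := fun {X v} => by
      change φ (U.rep X v) = U'.rep X (φ v)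
      induction X using zPlus_induction with
      | hz α j => exact hφ α j v
      | h0 => rw [map_zero, map_zero, LinearMap.zero_apply, LinearMap.zero_apply, map_zero]
      | hadd X Y hX hY =>
        rw [map_add, map_add, LinearMap.add_apply, LinearMap.add_apply, map_add, hX, hY]
      | hsmul c X hX =>
        rw [map_smul, map_smul, LinearMap.smul_apply, LinearMap.smul_apply, map_smul, hX] }

variable {V} {V' : FDMod.{u} (Gl n)}

theorem inflate_equiv_iff :
    Nonempty (inflate V ≃ₗ⁅ℂ,WPlus n⁆ inflate V') ↔ Nonempty (V ≃ₗ⁅ℂ,Gl n⁆ V') := by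
  constructor
  · rintro ⟨e⟩
    let φ : V ≃ₗ[ℂ] V' := e.toLinearEquiv
    refine ⟨{ φ with map_lie' := fun {x v} => ?_ }⟩
    change φ (V.rep x v) = V'.rep x (φ v)
    rw [eq_sum_linPart x]
    simp only [map_sum, map_smul, LinearMap.sum_apply, LinearMap.smul_apply]
    refine Finset.sum_congr rfl fun p _ => Finset.sum_congr rfl fun j _ => ?_
    have h1 := e.map_lie (zPlus ⟨Finsupp.single p 1, by simp⟩ j) v
    have h2 := rep_inflate_zPlus V ⟨Finsupp.single p 1, by simp⟩ j v
    have h3 := rep_inflate_zPlus V' ⟨Finsupp.single p 1, by simp⟩ j (φ v)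
    rw [← h2, ← h3]
    exact congrArg _ h1
  · rintro ⟨e⟩
    let φ : V ≃ₗ[ℂ] V' := e.toLinearEquiv
    refine ⟨wplusEquiv (U := inflate V) (U' := inflate V') φ fun α j v => ?_⟩
    have h2 := rep_inflate_zPlus V α j v
    have h3 := rep_inflate_zPlus V' α j (φ v)
    exact (congrArg φ h2).trans ((e.map_lie _ v).trans h3.symm)

theorem powFact_single (s : Fin n → ℤ) (p : Fin n) : powFact s (Finsupp.single p 1) = s p := by
  classical
  have := powFact_add_single s 0 p
  simpa [powFact_zero_right] using this

theorem jetOps_inflate (lam : Fin n → ℂ) (j : Fin n) (s : Fin n → ℤ) (v : V) :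
    jetOps lam (inflate V).rep j s v =
      (lam j • v + ∑ p, (s p : ℂ) • ⁅(Matrix.single p j 1 : Gl n), v⁆ : V) := by
  classical
  let ι : Fin n ↪ PosIndex n := ⟨fun p => ⟨Finsupp.single p 1, by simp⟩, fun p q h =>
    single_one_injective (congrArg Subtype.val h)⟩
  have h : ∑ᶠ β : PosIndex n, powFact s β.1 • V.rep (linPart j β.1) v =
      ∑ p, (s p : ℂ) • ⁅(Matrix.single p j 1 : Gl n), v⁆ := by
    rw [finsum_eq_sum_of_support_subset (s := Finset.univ.map ι), Finset.sum_map]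
    · refine Finset.sum_congr rfl fun p _ => ?_
      change powFact s (Finsupp.single p 1) • V.rep (linPart j (Finsupp.single p 1)) v = _
      rw [powFact_single, linPart_single]
      rfl
    · intro β hβ
      by_contra h
      refine hβ ?_
      change powFact s β.1 • V.rep (linPart j β.1) v = 0
      rw [linPart_eq_zero, map_zero, LinearMap.zero_apply, smul_zero]
      intro p hp
      exact h (Finset.mem_coe.2 (Finset.mem_map.2 ⟨p, Finset.mem_univ _, Subtype.ext hp.symm⟩))
  rw [← h]
  refine (jetOps_apply (U := inflate V) lam (inflate V).rep j s v).trans ?_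
  exact congrArg (fun w : V => lam j • v + w)
    (finsum_congr fun β => congrArg (powFact s β.1 • ·) (rep_inflate_zPlus V β j v))

theorem isTensorFieldModule_iff {lam : Fin n → ℂ} {J : JMod.{u} n} :
    IsTensorFieldModule lam V J ↔ IsJetTensor lam (inflate V) J := by
  rw [isJetTensor_iff]
  have key : ∀ (Φ : (TorusFun n ⊗[ℂ] V) ≃ₗ[TorusFun n] J) (j : Fin n) (s m : Fin n → ℤ) (v : V),
      Φ (((m j : ℂ) + lam j) • (fexp (m + s) ⊗ₜ[ℂ] v)
          + ∑ p, (s p : ℂ) • (fexp (m + s) ⊗ₜ[ℂ] ⁅(Matrix.single p j 1 : Gl n), v⁆)) =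
        (m j : ℂ) • Φ (fexp (m + s) ⊗ₜ[ℂ] v) + Φ (fexp (m + s) ⊗ₜ[ℂ]
          (lam j • v + ∑ p, (s p : ℂ) • ⁅(Matrix.single p j 1 : Gl n), v⁆)) := by
    intro Φ j s m v
    rw [TensorProduct.tmul_add, map_add, map_add, add_smul, map_add,
      TensorProduct.tmul_smul, add_assoc, TensorProduct.tmul_sum]
    simp only [TensorProduct.tmul_smul]
    congr 1
    exact LinearMap.map_smul_of_tower Φ.toLinearMap _ _
  constructor
  · rintro ⟨Φ, hΦ⟩
    refine ⟨⟨Φ, fun j s m v => ?_⟩⟩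
    refine ((hΦ j s m v).trans (key Φ j s m v)).trans ?_
    exact congrArg (fun w : V => (m j : ℂ) • Φ (fexp (m + s) ⊗ₜ[ℂ] v) + Φ (fexp (m + s) ⊗ₜ[ℂ] w))
      (jetOps_inflate lam j s v).symm
  · rintro ⟨M⟩
    let Φ : (TorusFun n ⊗[ℂ] V) ≃ₗ[TorusFun n] J := M.equiv
    refine ⟨Φ, fun j s m v => (M.lie_equiv j s m v).trans (Eq.trans ?_ (key Φ j s m v).symm)⟩
    exact congrArg (fun w : V => (m j : ℂ) • Φ (fexp (m + s) ⊗ₜ[ℂ] v) + Φ (fexp (m + s) ⊗ₜ[ℂ] w))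
      (jetOps_inflate lam j s v)

end Inflation

/-! ### The linear vector fields -/

/-- The embedding of `gl_n` into `W_n^+` as the linear vector fields, `E^p_j ↦ z_p ∂_j`. -/
def glEmbedLin : Gl n →ₗ[ℂ] WPlus n where
  toFun x := ∑ p, ∑ j, x p j • zPlus ⟨Finsupp.single p 1, by simp⟩ j
  map_add' x y := by
    simp only [Matrix.add_apply, add_smul, Finset.sum_add_distrib]
  map_smul' c x := by
    simp only [Matrix.smul_apply, smul_assoc, Finset.smul_sum, RingHom.id_apply]

theorem glEmbedLin_X (x : Gl n) (k : Fin n) :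
    (glEmbedLin x).1 (MvPolynomial.X k) = ∑ p, x p k • MvPolynomial.X p := by
  classical
  have h1 : (glEmbedLin x).1 = ∑ p, ∑ j, x p j • zField (Finsupp.single p 1) j := by
    have : (glEmbedLin x).1 = (WPlus n).toSubmodule.subtype (glEmbedLin x) := rfl
    rw [this, glEmbedLin]
    simp only [LinearMap.coe_mk, AddHom.coe_mk, map_sum, map_smul]
    rfl
  rw [h1]
  simp only [← Derivation.coeFnAddMonoidHom_apply, map_sum, Finset.sum_apply]
  refine Finset.sum_congr rfl fun p _ => ?_
  rw [Finset.sum_eq_single k]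
  · rw [Derivation.coeFnAddMonoidHom_apply, Derivation.smul_apply, zField, Derivation.smul_apply,
      MvPolynomial.pderiv_X_self, smul_eq_mul, mul_one]
    rfl
  · intro j _ hj
    rw [Derivation.coeFnAddMonoidHom_apply, Derivation.smul_apply, zField, Derivation.smul_apply,
      MvPolynomial.pderiv_X_of_ne (Ne.symm hj), smul_zero, smul_zero]
  · simp

/-- The embedding of `gl_n` into `W_n^+` as a homomorphism of Lie algebras. -/
def glEmbed : Gl n →ₗ⁅ℂ⁆ WPlus n :=
  { glEmbedLin with
    map_lie' := fun {x y} => by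
      change glEmbedLin ⁅x, y⁆ = ⁅glEmbedLin x, glEmbedLin y⁆
      refine Subtype.ext (MvPolynomial.derivation_ext fun k => ?_)
      change _ = ⁅(glEmbedLin x).1, (glEmbedLin y).1⁆ (MvPolynomial.X k)
      rw [glEmbedLin_X, Derivation.commutator_apply, glEmbedLin_X, glEmbedLin_X]
      have h1 : ∀ x y : Gl n, (glEmbedLin x).1 (∑ p, y p k • MvPolynomial.X p) =
          ∑ q, (x * y) q k • MvPolynomial.X q := by
        intro x y
        rw [map_sum]
        simp only [Derivation.map_smul, glEmbedLin_X, Finset.smul_sum, smul_smul,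
          Matrix.mul_apply, Finset.sum_smul]
        rw [Finset.sum_comm]
        simp only [mul_comm]
      rw [h1, h1, ← Finset.sum_sub_distrib]
      refine Finset.sum_congr rfl fun q _ => ?_
      rw [← sub_smul, LieRing.of_associative_ring_bracket, Matrix.sub_apply] }

theorem glEmbed_single (p j : Fin n) :
    glEmbed (Matrix.single p j 1) = zPlus ⟨Finsupp.single p 1, by simp⟩ j := by
  classical
  change ∑ a, ∑ b, (Matrix.single p j 1 : Gl n) a b • zPlus ⟨Finsupp.single a 1, by simp⟩ b = _
  rw [Finset.sum_eq_single p, Finset.sum_eq_single j]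
  · rw [Matrix.single_apply_same, one_smul]
  · intro b _ hb
    rw [Matrix.single_apply_of_ne _ _ _ _ _ (by tauto), zero_smul]
  · simp
  · intro a _ ha
    refine Finset.sum_eq_zero fun b _ => ?_
    rw [Matrix.single_apply_of_ne _ _ _ _ _ (by tauto), zero_smul]
  · simp

/-! ### Fields vanishing to second order act trivially on irreducible modules -/

variable (U : FDMod.{u} (WPlus n))

theorem rep_zPlus_comm (α β : PosIndex n) (j k : Fin n) (v : U) :
    U.rep (zPlus α j) (U.rep (zPlus β k) v) =
      (β.1 j : ℂ) • U.rep (zPlus ⟨α.1 + (β.1 - Finsupp.single j 1), add_tsub_ne_zero α.2 _⟩ k) v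
      - (α.1 k : ℂ) • U.rep (zPlus ⟨β.1 + (α.1 - Finsupp.single k 1), add_tsub_ne_zero β.2 _⟩ j) v
      + U.rep (zPlus β k) (U.rep (zPlus α j) v) := by
  have h := LinearMap.congr_fun (congrArg U.rep (zPlus_lie α β j k)) v
  rw [LieHom.map_lie, LieRing.of_associative_ring_bracket, map_sub, map_smul, map_smul] at h
  simp only [LinearMap.sub_apply, Module.End.mul_apply, LinearMap.smul_apply] at h
  rw [← h, sub_add_cancel]

/-- The vectors annihilated by the fields vanishing to second order. -/
def quadraticInvariants : Submodule ℂ U where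
  carrier := {v | ∀ (α : PosIndex n) (j : Fin n), 2 ≤ α.1.degree → U.rep (zPlus α j) v = 0}
  add_mem' ha hb α j h := by rw [map_add, ha α j h, hb α j h, add_zero]
  zero_mem' α j _ := map_zero _
  smul_mem' c v hv α j h := by rw [map_smul, hv α j h, smul_zero]

/-- The fields of degree at least two form an ideal: bracketing with `z^β ∂_k`, `|β| ≥ 1`, does not
lower the degree. -/
theorem quadraticInvariants_stable (X : WPlus n) {v : U} (hv : v ∈ quadraticInvariants U) :
    U.rep X v ∈ quadraticInvariants U := by
  induction X using zPlus_induction with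
  | h0 => rw [map_zero]; exact Submodule.zero_mem _
  | hadd X Y hX hY => rw [map_add]; exact Submodule.add_mem _ hX hY
  | hsmul c X hX => rw [map_smul]; exact Submodule.smul_mem _ c hX
  | hz β k =>
    intro α j hα
    rw [rep_zPlus_comm, hv α j hα, map_zero, add_zero, hv _ k (by
      change 2 ≤ Finsupp.degree (α.1 + (β.1 - Finsupp.single j 1))
      rw [map_add]
      omega), smul_zero, zero_sub, neg_eq_zero]
    by_cases h : α.1 k = 0
    · rw [h, Nat.cast_zero, zero_smul]
    · rw [hv _ j ?_, smul_zero]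
      change 2 ≤ Finsupp.degree (β.1 + (α.1 - Finsupp.single k 1))
      have h1 : Finsupp.single k 1 ≤ α.1 := by rw [Finsupp.single_le_iff]; omega
      have h2 := congrArg Finsupp.degree (add_tsub_cancel_of_le h1)
      rw [map_add, Finsupp.degree_single] at h2
      have h3 : Finsupp.degree β.1 ≠ 0 := fun h => β.2 ((Finsupp.degree_eq_zero_iff β.1).1 h)
      rw [map_add]
      omega

/-- The operator `z^α ∂_j` raises Euler eigenvalues by `|α| - 1 ≥ 1`, so it kills an eigenvector
whose eigenvalue has maximal real part. -/
theorem quadraticInvariants_ne_bot [Nontrivial U] : quadraticInvariants U ≠ ⊥ := by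
  let E := U.rep (euler n)
  have hfin : {μ | E.HasEigenvalue μ}.Finite := E.finite_hasEigenvalue
  obtain ⟨μ, hμ, hmax⟩ := Set.exists_max_image {μ | E.HasEigenvalue μ} Complex.re hfin
    (Module.End.exists_eigenvalue E)
  obtain ⟨v, hv, hv0⟩ := hμ.exists_hasEigenvector
  rw [Module.End.mem_eigenspace_iff] at hv
  refine (Submodule.ne_bot_iff _).2 ⟨v, fun α j hα => ?_, hv0⟩
  by_contra h0
  have h1 : E (U.rep (zPlus α j) v) = ((α.1.degree : ℂ) - 1 + μ) • U.rep (zPlus α j) v := by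
    have h := LinearMap.congr_fun (congrArg U.rep (euler_lie α j)) v
    rw [LieHom.map_lie, LieRing.of_associative_ring_bracket, map_smul] at h
    simp only [LinearMap.sub_apply, Module.End.mul_apply, LinearMap.smul_apply] at h
    change E (U.rep (zPlus α j) v) - U.rep (zPlus α j) (E v) = _ at h
    rw [hv, map_smul, sub_eq_iff_eq_add] at h
    rw [h, add_smul]
  have h2 := hmax _ (Module.End.hasEigenvalue_of_hasEigenvector
    ⟨Module.End.mem_eigenspace_iff.2 h1, h0⟩)
  have h3 : (2 : ℝ) ≤ α.1.degree := by exact_mod_cast hα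
  simp only [Complex.add_re, Complex.sub_re, Complex.natCast_re, Complex.one_re] at h2
  linarith

variable {U}

theorem FDMod.Irreducible.rep_eq_zero (hU : U.Irreducible) {α : PosIndex n}
    (hα : 2 ≤ α.1.degree) (j : Fin n) (v : U) : U.rep (zPlus α j) v = 0 := by
  rw [FDMod.irreducible_iff] at hU
  have := hU.1
  rcases hU.2 (quadraticInvariants U) fun X v hv => quadraticInvariants_stable U X hv with h | h
  · exact absurd h (quadraticInvariants_ne_bot U)
  · have hv : v ∈ quadraticInvariants U := by rw [h]; trivial
    exact hv α j hα

/-- Restrict to the linear fields along `glEmbed`; inflating back recovers `U` because all higher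
fields act by zero. -/
theorem FDMod.Irreducible.exists_inflate (hU : U.Irreducible) :
    ∃ V : FDMod.{u} (Gl n), Nonempty (U ≃ₗ⁅ℂ,WPlus n⁆ inflate V) := by
  let V : FDMod.{u} (Gl n) := FDMod.ofRep (U.rep.comp glEmbed)
  refine ⟨V, ⟨wplusEquiv (U := U) (U' := inflate V) (LinearEquiv.refl ℂ U) fun α j v => ?_⟩⟩
  refine Eq.trans ?_ (rep_inflate_zPlus V α j v).symm
  change U.rep (zPlus α j) v = U.rep (glEmbed (linPart j α.1)) v
  by_cases h : ∃ p, α.1 = Finsupp.single p 1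
  · obtain ⟨p, hp⟩ := h
    obtain ⟨α, hα⟩ := α
    dsimp only at hp
    subst hp
    rw [linPart_single, glEmbed_single]
  · push Not at h
    rw [linPart_eq_zero h, map_zero, map_zero, LinearMap.zero_apply]
    refine hU.rep_eq_zero ?_ j v
    -- A nonzero multi-index of degree less than two is some `ε_p`, which is excluded.
    by_contra hlt
    have h1 : Finsupp.degree α.1 ≠ 0 := fun h => α.2 ((Finsupp.degree_eq_zero_iff α.1).1 h)
    obtain ⟨p, hp⟩ := Finsupp.ne_iff.1 α.2
    rw [Finsupp.zero_apply] at hp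
    have hle : Finsupp.single p 1 ≤ α.1 := by rw [Finsupp.single_le_iff]; omega
    obtain ⟨γ, hγ⟩ := exists_add_of_le hle
    have h2 := congrArg Finsupp.degree hγ
    rw [map_add, Finsupp.degree_single] at h2
    rw [(Finsupp.degree_eq_zero_iff γ).1 (by omega), add_zero] at hγ
    exact h p hγ

end Irreducible

theorem JMod.Irreducible.indecomposable {J : JMod.{u} n} (hJ : J.Irreducible) :
    J.Indecomposable := by
  refine ⟨hJ.1, fun P Q hP hQ hc => ?_⟩
  rcases hJ.2 P hP with h | h
  · exact Or.inl h
  · right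
    rw [← hc.inf_eq_bot, h, top_inf_eq]

end JetModules

end

/-! ### Assembly of the structure theorem and the two bijections -/

theorem theorem3 (n : ℕ) :
    -- (a)
    (∀ J : JMod.{u} n, J.Indecomposable →
      (∃ lam : Fin n → ℂ, J.weightSpace lam ≠ ⊥) ∧
      ∀ lam : Fin n → ℂ, J.weightSpace lam ≠ ⊥ →
        FiniteDimensional ℂ (J.weightSpace lam) ∧
        (∃ Φ : (TorusFun n ⊗[ℂ] J.weightSpace lam) ≃ₗ[TorusFun n] J,
          ∀ (f : TorusFun n) (v : J.weightSpace lam), Φ (f ⊗ₜ[ℂ] v) = f • (v : J)) ∧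
        (∃! D : Fin n → (Fin n → ℤ) → Module.End ℂ (J.weightSpace lam), IsStructureOps J lam D) ∧
        ∀ D : Fin n → (Fin n → ℤ) → Module.End ℂ (J.weightSpace lam), IsStructureOps J lam D →
          (∃! T : Fin n → ((Fin n →₀ ℕ) →₀ Module.End ℂ (J.weightSpace lam)),
            IsTaylorExpansion D T) ∧
          ∀ T : Fin n → ((Fin n →₀ ℕ) →₀ Module.End ℂ (J.weightSpace lam)),
            IsTaylorExpansion D T →
              (∀ j, T j 0 = lam j • (1 : Module.End ℂ (J.weightSpace lam))) ∧
              ∃! ρ : WPlus n →ₗ⁅ℂ⁆ Module.End ℂ (J.weightSpace lam),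
                ∀ (α : PosIndex n) (j : Fin n), ρ (zPlus α j) = T j α.1) ∧
    -- (b)
    (∀ (U : FDMod.{u} (WPlus n)) (j : Fin n),
      {β : PosIndex n | ∃ v : U, ⁅zPlus β j, v⁆ ≠ 0}.Finite) ∧
    (∃ e : WeightCoset n × FDMod.IsoClass.{u} (L := WPlus n) FDMod.Indecomposable ≃
        JMod.IsoClass.{u} (n := n) JMod.Indecomposable,
      ∀ (lam : Fin n → ℂ) (U : {U : FDMod.{u} (WPlus n) // U.Indecomposable})
        (J : {J : JMod.{u} n // J.Indecomposable}),
        e (QuotientAddGroup.mk lam, FDMod.isoClass U) = JMod.isoClass J ↔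
          IsJetTensor lam U.1 J.1) ∧
    -- (c)
    (∃ e : WeightCoset n × FDMod.IsoClass.{u} (L := Gl n) FDMod.Irreducible ≃
        JMod.IsoClass.{u} (n := n) JMod.Irreducible,
      ∀ (lam : Fin n → ℂ) (V : {V : FDMod.{u} (Gl n) // V.Irreducible})
        (J : {J : JMod.{u} n // J.Irreducible}),
        e (QuotientAddGroup.mk lam, FDMod.isoClass V) = JMod.isoClass J ↔
          IsTensorFieldModule lam V.1 J.1) := by
  refine ⟨fun J hJ => ⟨?_, fun lam hlam => ?_⟩, fun U j => ?_, ?_, ?_⟩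
  · have := hJ.1
    exact J.exists_weightSpace_ne_bot
  · have hfin := hJ.finiteDimensional hlam
    refine ⟨hfin, ⟨hJ.weightEquiv hlam, JMod.weightMap_tmul lam⟩,
      ⟨J.structOps lam, J.isStructureOps_structOps lam,
        fun D hD => hD.unique (J.isStructureOps_structOps lam)⟩, fun D hD => ⟨?_, fun T hT =>
        ⟨hD.taylor_zero hT, hD.existsUnique_rep hT⟩⟩⟩
    obtain ⟨T, hT⟩ := hD.isJetFamily.exists_taylorExpansion
    exact ⟨T, hT, fun T' hT' => hT'.unique hT⟩
  · refine (finite_setOf_ne_zero U.rep j).subset fun β ⟨v, hv⟩ h => hv ?_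
    exact LinearMap.congr_fun h v
  · obtain ⟨e, he⟩ := exists_quotient_equiv (n := n)
      (FDMod.isoSetoid FDMod.Indecomposable) (JMod.isoSetoid JMod.Indecomposable)
      (fun lam U J => IsJetTensor lam U.1 J.1)
      (fun lam U => by
        obtain ⟨J, hJ⟩ := IsJetTensor.exists_of_rep lam U.1
        exact ⟨⟨J, hJ.indecomposable_iff.2 U.2⟩, hJ⟩)
      (fun J => by
        have := J.2.1
        obtain ⟨lam, hlam⟩ := J.1.exists_weightSpace_ne_bot
        obtain ⟨U, hU⟩ := J.2.exists_isJetTensor hlam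
        exact ⟨lam, ⟨U, hU.indecomposable_iff.1 J.2⟩, hU⟩)
      (fun lam U J lam' U' J' h h' => by
        have := U'.2.1
        constructor
        · intro hJ
          -- With both structures on one module, the weights agree modulo `ℤⁿ`; after shifting to
          -- the same representative the fibres are isomorphic.
          have h1 := h.of_iso hJ
          have h2 := h1.sub_mem h'
          exact ⟨h2, (h1.shift h2).nonempty_equiv h'⟩
        · rintro ⟨hl, ⟨f⟩⟩
          exact ((h.shift hl).of_equiv f).iso h')
      (fun lam U J J' h hJ => h.of_iso hJ)
    exact ⟨e, he⟩
  · obtain ⟨e, he⟩ := exists_quotient_equiv (n := n)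
      (FDMod.isoSetoid FDMod.Irreducible) (JMod.isoSetoid JMod.Irreducible)
      (fun lam V J => IsTensorFieldModule lam V.1 J.1)
      (fun lam V => by
        obtain ⟨J, hJ⟩ := IsJetTensor.exists_of_rep lam (inflate V.1)
        exact ⟨⟨J, hJ.irreducible_iff.2 ((inflate_irreducible_iff V.1).2 V.2)⟩,
          isTensorFieldModule_iff.2 hJ⟩)
      (fun J => by
        have := J.2.1
        obtain ⟨lam, hlam⟩ := J.1.exists_weightSpace_ne_bot
        -- An irreducible `J` comes from some `W_n^+`-module `U`; `U` is then irreducible, hence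
        -- inflated from `gl_n`.
        obtain ⟨U, hU⟩ := J.2.indecomposable.exists_isJetTensor hlam
        have hUirr := hU.irreducible_iff.1 J.2
        obtain ⟨V, ⟨f⟩⟩ := hUirr.exists_inflate
        have hV := hU.of_equiv f
        exact ⟨lam, ⟨V, (inflate_irreducible_iff V).1 (hV.irreducible_iff.1 J.2)⟩,
          isTensorFieldModule_iff.2 hV⟩)
      (fun lam V J lam' V' J' h h' => by
        rw [isTensorFieldModule_iff] at h h'
        have : Nontrivial (inflate V'.1) :=
          ((inflate V'.1).irreducible_iff.1 ((inflate_irreducible_iff V'.1).2 V'.2)).1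
        constructor
        · intro hJ
          have h1 := h.of_iso hJ
          have h2 := h1.sub_mem h'
          exact ⟨h2, inflate_equiv_iff.1 ((h1.shift h2).nonempty_equiv h')⟩
        · rintro ⟨hl, hf⟩
          obtain ⟨f⟩ := inflate_equiv_iff.2 hf
          exact ((h.shift hl).of_equiv f).iso h')
      (fun lam V J J' h hJ => by
        rw [isTensorFieldModule_iff] at h ⊢
        exact h.of_iso hJ)
    exact ⟨e, he⟩
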